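/- Let $\ell \ne p$ be primes with $p \ge 3$ and $\ell \not\equiv 1 \pmod p$. For $q \in \mathbb{Q}_\ell$ with $0 < |q|_\ell < 1$ let $E_q$ be the elliptic curve over $\mathbb{Q}_\ell$ given by $$y^2 + xy = x^3 + a_4(q)\,x + a_6(q), \qquad a_4(q) = -5 s_3(q), \quad a_6(q) = -\frac{5 s_3(q) + 7 s_5(q)}{12}, \qquad s_k(q) = \sum_{n \ge 1} \frac{n^k q^n}{1 - q^n}.$$ A Tate curve over $\mathbb{Q}_\ell$ with Tate parameter $q$ is an elliptic curve over $\mathbb{Q}_\ell$ that is isomorphic over $\mathbb{Q}_\ell$ to $E_q$. Let $E_1$ and $E_2$ be Tate curves over $\mathbb{Q}_\ell$ with Tate parameters $q_1$ and $q_2$. Write $e_1 = v_\ell(q_1)$ and $e_2 = v_\ell(q_2)$, where $v_\ell$ is the normalized valuation, and suppose that $p \nmid e_1 e_2$. Let $G_{\mathbb{Q}_\ell} = \mathrm{Gal}(\overline{\mathbb{Q}}_\ell/\mathbb{Q}_\ell)$ and let $E_i[p] \subset E_i(\overline{\mathbb{Q}}_\ell)$ be the $p$-torsion subgroup. Then $E_1[p]$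 and $E_2[p]$ are isomorphic as $G_{\mathbb{Q}_\ell}$-modules. -/

import Mathlib

noncomputable section

namespace TateCurve

open WeierstrassCurve

section Torsion

variable {K : Type*} [Field K]

open scoped Classical in
/-- The group of points of `E` over the algebraic closure of `K`. -/
abbrev GeomPoints (E : WeierstrassCurve K) : Type _ :=
  (E.baseChange (AlgebraicClosure K)).toAffine.Point

open scoped Classical in
instance instAddCommGroupGeomPoints (E : WeierstrassCurve K) : AddCommGroup (GeomPoints E) :=
  inferInstanceAs (AddCommGroup (E.baseChange (AlgebraicClosure K)).toAffine.Point)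

/-- The absolute Galois group of `K` acts on the points of `E` over the algebraic closure of `K`,
through the coordinates. -/
instance instGaloisActionGeomPoints (E : WeierstrassCurve K) :
    DistribMulAction (AlgebraicClosure K ≃ₐ[K] AlgebraicClosure K) (GeomPoints E) where
  smul σ P := by
    classical
    exact Affine.Point.map (W' := E.toAffine) (σ : AlgebraicClosure K →ₐ[K] AlgebraicClosure K) P
  one_smul P := by
    cases P <;> rfl
  mul_smul σ τ P := by
    cases P <;> rfl
  smul_zero σ := rfl
  smul_add σ P Q := by
    classical
    exact map_add (Affine.Point.map (W' := E.toAffine)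
      (σ : AlgebraicClosure K →ₐ[K] AlgebraicClosure K)) P Q

/-- `E[n]`: the `n`-torsion subgroup of the points of `E` over the algebraic closure of `K`. -/
abbrev Torsion (E : WeierstrassCurve K) (n : ℕ) : AddSubgroup (GeomPoints E) :=
  AddSubgroup.torsionBy (GeomPoints E) (n : ℤ)

/-- `E[n]` is stable under the absolute Galois group, hence is a Galois module. -/
instance instGaloisActionTorsion (E : WeierstrassCurve K) (n : ℕ) :
    DistribMulAction (AlgebraicClosure K ≃ₐ[K] AlgebraicClosure K) (Torsion E n) where
  smul σ P := ⟨σ • (P : GeomPoints E), by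
    have h : (n : ℤ) • (P : GeomPoints E) = 0 := P.2
    change (n : ℤ) • (σ • (P : GeomPoints E)) = 0
    have e := map_zsmul (DistribSMul.toAddMonoidHom (GeomPoints E) σ) (n : ℤ) (P : GeomPoints E)
    simp only [DistribSMul.toAddMonoidHom_apply] at e
    rw [← e, h, smul_zero]⟩
  one_smul P := Subtype.ext (one_smul _ _)
  mul_smul σ τ P := Subtype.ext (mul_smul _ _ _)
  smul_zero σ := Subtype.ext (smul_zero _)
  smul_add σ P Q := Subtype.ext (smul_add _ _ _)

end Torsion

variable {ℓ : ℕ} [Fact ℓ.Prime]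

/-- The Lambert series `s_k(q) = ∑_{n ≥ 1} n^k q^n / (1 - q^n)`. -/
def lambert (k : ℕ) (q : ℚ_[ℓ]) : ℚ_[ℓ] :=
  ∑' n : ℕ, ((n : ℚ_[ℓ]) + 1) ^ k * q ^ (n + 1) / (1 - q ^ (n + 1))

/-- The Weierstrass equation `y² + x y = x³ + a₄(q) x + a₆(q)` of the Tate curve `E_q`, where
`a₄(q) = -5 s₃(q)` and `a₆(q) = -(5 s₃(q) + 7 s₅(q)) / 12`. -/
def equation (q : ℚ_[ℓ]) : WeierstrassCurve ℚ_[ℓ] where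
  a₁ := 1
  a₂ := 0
  a₃ := 0
  a₄ := -5 * lambert 3 q
  a₆ := -(5 * lambert 3 q + 7 * lambert 5 q) / 12

/-- `E` is a Tate curve over `ℚ_ℓ` with Tate parameter `q`: here `0 < |q| < 1`, and `E` is
isomorphic over `ℚ_ℓ` to the curve `E_q`. -/
structure IsTateCurve (E : WeierstrassCurve ℚ_[ℓ]) (q : ℚ_[ℓ]) : Prop where
  ne_zero : q ≠ 0
  norm_lt_one : ‖q‖ < 1
  isom : ∃ C : VariableChange ℚ_[ℓ], C • E = equation q

end TateCurve

end

/-! ## Admissible changes of variables and groups of points -/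

noncomputable section

open WeierstrassCurve

namespace WeierstrassCurve.VariableChange

variable {F : Type*} [Field F] (C : VariableChange F) (W : WeierstrassCurve F)

/-! The `p`-torsion of a Tate curve is a non-split extension of `ℤ/p` by `μ_p`, and over `ℚ_ℓ` with
`ℓ ≠ p`, `ℓ ≢ 1 mod p` there is only one such Galois module. Indeed units of `ℤ_ℓ` are `p`-th
powers, so `H¹(G, μ_p) = ℚ_ℓˣ / p` is generated by the Kummer class of `ℓ`. A nonzero multiple of
that class gives the same module after rescaling the quotient `ℤ/p`. Both torsion modules are
therefore isomorphic to one explicit module on `μ_p × ℤ/p`.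

The Tate parametrization is not used. The only input about `E_q` is `|a₄| ≤ |a₆| = |q| < 1`
(`isNodal_equation`): the reduction is the node `y² + xy = x³`. The submodule consists of the
torsion points not reducing to the node. On them `y / (x + y)` is multiplicative modulo the maximal
ideal, which embeds them in `μ_p` (`exists_hom_rootsOfUnity`). Galois preserves absolute values, so
it acts trivially on components and `σP - P` is always in the submodule (`isSmooth_smul_sub`).

Three facts then determine the module through `exists_addEquiv_prod_of_cocycle`, without computing
the order of `E[p]`. Some torsion point reduces to the node, because the division polynomial has
unit leading coefficient and small constant term (`exists_nsmul_eq_zero_not_isSmooth`); this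
requires knowing that roots of division polynomials are torsion points, proved with elliptic
divisibility sequences. There is no rational `p`-torsion, since the component group over `ℚ_ℓ` has
order `v(q)`, prime to `p`, and `𝔽_ℓˣ` has no `p`-torsion (`eq_zero_of_fixed`). Every cocycle `σ ↦
σP - P` is a multiple of the Kummer cocycle of `ℓ` up to a coboundary (`exists_zsmul_kummer`). -/

lemma equation_smul_iff (x y : F) : (C • W).toAffine.Equation x y ↔
    W.toAffine.Equation (C.u ^ 2 * x + C.r) (C.u ^ 3 * y + C.s * C.u ^ 2 * x + C.t) := by
  have hu : (C.u : F) ≠ 0 := C.u.ne_zero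
  have key : (C.u : F) ^ 6 * (y ^ 2 + (C • W).a₁ * x * y + (C • W).a₃ * y -
      (x ^ 3 + (C • W).a₂ * x ^ 2 + (C • W).a₄ * x + (C • W).a₆)) =
      (C.u ^ 3 * y + C.s * C.u ^ 2 * x + C.t) ^ 2 +
        W.a₁ * (C.u ^ 2 * x + C.r) * (C.u ^ 3 * y + C.s * C.u ^ 2 * x + C.t) +
        W.a₃ * (C.u ^ 3 * y + C.s * C.u ^ 2 * x + C.t) -
      ((C.u ^ 2 * x + C.r) ^ 3 + W.a₂ * (C.u ^ 2 * x + C.r) ^ 2 + W.a₄ * (C.u ^ 2 * x + C.r) +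
        W.a₆) := by
    simp only [variableChange_def, Units.val_inv_eq_inv_val]
    field_simp
    ring
  rw [Affine.equation_iff', Affine.equation_iff', ← key, mul_eq_zero, pow_eq_zero_iff (by simp)]
  simp [hu]

/-- The partial derivatives transform triangularly: `W_Y` is scaled by `u³`, and `u⁴` times the new
`W_X` is the old `W_X` plus `s` times the old `W_Y`. Hence they vanish together. -/
lemma nonsingular_smul_iff (x y : F) : (C • W).toAffine.Nonsingular x y ↔
    W.toAffine.Nonsingular (C.u ^ 2 * x + C.r) (C.u ^ 3 * y + C.s * C.u ^ 2 * x + C.t) := by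
  have hu : (C.u : F) ≠ 0 := C.u.ne_zero
  have keyY : (C.u : F) ^ 3 * (2 * y + (C • W).a₁ * x + (C • W).a₃) =
      2 * (C.u ^ 3 * y + C.s * C.u ^ 2 * x + C.t) + W.a₁ * (C.u ^ 2 * x + C.r) + W.a₃ := by
    simp only [variableChange_def, Units.val_inv_eq_inv_val]
    field_simp
    ring
  have keyX : (C.u : F) ^ 4 * ((C • W).a₁ * y - (3 * x ^ 2 + 2 * (C • W).a₂ * x + (C • W).a₄)) =
      W.a₁ * (C.u ^ 3 * y + C.s * C.u ^ 2 * x + C.t) -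
        (3 * (C.u ^ 2 * x + C.r) ^ 2 + 2 * W.a₂ * (C.u ^ 2 * x + C.r) + W.a₄) +
      C.s * (2 * (C.u ^ 3 * y + C.s * C.u ^ 2 * x + C.t) + W.a₁ * (C.u ^ 2 * x + C.r) + W.a₃) := by
    simp only [variableChange_def, Units.val_inv_eq_inv_val]
    field_simp
    ring
  rw [Affine.nonsingular_iff', Affine.nonsingular_iff', equation_smul_iff, ← keyY]
  refine and_congr_right fun _ ↦ ?_
  rw [mul_ne_zero_iff, ← not_iff_not]
  simp only [not_or, not_not, ne_eq, pow_eq_zero_iff, hu, not_and, not_false_eq_true,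
    OfNat.ofNat_ne_zero, forall_true_left]
  refine and_congr_left fun h ↦ ?_
  rw [← keyY, h, mul_zero, mul_zero, add_zero] at keyX
  rw [← keyX, mul_eq_zero, pow_eq_zero_iff (by simp)]
  simp [hu]

variable {C W} {W' : WeierstrassCurve F}

/-- The map on points given by the substitution of an admissible change of variables. -/
def mapPoint (h : C • W = W') : W'.toAffine.Point → W.toAffine.Point
  | .zero => .zero
  | .some x y hxy => .some (C.u ^ 2 * x + C.r) (C.u ^ 3 * y + C.s * C.u ^ 2 * x + C.t)
      ((nonsingular_smul_iff C W x y).mp (h ▸ hxy))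

lemma mapPoint_some (h : C • W = W') {x y : F} (hxy : W'.toAffine.Nonsingular x y) :
    mapPoint h (.some x y hxy) =
      .some (C.u ^ 2 * x + C.r) (C.u ^ 3 * y + C.s * C.u ^ 2 * x + C.t)
      ((nonsingular_smul_iff C W x y).mp (h ▸ hxy)) := rfl

lemma mapPoint_bijective (h : C • W = W') : Function.Bijective (mapPoint h) := by
  have hu : (C.u : F) ≠ 0 := C.u.ne_zero
  constructor
  · rintro (_ | ⟨x, y, h₁⟩) (_ | ⟨x', y', h₂⟩) hP
    · rfl
    · simp [mapPoint] at hP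
    · simp [mapPoint] at hP
    · simp only [mapPoint, Affine.Point.some.injEq, add_left_inj] at hP
      obtain ⟨hx, hy⟩ := hP
      have hx' : x = x' := mul_left_cancel₀ (pow_ne_zero 2 hu) hx
      subst hx'
      have hy' : y = y' := mul_left_cancel₀ (pow_ne_zero 3 hu) (add_right_cancel hy)
      subst hy'
      rfl
  · rintro (_ | ⟨x, y, h₁⟩)
    · exact ⟨.zero, rfl⟩
    · have hx : C.u ^ 2 * ((x - C.r) / C.u ^ 2) + C.r = x := by field_simp; ring
      have hy : C.u ^ 3 * ((y - C.t - C.s * (x - C.r)) / C.u ^ 3) +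
        C.s * C.u ^ 2 * ((x - C.r) / C.u ^ 2) + C.t = y := by field_simp; ring
      refine ⟨.some ((x - C.r) / C.u ^ 2) ((y - C.t - C.s * (x - C.r)) / C.u ^ 3) ?_, ?_⟩
      · rw [← h, nonsingular_smul_iff, hx, hy]
        exact h₁
      · rw [mapPoint_some]
        simp only [hx, hy]

variable [DecidableEq F]

lemma slope_substitution (h : C • W = W') {x₁ x₂ y₁ y₂ : F}
    (hxy : ¬(x₁ = x₂ ∧ y₁ = W'.toAffine.negY x₂ y₂))
    (h₁ : W'.toAffine.Equation x₁ y₁) (h₂ : W'.toAffine.Equation x₂ y₂) :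
    W.toAffine.slope (C.u ^ 2 * x₁ + C.r) (C.u ^ 2 * x₂ + C.r)
      (C.u ^ 3 * y₁ + C.s * C.u ^ 2 * x₁ + C.t) (C.u ^ 3 * y₂ + C.s * C.u ^ 2 * x₂ + C.t) =
    C.u * W'.toAffine.slope x₁ x₂ y₁ y₂ + C.s := by
  have hu : (C.u : F) ≠ 0 := C.u.ne_zero
  by_cases hx : x₁ = x₂
  · subst hx
    have hy : y₁ ≠ W'.toAffine.negY x₁ y₂ := fun h ↦ hxy ⟨rfl, h⟩
    obtain rfl := Affine.Y_eq_of_Y_ne h₁ h₂ rfl hy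
    have hd : y₁ - W'.toAffine.negY x₁ y₁ ≠ 0 := sub_ne_zero.mpr hy
    have key : C.u ^ 3 * y₁ + C.s * C.u ^ 2 * x₁ + C.t -
        W.toAffine.negY (C.u ^ 2 * x₁ + C.r) (C.u ^ 3 * y₁ + C.s * C.u ^ 2 * x₁ + C.t) =
        C.u ^ 3 * (y₁ - W'.toAffine.negY x₁ y₁) := by
      subst h
      simp only [Affine.negY, variableChange_def, Units.val_inv_eq_inv_val]
      field_simp
      ring
    have hd' : C.u ^ 3 * y₁ + C.s * C.u ^ 2 * x₁ + C.t ≠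
        W.toAffine.negY (C.u ^ 2 * x₁ + C.r) (C.u ^ 3 * y₁ + C.s * C.u ^ 2 * x₁ + C.t) := by
      rw [← sub_ne_zero, key]
      exact mul_ne_zero (pow_ne_zero _ hu) hd
    rw [Affine.slope_of_Y_ne rfl hy, Affine.slope_of_Y_ne rfl hd', key, mul_div_assoc',
      div_add' _ _ _ hd, div_eq_div_iff (mul_ne_zero (pow_ne_zero _ hu) hd) hd]
    subst h
    simp only [Affine.negY, variableChange_def, Units.val_inv_eq_inv_val]
    field_simp
    ring
  · have hx' : C.u ^ 2 * x₁ + C.r ≠ C.u ^ 2 * x₂ + C.r := fun h ↦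
      hx (mul_left_cancel₀ (pow_ne_zero 2 hu) (add_right_cancel h))
    have := sub_ne_zero.mpr hx
    rw [Affine.slope_of_X_ne hx, Affine.slope_of_X_ne hx']
    have h3 : C.u ^ 2 * x₁ + C.r - (C.u ^ 2 * x₂ + C.r) = C.u ^ 2 * (x₁ - x₂) := by ring
    rw [h3]
    field_simp
    ring

lemma mapPoint_add (h : C • W = W') (P Q : W'.toAffine.Point) :
    mapPoint h (P + Q) = mapPoint h P + mapPoint h Q := by
  have hu : (C.u : F) ≠ 0 := C.u.ne_zero
  rcases P with _ | ⟨x₁, y₁, h₁⟩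
  · change mapPoint h (0 + Q) = 0 + mapPoint h Q
    rw [zero_add, zero_add]
  rcases Q with _ | ⟨x₂, y₂, h₂⟩
  · change mapPoint h (Affine.Point.some x₁ y₁ h₁ + 0) = mapPoint h _ + 0
    rw [add_zero, add_zero]
  have hneg : C.u ^ 3 * W'.toAffine.negY x₂ y₂ + C.s * C.u ^ 2 * x₂ + C.t =
      W.toAffine.negY (C.u ^ 2 * x₂ + C.r) (C.u ^ 3 * y₂ + C.s * C.u ^ 2 * x₂ + C.t) := by
    subst h
    simp only [Affine.negY, variableChange_def, Units.val_inv_eq_inv_val]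
    field_simp
    ring
  by_cases hxy : x₁ = x₂ ∧ y₁ = W'.toAffine.negY x₂ y₂
  · rw [Affine.Point.add_of_Y_eq hxy.1 hxy.2, mapPoint_some, mapPoint_some,
      Affine.Point.add_of_Y_eq]
    · rfl
    · rw [hxy.1]
    · rw [← hneg, ← hxy.2, hxy.1]
  · have hxy' : ¬(C.u ^ 2 * x₁ + C.r = C.u ^ 2 * x₂ + C.r ∧
        C.u ^ 3 * y₁ + C.s * C.u ^ 2 * x₁ + C.t =
        W.toAffine.negY (C.u ^ 2 * x₂ + C.r) (C.u ^ 3 * y₂ + C.s * C.u ^ 2 * x₂ + C.t)) := by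
      rw [← hneg]
      rintro ⟨hx, hy⟩
      have hx' : x₁ = x₂ := mul_left_cancel₀ (pow_ne_zero 2 hu) (add_right_cancel hx)
      subst hx'
      exact hxy ⟨rfl, mul_left_cancel₀ (pow_ne_zero 3 hu) (add_right_cancel (add_right_cancel hy))⟩
    rw [Affine.Point.add_some hxy, mapPoint_some, mapPoint_some, mapPoint_some,
      Affine.Point.add_some hxy']
    simp only [Affine.Point.some.injEq]
    rw [slope_substitution h hxy h₁.1 h₂.1]
    generalize W'.toAffine.slope x₁ x₂ y₁ y₂ = l
    subst h
    constructor <;>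
    · simp only [Affine.addX, Affine.addY, Affine.negAddY, Affine.negY, variableChange_def,
        Units.val_inv_eq_inv_val]
      field_simp
      ring

/-- An admissible change of variables is an isomorphism of groups of points. -/
def pointEquiv (h : C • W = W') : W'.toAffine.Point ≃+ W.toAffine.Point :=
  { Equiv.ofBijective _ (mapPoint_bijective h) with map_add' := mapPoint_add h }

end WeierstrassCurve.VariableChange

end

/-! ## The `x`-coordinates of sums and differences -/

noncomputable section

open WeierstrassCurve

namespace WeierstrassCurve

variable {F : Type*} [Field F] (W : WeierstrassCurve F)

/-- The symmetric biquadratic form whose vanishing on the `x`-coordinates of three points says that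
`± P ± Q ± R = 0` for some choice of signs. -/
def biquadratic (x₁ x₂ x₃ : F) : F :=
  (x₁ - x₂) ^ 2 * x₃ ^ 2 -
    (2 * (x₁ + x₂) * (x₁ * x₂) + W.b₂ * (x₁ * x₂) + W.b₄ * (x₁ + x₂) + W.b₆) * x₃ +
    ((x₁ * x₂) ^ 2 - W.b₄ * (x₁ * x₂) - W.b₆ * (x₁ + x₂) - W.b₈)

lemma biquadratic_right_comm (x₁ x₂ x₃ : F) :
    W.biquadratic x₁ x₂ x₃ = W.biquadratic x₁ x₃ x₂ := by
  simp only [biquadratic]; ring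

lemma biquadratic_left_comm (x₁ x₂ x₃ : F) :
    W.biquadratic x₁ x₂ x₃ = W.biquadratic x₂ x₁ x₃ := by
  simp only [biquadratic]; ring

namespace Affine.Point

variable {W}

/-- The `x`-coordinate of a point, with the value `0` at infinity. -/
def xCoord : W.toAffine.Point → F
  | .zero => 0
  | .some x _ _ => x

/-- The value of `2y + a₁x + a₃` at a point, with the value `0` at infinity. -/
def psiTwo : W.toAffine.Point → F
  | .zero => 0
  | .some x y _ => 2 * y + W.a₁ * x + W.a₃

lemma xCoord_some {x y : F} (h : W.toAffine.Nonsingular x y) : xCoord (.some x y h) = x := rfl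

lemma psiTwo_some {x y : F} (h : W.toAffine.Nonsingular x y) :
    psiTwo (.some x y h) = 2 * y + W.a₁ * x + W.a₃ := rfl

lemma xCoord_neg (P : W.toAffine.Point) : xCoord (-P) = xCoord P := by
  cases P <;> rfl

lemma exists_eq_some {P : W.toAffine.Point} (hP : P ≠ 0) : ∃ x y h, P = .some x y h := by
  rcases P with _ | ⟨x, y, h⟩
  · exact absurd rfl hP
  · exact ⟨x, y, h, rfl⟩

lemma xCoord_eq_iff {P Q : W.toAffine.Point} (hP : P ≠ 0) (hQ : Q ≠ 0) :
    xCoord P = xCoord Q ↔ P = Q ∨ P = -Q := by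
  obtain ⟨x₁, y₁, h₁, rfl⟩ := exists_eq_some hP
  obtain ⟨x₂, y₂, h₂, rfl⟩ := exists_eq_some hQ
  exact X_eq_iff

variable [DecidableEq F]

/-- The two curve equations eliminate `a₆` and `a₄`, leaving an identity in the coordinates.
Packaging the sum and product of the two roots into one form makes its symmetry in three abscissae
available, which drives `xCoord_nsmul_sub`. -/
lemma xCoord_add_sub {P Q : W.toAffine.Point} (hP : P ≠ 0) (hQ : Q ≠ 0)
    (h : xCoord P ≠ xCoord Q) (X : F) :
    (xCoord (P + Q) - X) * (xCoord (P - Q) - X) * (xCoord P - xCoord Q) ^ 2 =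
      W.biquadratic (xCoord P) (xCoord Q) X := by
  obtain ⟨x₁, y₁, h₁, rfl⟩ := exists_eq_some hP
  obtain ⟨x₂, y₂, h₂, rfl⟩ := exists_eq_some hQ
  simp only [xCoord_some] at h ⊢
  rw [sub_eq_add_neg (some x₁ y₁ h₁), neg_some, add_of_X_ne h, add_of_X_ne h, xCoord_some,
    xCoord_some, slope_of_X_ne h, slope_of_X_ne h]
  have h0 : x₁ - x₂ ≠ 0 := sub_ne_zero.mpr h
  have e₁ := (equation_iff' ..).mp h₁.1
  have e₂ := (equation_iff' ..).mp h₂.1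
  have e₆ : W.a₆ = y₁ ^ 2 + W.a₁ * x₁ * y₁ + W.a₃ * y₁ - (x₁ ^ 3 + W.a₂ * x₁ ^ 2 + W.a₄ * x₁) := by
    linear_combination -e₁
  have e₄ : W.a₄ = (y₁ ^ 2 + W.a₁ * x₁ * y₁ + W.a₃ * y₁ - (x₁ ^ 3 + W.a₂ * x₁ ^ 2) -
      (y₂ ^ 2 + W.a₁ * x₂ * y₂ + W.a₃ * y₂ - (x₂ ^ 3 + W.a₂ * x₂ ^ 2))) / (x₁ - x₂) := by
    rw [eq_div_iff h0]
    linear_combination e₂ - e₁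
  simp only [addX, negY, biquadratic, b₂, b₄, b₆, b₈]
  rw [e₆, e₄]
  field_simp
  ring

lemma xCoord_sub_sub_xCoord_add {P Q : W.toAffine.Point} (hP : P ≠ 0) (hQ : Q ≠ 0)
    (h : xCoord P ≠ xCoord Q) :
    (xCoord (P - Q) - xCoord (P + Q)) * (xCoord P - xCoord Q) ^ 2 = psiTwo P * psiTwo Q := by
  obtain ⟨x₁, y₁, h₁, rfl⟩ := exists_eq_some hP
  obtain ⟨x₂, y₂, h₂, rfl⟩ := exists_eq_some hQ
  simp only [xCoord_some] at h ⊢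
  rw [sub_eq_add_neg (some x₁ y₁ h₁), neg_some, add_of_X_ne h, add_of_X_ne h, xCoord_some,
    xCoord_some, slope_of_X_ne h, slope_of_X_ne h, psiTwo_some, psiTwo_some]
  have h0 : x₁ - x₂ ≠ 0 := sub_ne_zero.mpr h
  simp only [addX, negY]
  field_simp
  ring

lemma psiTwo_eq_zero_iff {P : W.toAffine.Point} (hP : P ≠ 0) : psiTwo P = 0 ↔ P + P = 0 := by
  obtain ⟨x, y, h, rfl⟩ := exists_eq_some hP
  rw [psiTwo_some, add_eq_zero_iff_eq_neg (a := Affine.Point.some x y h), neg_some, some.injEq, negY]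
  constructor
  · exact fun H ↦ ⟨rfl, by linear_combination H⟩
  · exact fun H ↦ by linear_combination H.2

lemma xCoord_add_self {P : W.toAffine.Point} (hP : P ≠ 0) (h2 : P + P ≠ 0) (X : F) :
    (xCoord (P + P) - X) * psiTwo P ^ 2 = W.biquadratic (xCoord P) (xCoord P) X := by
  have hψ := (psiTwo_eq_zero_iff hP).not.mpr h2
  obtain ⟨x, y, h, rfl⟩ := exists_eq_some hP
  have hy : y ≠ W.toAffine.negY x y := by
    intro H
    refine hψ ?_
    rw [psiTwo_some]
    rw [negY] at H
    linear_combination H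
  have e := (equation_iff' ..).mp h.1
  have e₆ : W.a₆ = y ^ 2 + W.a₁ * x * y + W.a₃ * y - (x ^ 3 + W.a₂ * x ^ 2 + W.a₄ * x) := by
    linear_combination -e
  rw [add_self_of_Y_ne hy, xCoord_some, xCoord_some, slope_of_Y_ne rfl hy]
  have hd : y - W.toAffine.negY x y = psiTwo (.some x y h) := by
    rw [psiTwo_some, negY]; ring
  rw [hd]
  simp only [addX, biquadratic, b₂, b₄, b₆, b₈]
  field_simp
  rw [psiTwo_some, e₆]
  ring

lemma psiTwo_add_self {P : W.toAffine.Point} (hP : P ≠ 0) (h2 : P + P ≠ 0) :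
    psiTwo (P + P) * psiTwo P ^ 3 = W.preΨ₄.eval (xCoord P) := by
  have hψ := (psiTwo_eq_zero_iff hP).not.mpr h2
  obtain ⟨x, y, h, rfl⟩ := exists_eq_some hP
  have hy : y ≠ W.toAffine.negY x y := by
    intro H
    refine hψ ?_
    rw [psiTwo_some]
    rw [negY] at H
    linear_combination H
  have e := (equation_iff' ..).mp h.1
  have e₆ : W.a₆ = y ^ 2 + W.a₁ * x * y + W.a₃ * y - (x ^ 3 + W.a₂ * x ^ 2 + W.a₄ * x) := by
    linear_combination -e
  rw [add_self_of_Y_ne hy, psiTwo_some, xCoord_some, slope_of_Y_ne rfl hy]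
  have hd : y - W.toAffine.negY x y = psiTwo (.some x y h) := by
    rw [psiTwo_some, negY]; ring
  rw [hd]
  simp only [addX, addY, negAddY, negY, preΨ₄, b₂, b₄, b₆, b₈, Polynomial.eval_add, Polynomial.eval_mul,
    Polynomial.eval_pow, Polynomial.eval_X, Polynomial.eval_C,
    Polynomial.eval_ofNat]
  field_simp
  rw [psiTwo_some, e₆]
  ring

end Affine.Point
end WeierstrassCurve

end

/-! ## Elliptic divisibility sequences attached to points -/

noncomputable section

open WeierstrassCurve

namespace WeierstrassCurve.Affine.Point

variable {F : Type*} [Field F] {W : WeierstrassCurve F}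

/-- The elliptic divisibility sequence of a sequence of `x`-coordinates: it satisfies
`V (k + 1) * V (k - 1) = (x 1 - x k) * V k ^ 2`. -/
def xSeqEDS (b : F) (x : ℕ → F) : ℕ → F
  | 0 => 0
  | 1 => 1
  | 2 => b
  -- Division by zero gives `0`, so a value is meaningful only while the earlier ones are nonzero.
  -- This is why later statements carry a bound `N` up to which no positive multiple of `P`
  -- vanishes.
  | k + 3 => (x 1 - x (k + 2)) * xSeqEDS b x (k + 2) ^ 2 / xSeqEDS b x (k + 1)

variable [DecidableEq F]

/-- The sequence of division polynomial values at `P`, computed from the multiples of `P`. -/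
def multEDS (P : W.toAffine.Point) : ℕ → F := xSeqEDS (psiTwo P) fun k ↦ xCoord (k • P)

variable {P : W.toAffine.Point} {N : ℕ}

lemma xCoord_nsmul_eq_iff (hN : ∀ k, 1 ≤ k → k ≤ N → k • P ≠ 0) {m n : ℕ} (hn : 1 ≤ n)
    (hnm : n < m) (hm : m ≤ N) : xCoord (n • P) = xCoord (m • P) ↔ (m + n) • P = 0 := by
  rw [xCoord_eq_iff (hN n hn (by omega)) (hN m (by omega) hm)]
  constructor
  · rintro (h | h)
    · refine absurd ?_ (hN (m - n) (by omega) (by omega))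
      rw [sub_nsmul P hnm.le, ← sub_eq_add_neg, sub_eq_zero, h]
    · rw [add_nsmul, h, add_neg_cancel]
  · intro h
    right
    rw [add_nsmul] at h
    exact eq_neg_of_add_eq_zero_right h

lemma multEDS_one_add (P : W.toAffine.Point) (k : ℕ) (h : multEDS P (k + 1) ≠ 0) :
    (xCoord P - xCoord ((k + 2) • P)) * multEDS P (k + 2) ^ 2 =
      multEDS P (k + 3) * multEDS P (k + 1) := by
  have : multEDS P (k + 3) = (xCoord (1 • P) - xCoord ((k + 2) • P)) * multEDS P (k + 2) ^ 2 /
    multEDS P (k + 1) := by rw [multEDS]; rfl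
  rw [this, one_nsmul, div_mul_cancel₀ _ h]

lemma multEDS_two (P : W.toAffine.Point) : multEDS P 2 = psiTwo P := rfl
lemma multEDS_one (P : W.toAffine.Point) : multEDS P 1 = 1 := rfl
lemma multEDS_zero (P : W.toAffine.Point) : multEDS P 0 = 0 := rfl

lemma multEDS_ne_zero (hN : ∀ k, 1 ≤ k → k ≤ N → k • P ≠ 0) :
    ∀ k, 1 ≤ k → k ≤ N → multEDS P k ≠ 0
  | 0, h, _ => by omega
  | 1, _, _ => by rw [multEDS_one]; exact one_ne_zero
  | 2, _, h => by
      have h1 := hN 1 le_rfl (by omega)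
      have h2 := hN 2 (by omega) h
      rw [one_nsmul] at h1
      rw [two_nsmul] at h2
      exact (psiTwo_eq_zero_iff h1).not.mpr h2
  | k + 3, _, h => by
      have i1 := multEDS_ne_zero hN (k + 1) (by omega) (by omega)
      have i2 := multEDS_ne_zero hN (k + 2) (by omega) (by omega)
      have e := multEDS_one_add P k i1
      intro h0
      rw [h0, zero_mul, mul_eq_zero, sub_eq_zero] at e
      rcases e with e | e
      · have := (xCoord_nsmul_eq_iff hN (m := k + 2) (n := 1) le_rfl (by omega) (by omega)).mp
          (by rwa [one_nsmul])
        exact hN (k + 3) (by omega) h this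
      · exact i2 (by simpa using e)

lemma xCoord_sub_mul_multEDS_one (hN : ∀ k, 1 ≤ k → k ≤ N → k • P ≠ 0) {m : ℕ} (h1 : 2 ≤ m)
    (hm : m ≤ N) : (xCoord P - xCoord (m • P)) * multEDS P m ^ 2 =
      multEDS P (m + 1) * multEDS P (m - 1) := by
  obtain ⟨k, rfl⟩ : ∃ k, m = k + 2 := ⟨m - 2, by omega⟩
  exact multEDS_one_add P k (multEDS_ne_zero hN (k + 1) (by omega) (by omega))

/-- The classical formula `x(nP) - x(mP) = V(m+n) V(m-n) / (V(m) V(n))²`, by induction on `n`. The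
case `n = 1` is the recursion defining `V`; the step uses the symmetry of the biquadratic form. -/
lemma xCoord_nsmul_sub (hN : ∀ k, 1 ≤ k → k ≤ N → k • P ≠ 0) (n : ℕ) :
    1 ≤ n → ∀ m, n < m → m + n ≤ N + 1 →
    (xCoord (n • P) - xCoord (m • P)) * (multEDS P m ^ 2 * multEDS P n ^ 2) =
      multEDS P (m + n) * multEDS P (m - n) := by
  induction n using Nat.strong_induction_on with
  | _ n ih =>
  intro hn m hm hmN
  obtain rfl | hn1 := Nat.eq_or_lt_of_le hn
  · rw [multEDS_one, one_nsmul, one_pow, mul_one]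
    exact xCoord_sub_mul_multEDS_one hN (by omega) (by omega)
  have hP := hN 1 le_rfl (by omega)
  rw [one_nsmul] at hP
  have V := multEDS_ne_zero hN
  obtain rfl | hn2 := Nat.eq_or_lt_of_le hn1
  · have h2 := hN 2 (by omega) (by omega)
    rw [two_nsmul] at h2
    have dbl := xCoord_add_self hP h2 (xCoord (m • P))
    have r1 := xCoord_sub_mul_multEDS_one hN (m := m) (by omega) (by omega)
    have r2 := xCoord_sub_mul_multEDS_one hN (m := m + 1) (by omega) (by omega)
    have r3 := xCoord_sub_mul_multEDS_one hN (m := m - 1) (by omega) (by omega)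
    have hx : xCoord (m • P) ≠ xCoord P := by
      intro h
      have := (xCoord_nsmul_eq_iff hN (m := m) (n := 1) le_rfl (by omega) (by omega)).mp
          (by rw [one_nsmul, h])
      exact hN (m + 1) (by omega) (by omega) this
    have as := xCoord_add_sub (hN m (by omega) (by omega)) hP hx (xCoord P)
    rw [biquadratic_left_comm, biquadratic_right_comm, ← dbl] at as
    have ea : m • P + P = (m + 1) • P := (succ_nsmul P m).symm
    have es : m • P - P = (m - 1) • P := by
      rw [sub_nsmul P (by omega : 1 ≤ m), one_nsmul, sub_eq_add_neg]
    rw [ea, es, ← two_nsmul] at as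
    have e1 : m + 1 + 1 = m + 2 := rfl
    have e2 : m + 1 - 1 = m := rfl
    have e3 : m - 1 + 1 = m := by omega
    have e4 : m - 1 - 1 = m - 2 := by omega
    rw [e1, e2] at r2
    rw [e3, e4] at r3
    have v0 := V m (by omega) (by omega)
    have v1 := V (m + 1) (by omega) (by omega)
    have v2 := V (m - 1) (by omega) (by omega)
    rw [multEDS_two]
    rw [← eq_div_iff (pow_ne_zero 2 v0)] at r1
    rw [← eq_div_iff (pow_ne_zero 2 v1)] at r2
    rw [← eq_div_iff (pow_ne_zero 2 v2)] at r3
    have key : (xCoord (2 • P) - xCoord (m • P)) * psiTwo P ^ 2 =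
      (xCoord P - xCoord ((m + 1) • P)) * (xCoord P - xCoord ((m - 1) • P)) *
        (xCoord P - xCoord (m • P)) ^ 2 := by rw [← as]; ring
    rw [mul_comm (multEDS P m ^ 2), ← mul_assoc, key, r1, r2, r3]
    field_simp
  · obtain ⟨n, rfl⟩ : ∃ k, n = k + 1 := ⟨n - 1, by omega⟩
    have d1 := ih (n - 1) (by omega) (by omega) m (by omega) (by omega)
    have d2 := ih n (by omega) (by omega) m (by omega) (by omega)
    have d3 := xCoord_sub_mul_multEDS_one hN (m := n) (by omega) (by omega)
    have d4 := xCoord_sub_mul_multEDS_one hN (m := m + n) (by omega) (by omega)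
    have d5 := xCoord_sub_mul_multEDS_one hN (m := m - n) (by omega) (by omega)
    have hx : xCoord (n • P) ≠ xCoord P := by
      intro h
      have := (xCoord_nsmul_eq_iff hN (m := n) (n := 1) le_rfl (by omega) (by omega)).mp
          (by rw [one_nsmul, h])
      exact hN (n + 1) (by omega) (by omega) this
    have hx' : xCoord (n • P) ≠ xCoord (m • P) := by
      intro h
      have := (xCoord_nsmul_eq_iff hN (m := m) (n := n) (by omega) (by omega) (by omega)).mp h
      exact hN (m + n) (by omega) (by omega) this
    have a1 := xCoord_add_sub (hN n (by omega) (by omega)) hP hx (xCoord (m • P))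
    have a2 := xCoord_add_sub (hN n (by omega) (by omega)) (hN m (by omega) (by omega)) hx'
      (xCoord P)
    -- Exchanging the roles of `x(P)` and `x(mP)` in the form relates the points `(n ± 1)P` compared
    -- with `mP` to the points `(m ± n)P` compared with `P`.
    have key := a1.trans ((biquadratic_right_comm _ _ _ _).trans a2.symm)
    have ea : n • P + P = (n + 1) • P := (succ_nsmul P n).symm
    have es : n • P - P = (n - 1) • P := by
      rw [sub_nsmul P (by omega : 1 ≤ n), one_nsmul, sub_eq_add_neg]
    have ea' : n • P + m • P = (m + n) • P := by rw [add_comm m n, add_nsmul]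
    have es' : xCoord (n • P - m • P) = xCoord ((m - n) • P) := by
      rw [sub_nsmul P (by omega : n ≤ m), ← sub_eq_add_neg, ← xCoord_neg, neg_sub]
    rw [ea, es, ea', es'] at key
    rw [show m + (n - 1) = m + n - 1 by omega, show m - (n - 1) = m - n + 1 by omega] at d1
    rw [show m + (n + 1) = m + n + 1 by omega, show m - (n + 1) = m - n - 1 by omega]
    have v1 := V n (by omega) (by omega)
    have v2 := V (n - 1) (by omega) (by omega)
    have v3 := V m (by omega) (by omega)
    have v4 := V (m + n) (by omega) (by omega)
    have v5 := V (m - n) (by omega) (by omega)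
    have v6 := V (m + n - 1) (by omega) (by omega)
    have v7 := V (m - n + 1) (by omega) (by omega)
    have v8 := V (n + 1) (by omega) (by omega)
    rw [← eq_div_iff (by simp [v1, v2, v3])] at d1 d2 d3
    rw [← eq_div_iff (by simp [v4])] at d4
    rw [← eq_div_iff (by simp [v5])] at d5
    rw [← neg_sub (xCoord P) (xCoord (n • P)), ← neg_sub (xCoord P) (xCoord ((m + n) • P)),
      ← neg_sub (xCoord P) (xCoord ((m - n) • P)), d1, d2, d3, d4, d5] at key
    generalize xCoord ((n + 1) • P) - xCoord (m • P) = D at key ⊢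
    field_simp at key
    linear_combination key

lemma multEDS_relation (hN : ∀ k, 1 ≤ k → k ≤ N → k • P ≠ 0) {m n : ℕ} (hn : 1 ≤ n)
    (hm : n < m) (hmN : m + n ≤ N + 1) :
    multEDS P (m + n) * multEDS P (m - n) =
      multEDS P (m + 1) * multEDS P (m - 1) * multEDS P n ^ 2 -
      multEDS P (n + 1) * multEDS P (n - 1) * multEDS P m ^ 2 := by
  rw [← xCoord_nsmul_sub hN n hn m hm hmN,
    ← xCoord_sub_mul_multEDS_one hN (m := m) (by omega) (by omega)]
  obtain rfl | hn1 := Nat.eq_or_lt_of_le hn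
  · rw [one_nsmul, Nat.sub_self, multEDS_zero]
    ring
  · rw [← xCoord_sub_mul_multEDS_one hN (m := n) (by omega) (by omega)]
    ring

variable (W) in
/-- The values at a point of the division polynomials. -/
def divEDS (P : W.toAffine.Point) (n : ℤ) : F :=
  normEDS (psiTwo P) (W.Ψ₃.eval (xCoord P)) (W.preΨ₄.eval (xCoord P)) n

lemma multEDS_three (hN : ∀ k, 1 ≤ k → k ≤ N → k • P ≠ 0) (h2 : 2 ≤ N) :
    multEDS P 3 = W.Ψ₃.eval (xCoord P) := by
  have h1 := hN 1 le_rfl (by omega)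
  rw [one_nsmul] at h1
  have h2' := hN 2 (by omega) h2
  rw [two_nsmul] at h2'
  have e := xCoord_sub_mul_multEDS_one hN (m := 2) le_rfl h2
  have d := xCoord_add_self h1 h2' (xCoord P)
  rw [two_nsmul, multEDS_two] at e
  simp only [Nat.reduceAdd, Nat.add_one_sub_one, multEDS_one, mul_one] at e
  rw [← e]
  simp only [biquadratic, Ψ₃, Polynomial.eval_add, Polynomial.eval_mul, Polynomial.eval_pow,
    Polynomial.eval_X, Polynomial.eval_C, Polynomial.eval_ofNat] at d ⊢
  linear_combination -d

lemma multEDS_four (hN : ∀ k, 1 ≤ k → k ≤ N → k • P ≠ 0) (h2 : 3 ≤ N) :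
    multEDS P 4 = psiTwo (2 • P) * psiTwo P ^ 4 := by
  have h1 := hN 1 le_rfl (by omega)
  rw [one_nsmul] at h1
  have V := multEDS_ne_zero hN
  have e := xCoord_sub_mul_multEDS_one hN (m := 3) (by omega) h2
  have e' := xCoord_sub_mul_multEDS_one hN (m := 2) (by omega) (by omega)
  have hx : xCoord (2 • P) ≠ xCoord P := by
    intro h
    have := (xCoord_nsmul_eq_iff hN (m := 2) (n := 1) le_rfl (by omega) (by omega)).mp
        (by rw [one_nsmul, h])
    exact hN 3 (by omega) (by omega) this
  have s := xCoord_sub_sub_xCoord_add (hN 2 (by omega) (by omega)) h1 hx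
  have es : 2 • P - P = P := by rw [two_nsmul, add_sub_cancel_right]
  have ea : 2 • P + P = 3 • P := (succ_nsmul P 2).symm
  have v2 := V 2 (by omega) (by omega)
  rw [es, ea] at s
  simp only [Nat.reduceAdd, Nat.add_one_sub_one, multEDS_one, mul_one] at e e'
  refine mul_right_cancel₀ v2 ?_
  rw [← e, ← e', multEDS_two]
  linear_combination s * psiTwo P ^ 4

/-- Both sequences agree at `0, …, 4` and obey the same doubling recursions, the instances `(m+1,
m-1)` and `(m+1, m)` of `multEDS_relation`. The range reaches `N + 1` because `V(N+1)` only involves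
`x(NP)`, so it still makes sense when `(N+1)P = 0`. -/
lemma multEDS_eq_divEDS (hN : ∀ k, 1 ≤ k → k ≤ N → k • P ≠ 0) (hN1 : 1 ≤ N) (k : ℕ) :
    k ≤ N + 1 → multEDS P k = divEDS W P k := by
  induction k using Nat.strong_induction_on with
  | _ k ih =>
  intro hk
  have h1 := hN 1 le_rfl hN1
  rw [one_nsmul] at h1
  by_cases hk4 : k ≤ 4
  · interval_cases k
    · simp [divEDS, multEDS_zero]
    · simp [divEDS, multEDS_one]
    · simp [divEDS, multEDS_two]
    · rw [multEDS_three hN (by omega)]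
      simp [divEDS]
    · have h2 := hN 2 (by omega) (by omega)
      rw [multEDS_four hN (by omega), divEDS]
      rw [two_nsmul] at h2 ⊢
      push_cast
      rw [normEDS_four, ← psiTwo_add_self h1 h2]
      ring
  · push Not at hk4
    obtain ⟨m, rfl | rfl⟩ := Nat.even_or_odd' k
    · have r := multEDS_relation hN (m := m + 1) (n := m - 1) (by omega) (by omega) (by omega)
      rw [show m + 1 + (m - 1) = 2 * m by omega, show m + 1 - (m - 1) = 2 by omega,
        show m + 1 + 1 = m + 2 by omega, show m + 1 - 1 = m by omega,
        show m - 1 + 1 = m by omega, show m - 1 - 1 = m - 2 by omega,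
        ih (m + 2) (by omega) (by omega), ih m (by omega) (by omega),
        ih (m - 1) (by omega) (by omega), ih (m - 2) (by omega) (by omega),
        ih (m + 1) (by omega) (by omega)] at r
      have v2 := multEDS_ne_zero hN 2 (by omega) (by omega)
      refine mul_right_cancel₀ v2 (r.trans ?_)
      simp only [divEDS, multEDS_two]
      push_cast [show 1 ≤ m by omega, show 2 ≤ m by omega]
      rw [normEDS_even]
      ring
    · have r := multEDS_relation hN (m := m + 1) (n := m) (by omega) (by omega) (by omega)
      rw [show m + 1 + m = 2 * m + 1 by omega, show m + 1 - m = 1 by omega,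
        show m + 1 + 1 = m + 2 by omega, show m + 1 - 1 = m by omega, multEDS_one, mul_one,
        ih (m + 2) (by omega) (by omega), ih m (by omega) (by omega),
        ih (m - 1) (by omega) (by omega),
        ih (m + 1) (by omega) (by omega)] at r
      rw [r]
      simp only [divEDS]
      push_cast [show 1 ≤ m by omega, show 2 ≤ m by omega]
      rw [normEDS_odd]
      ring

end WeierstrassCurve.Affine.Point

end

/-! ## Roots of division polynomials are torsion points -/

noncomputable section

open WeierstrassCurve

namespace WeierstrassCurve.Affine.Point

open Polynomial

section

variable {F : Type*} [Field F] {W : WeierstrassCurve F}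

lemma divEDS_eq_evalEval {x y : F} (h : W.toAffine.Nonsingular x y) (n : ℤ) :
    divEDS W (.some x y h) n = (W.ψ n).evalEval x y := by
  rw [WeierstrassCurve.ψ, ← coe_evalEvalRingHom, map_normEDS, divEDS]
  congr 1
  · simp [psiTwo_some, ψ₂, evalEval_polynomialY]
  · simp [xCoord_some]
  · simp [xCoord_some]

/-- Modulo the curve equation `Ψ₃` is expressed through the two partial derivatives. When `W_Y = 0`
only `-W_X²` survives, which is nonzero at a nonsingular point. -/
lemma eval_Ψ₃ {x y : F} (h : W.toAffine.Equation x y) : W.Ψ₃.eval x =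
    (3 * x + W.a₂) * (2 * y + W.a₁ * x + W.a₃) ^ 2 -
      W.a₁ * (3 * x ^ 2 + 2 * W.a₂ * x + W.a₄ - W.a₁ * y) * (2 * y + W.a₁ * x + W.a₃) -
      (3 * x ^ 2 + 2 * W.a₂ * x + W.a₄ - W.a₁ * y) ^ 2 := by
  have e := (equation_iff' ..).mp h
  have e₆ : W.a₆ = y ^ 2 + W.a₁ * x * y + W.a₃ * y - (x ^ 3 + W.a₂ * x ^ 2 + W.a₄ * x) := by
    linear_combination -e
  simp only [Ψ₃, b₂, b₄, b₆, b₈, eval_add, eval_mul, eval_pow, eval_X, eval_C, eval_ofNat, e₆]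
  ring

variable [DecidableEq F]

lemma divEDS_ne_zero {P : W.toAffine.Point} {N : ℕ} (hN : ∀ k, 1 ≤ k → k ≤ N → k • P ≠ 0) (k : ℕ)
    (h1 : 1 ≤ k) (hk : k ≤ N) : divEDS W P k ≠ 0 := by
  rw [← multEDS_eq_divEDS hN (by omega) k (by omega)]
  exact multEDS_ne_zero hN k h1 hk

lemma divEDS_eq_zero {P : W.toAffine.Point} {N : ℕ} (hN : ∀ k, 1 ≤ k → k ≤ N → k • P ≠ 0)
    (h1 : 1 ≤ N) (h0 : (N + 1) • P = 0) : divEDS W P (N + 1 : ℕ) = 0 := by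
  rw [← multEDS_eq_divEDS hN h1 _ le_rfl]
  obtain rfl | h2 := Nat.eq_or_lt_of_le h1
  · have hP := hN 1 le_rfl le_rfl
    rw [one_nsmul] at hP
    rw [multEDS_two, psiTwo_eq_zero_iff hP, ← two_nsmul, h0]
  · have r := xCoord_sub_mul_multEDS_one hN h2 le_rfl
    have e := (xCoord_nsmul_eq_iff hN (m := N) (n := 1) le_rfl h2 le_rfl).mpr h0
    rw [← e, one_nsmul, sub_self, zero_mul, eq_comm, mul_eq_zero] at r
    exact r.resolve_right (multEDS_ne_zero hN _ (by omega) (by omega))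

lemma nsmul_ne_zero_of_divEDS_ne_zero {P : W.toAffine.Point} (hP : P ≠ 0)
    (h : ∀ k : ℕ, 1 ≤ k → divEDS W P k ≠ 0) (k : ℕ) (h1 : 1 ≤ k) : k • P ≠ 0 := by
  induction k using Nat.strong_induction_on with
  | _ k ih =>
  obtain rfl | h2 := Nat.eq_or_lt_of_le h1
  · rwa [one_nsmul]
  · obtain ⟨N, rfl⟩ : ∃ N, k = N + 1 := ⟨k - 1, by omega⟩
    exact fun h0 ↦ h _ h1 (divEDS_eq_zero (fun k h1 hk ↦ ih k (by omega) h1) (by omega) h0)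

lemma eval_Ψ₃_ne_zero {P : W.toAffine.Point} (hP : P ≠ 0) (h2 : P + P = 0) :
    W.Ψ₃.eval (xCoord P) ≠ 0 := by
  obtain ⟨x, y, h, rfl⟩ := exists_eq_some hP
  rw [← psiTwo_eq_zero_iff hP, psiTwo_some] at h2
  rw [xCoord_some, eval_Ψ₃ h.1, h2]
  have := (((nonsingular_iff' ..).mp h).2.resolve_right (not_not.mpr h2))
  intro H
  apply this
  have H' : (3 * x ^ 2 + 2 * W.a₂ * x + W.a₄ - W.a₁ * y) ^ 2 = 0 := by linear_combination -H
  linear_combination -(pow_eq_zero_iff two_ne_zero).mp H'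

end

section generic

variable {F : Type*} [Field F] (W : WeierstrassCurve F)

/-- Evaluation of bivariate polynomials in the function field. -/
def evalGeneric : F[X][X] →+* W.toAffine.FunctionField :=
  (algebraMap W.toAffine.CoordinateRing W.toAffine.FunctionField).comp (CoordinateRing.mk W.toAffine)

/-- The field of constants inside the function field. -/
def constGeneric : F →+* W.toAffine.FunctionField := (evalGeneric W).comp (C.comp C)

lemma eval_map_constGeneric (p : F[X]) :
    (p.map (constGeneric W)).eval (evalGeneric W (C X)) = evalGeneric W (C p) := by
  rw [eval_map]
  have : eval₂RingHom (constGeneric W) (evalGeneric W (C X)) = (evalGeneric W).comp C := by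
    ext
    · simp [constGeneric]
    · simp
  exact congrArg (fun f : F[X] →+* _ ↦ f p) this

lemma equation_generic : (W.map (constGeneric W)).toAffine.Equation (evalGeneric W (C X))
    (evalGeneric W X) := by
  have h : evalGeneric W W.toAffine.polynomial = 0 := by
    simp [evalGeneric, AdjoinRoot.mk_self]
  rw [equation_iff']
  refine Eq.trans ?_ h
  simp only [Affine.polynomial]
  simp only [map_a₁, map_a₂, map_a₃, map_a₄, map_a₆, constGeneric, RingHom.comp_apply, map_add,
    map_sub, map_mul, map_pow]
  ring

lemma evalGeneric_injOn {p : F[X]} (hp : p ≠ 0) : evalGeneric W (C p) ≠ 0 := by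
  rw [evalGeneric, RingHom.comp_apply, map_ne_zero_iff _ (IsFractionRing.injective _ _)]
  exact AdjoinRoot.mk_ne_zero_of_natDegree_lt monic_polynomial (C_ne_zero.mpr hp) <|
    by rw [natDegree_polynomial, natDegree_C]; norm_num1

/-- In the coordinate ring `ψ n` squares to `ΨSq n`, a nonzero polynomial in `x` alone. -/
lemma evalGeneric_ψ_ne_zero {n : ℤ} (hn : (n : F) ≠ 0) : evalGeneric W (W.ψ n) ≠ 0 := by
  have h := evalGeneric_injOn W (W.ΨSq_ne_zero hn)
  rw [evalGeneric, RingHom.comp_apply, ← CoordinateRing.mk_Ψ_sq, ← CoordinateRing.mk_ψ, map_pow] at h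
  exact fun H ↦ h (by rw [← RingHom.comp_apply, ← evalGeneric, H, zero_pow two_ne_zero])

variable [W.IsElliptic]

/-- The generic point. -/
def generic : (W.map (constGeneric W)).toAffine.Point :=
  .mk (equation_generic W)

lemma divEDS_generic (n : ℤ) :
    divEDS (W.map (constGeneric W)) (generic W) n = evalGeneric W (W.ψ n) := by
  rw [WeierstrassCurve.ψ, map_normEDS, divEDS, generic, Point.mk, psiTwo_some, xCoord_some,
    map_Ψ₃, map_preΨ₄, eval_map_constGeneric, eval_map_constGeneric]
  congr 1
  rw [ψ₂, polynomialY]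
  simp only [constGeneric, map_a₁, map_a₃, map_add, map_mul, map_ofNat, RingHom.comp_apply]
  ring

/-- The defining relation of an elliptic divisibility sequence, for the division polynomials of an
elliptic curve at a point. -/
lemma divEDS_relation [CharZero F] (P : W.toAffine.Point) (hP : P ≠ 0) {m n : ℕ} (hn : 1 ≤ n)
    (hm : n < m) :
    divEDS W P (m + n : ℕ) * divEDS W P (m - n : ℕ) =
      divEDS W P (m + 1 : ℕ) * divEDS W P (m - 1 : ℕ) * divEDS W P n ^ 2 -
      divEDS W P (n + 1 : ℕ) * divEDS W P (n - 1 : ℕ) * divEDS W P m ^ 2 := by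
  classical
  -- In characteristic zero the generic point has infinite order, so `multEDS_relation` applies to
  -- it for all indices and yields the relation between the `ψ n` in the coordinate ring.
  have hG : ∀ k : ℕ, 1 ≤ k → k • generic W ≠ 0 := by
    refine nsmul_ne_zero_of_divEDS_ne_zero (some_ne_zero _) fun k hk ↦ ?_
    rw [divEDS_generic]
    refine evalGeneric_ψ_ne_zero W ?_
    rw [Int.cast_natCast, Nat.cast_ne_zero]
    omega
  have hN : ∀ k, 1 ≤ k → k ≤ m + n → k • generic W ≠ 0 := fun k h _ ↦ hG k h
  have r := multEDS_relation hN hn hm (by omega)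
  simp only [multEDS_eq_divEDS hN (by omega : 1 ≤ m + n) (m + n) (by omega),
    multEDS_eq_divEDS hN (by omega : 1 ≤ m + n) (m - n) (by omega),
    multEDS_eq_divEDS hN (by omega : 1 ≤ m + n) (m + 1) (by omega),
    multEDS_eq_divEDS hN (by omega : 1 ≤ m + n) (m - 1) (by omega),
    multEDS_eq_divEDS hN (by omega : 1 ≤ m + n) (n + 1) (by omega),
    multEDS_eq_divEDS hN (by omega : 1 ≤ m + n) (n - 1) (by omega),
    multEDS_eq_divEDS hN (by omega : 1 ≤ m + n) m (by omega),
    multEDS_eq_divEDS hN (by omega : 1 ≤ m + n) n (by omega), divEDS_generic] at r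
  simp only [← map_mul, ← map_pow, ← map_sub] at r
  rw [evalGeneric, RingHom.comp_apply, RingHom.comp_apply] at r
  have r' := IsFractionRing.injective W.toAffine.CoordinateRing W.toAffine.FunctionField r
  obtain ⟨x, y, h, rfl⟩ := exists_eq_some hP
  have hz : W.toAffine.polynomial.eval₂ (evalRingHom x) y = 0 := by
    rw [eval₂_evalRingHom]
    exact h.1
  -- Evaluation at `P` is a ring homomorphism on the coordinate ring, so the relation specializes to
  -- every affine point, torsion or not.
  have ev := congrArg (AdjoinRoot.lift (evalRingHom x) y hz) r'
  rw [AdjoinRoot.lift_mk, AdjoinRoot.lift_mk, eval₂_evalRingHom, ← coe_evalEvalRingHom] at ev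
  simp only [map_mul, map_sub, map_pow] at ev
  simpa only [divEDS_eq_evalEval, coe_evalEvalRingHom] using ev

end generic

section apparition

variable {F : Type*} [Field F] [CharZero F] [DecidableEq F] {W : WeierstrassCurve F} [W.IsElliptic]

/-- Once the value at `N + 1` vanishes, the relation for `(N, 2)` reads `ψ(N+2) ψ(N-2) = -ψ(3) ψ(1)
ψ(N)²`, and the right side is nonzero if `N ≥ 3`. For `N = 1, 2` the values `Ψ₃` and `ψ(4)` are
inspected directly. -/
lemma divEDS_addOrderOf_add_one_ne_zero {P : W.toAffine.Point} {N : ℕ} (h1 : 1 ≤ N)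
    (hN : ∀ k, 1 ≤ k → k ≤ N → k • P ≠ 0) (h0 : (N + 1) • P = 0) :
    divEDS W P (N + 2 : ℕ) ≠ 0 := by
  have hP := hN 1 le_rfl h1
  rw [one_nsmul] at hP
  have W0 := divEDS_eq_zero hN h1 h0
  have V := divEDS_ne_zero hN
  by_cases hN3 : 3 ≤ N
  · have r := divEDS_relation W P hP (m := N) (n := 2) (by omega) (by omega)
    rw [W0, zero_mul, zero_mul, zero_sub] at r
    intro H
    rw [H, zero_mul, eq_comm, neg_eq_zero] at r
    exact mul_ne_zero (mul_ne_zero (V 3 (by omega) (by omega)) (V 1 le_rfl h1))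
      (pow_ne_zero 2 (V N h1 le_rfl)) r
  · interval_cases N
    · rw [two_nsmul] at h0
      simpa [divEDS] using eval_Ψ₃_ne_zero hP h0
    · have h2 := hN 2 (by omega) (by omega)
      rw [two_nsmul] at h2
      have hψ := (psiTwo_eq_zero_iff hP).not.mpr h2
      have hψ' : psiTwo (P + P) ≠ 0 := by
        rw [ne_eq, psiTwo_eq_zero_iff h2]
        intro H
        apply hP
        have : (2 + 1) • P + P = 0 := by rw [← H]; abel
        rwa [h0, zero_add] at this
      simp [divEDS, ← psiTwo_add_self hP h2, hψ, hψ']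

/-- With `r = N + 1` the order of `P`, the relation for the pair `r`, `k` expresses `ψ(k+r)
ψ(|k-r|)` as `± ψ(r+1) ψ(r-1) ψ(k)²`, so nonvanishing passes from `k` to `k + r`. -/
lemma divEDS_ne_zero_of_not_dvd {P : W.toAffine.Point} {N : ℕ} (h1 : 1 ≤ N)
    (hN : ∀ k, 1 ≤ k → k ≤ N → k • P ≠ 0) (h0 : (N + 1) • P = 0) (m : ℕ) :
    ¬ N + 1 ∣ m → divEDS W P m ≠ 0 := by
  induction m using Nat.strong_induction_on with
  | _ m ih =>
  intro hm
  have hP := hN 1 le_rfl h1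
  rw [one_nsmul] at hP
  have W0 := divEDS_eq_zero hN h1 h0
  have V := divEDS_ne_zero hN
  have W1 := divEDS_addOrderOf_add_one_ne_zero h1 hN h0
  obtain hlt | hge := Nat.lt_or_ge m (N + 1)
  · refine V m (Nat.one_le_iff_ne_zero.mpr ?_) (by omega)
    rintro rfl
    exact hm (dvd_zero _)
  · obtain ⟨k, rfl⟩ := Nat.exists_eq_add_of_le hge
    have hk : ¬ N + 1 ∣ k := fun h ↦ hm (dvd_add dvd_rfl h)
    have hk0 : k ≠ 0 := by rintro rfl; exact hk (dvd_zero _)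
    have hkN : k ≠ N + 1 := by rintro rfl; exact hk dvd_rfl
    have ihk := ih k (by omega) hk
    intro H
    obtain hlt | hlt := Nat.lt_or_gt_of_ne hkN
    · have r := divEDS_relation W P hP (m := N + 1) (n := k) (by omega) hlt
      rw [H, W0, zero_mul, zero_pow two_ne_zero, mul_zero, sub_zero, eq_comm] at r
      exact mul_ne_zero (mul_ne_zero W1 (V N h1 le_rfl)) (pow_ne_zero 2 ihk) r
    · have r := divEDS_relation W P hP (m := k) (n := N + 1) (by omega) hlt
      rw [add_comm k, H, W0, zero_mul, zero_pow two_ne_zero, mul_zero, zero_sub, eq_comm,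
        neg_eq_zero] at r
      exact mul_ne_zero (mul_ne_zero W1 (V N h1 le_rfl)) (pow_ne_zero 2 ihk) r

lemma nsmul_eq_zero_of_divEDS_eq_zero {P : W.toAffine.Point} (hP : P ≠ 0) {m : ℕ}
    (h : divEDS W P m = 0) : m • P = 0 := by
  by_contra hm
  rcases Nat.eq_zero_or_pos (addOrderOf P) with h0 | hpos
  · rw [addOrderOf_eq_zero_iff'] at h0
    refine divEDS_ne_zero (N := m) (fun k hk _ ↦ h0 k hk) m (Nat.one_le_iff_ne_zero.mpr ?_) le_rfl h
    rintro rfl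
    exact hm (zero_nsmul P)
  · have h1 : addOrderOf P ≠ 1 := by rwa [ne_eq, AddMonoid.addOrderOf_eq_one_iff]
    obtain ⟨N, hN⟩ : ∃ N, addOrderOf P = N + 1 := ⟨addOrderOf P - 1, by omega⟩
    refine divEDS_ne_zero_of_not_dvd (N := N) (by omega) (fun k hk hkN ↦ ?_) ?_ m ?_ h
    · exact nsmul_ne_zero_of_lt_addOrderOf (by omega) (by omega)
    · rw [← hN]; exact addOrderOf_nsmul_eq_zero P
    · rw [← hN, addOrderOf_dvd_iff_nsmul_eq_zero]; exact hm

/-- The points whose `x`-coordinates are roots of the `n`-division polynomial are `n`-torsion. -/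
theorem nsmul_eq_zero_of_eval_preΨ' {P : W.toAffine.Point} (hP : P ≠ 0) {n : ℕ} (hn : Odd n)
    (h : (W.preΨ' n).eval (xCoord P) = 0) : n • P = 0 := by
  refine nsmul_eq_zero_of_divEDS_eq_zero hP ?_
  have hψ : psiTwo P ^ 2 = W.Ψ₂Sq.eval (xCoord P) := by
    obtain ⟨x, y, hxy, rfl⟩ := exists_eq_some hP
    have e := (equation_iff' ..).mp hxy.1
    simp only [psiTwo_some, xCoord_some, Ψ₂Sq, b₂, b₄, b₆, eval_add, eval_mul, eval_pow, eval_X,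
      eval_C]
    linear_combination 4 * e
  have hodd : ¬ Even (n : ℤ) := by rwa [Int.even_coe_nat, Nat.not_even_iff_odd]
  rw [divEDS, normEDS, if_neg hodd, mul_one, ← h, ← preΨ_ofNat, preΨ, ← coe_evalRingHom,
    map_preNormEDS]
  simp only [coe_evalRingHom, eval_pow, ← hψ]
  ring_nf

end apparition

end WeierstrassCurve.Affine.Point

end

/-! ## Nodal reduction: estimates on collinear points -/

noncomputable section

open WeierstrassCurve

namespace IsUltrametricDist

variable {L : Type*} [NormedField L] [IsUltrametricDist L]

lemma norm_add_le_of_le {a b : L} {c : ℝ} (ha : ‖a‖ ≤ c) (hb : ‖b‖ ≤ c) : ‖a + b‖ ≤ c :=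
  (norm_add_le_max a b).trans (max_le ha hb)

lemma norm_sub_le_of_le {a b : L} {c : ℝ} (ha : ‖a‖ ≤ c) (hb : ‖b‖ ≤ c) : ‖a - b‖ ≤ c := by
  rw [sub_eq_add_neg]
  exact norm_add_le_of_le ha (by rwa [norm_neg])

lemma norm_add_lt_of_lt {a b : L} {c : ℝ} (ha : ‖a‖ < c) (hb : ‖b‖ < c) : ‖a + b‖ < c :=
  (norm_add_le_max a b).trans_lt (max_lt ha hb)

lemma norm_sub_lt_of_lt {a b : L} {c : ℝ} (ha : ‖a‖ < c) (hb : ‖b‖ < c) : ‖a - b‖ < c := by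
  rw [sub_eq_add_neg]
  exact norm_add_lt_of_lt ha (by rwa [norm_neg])

lemma norm_add_eq_left {a b : L} (h : ‖b‖ < ‖a‖) : ‖a + b‖ = ‖a‖ := by
  rw [norm_add_eq_max_of_norm_ne_norm h.ne', max_eq_left h.le]

lemma norm_sub_eq_left {a b : L} (h : ‖b‖ < ‖a‖) : ‖a - b‖ = ‖a‖ := by
  rw [sub_eq_add_neg]
  exact norm_add_eq_left (by rwa [norm_neg])

/-- In `uⁿ - 1 = (u - 1) ∑ uⁱ` the sum is congruent to `n`, a unit, modulo the maximal ideal. -/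
lemma norm_pow_sub_one {u : L} (hu : ‖u - 1‖ < 1) {n : ℕ} (hn : ‖(n : L)‖ = 1) :
    ‖u ^ n - 1‖ = ‖u - 1‖ := by
  have hu1 : ‖u‖ ≤ 1 := by
    rw [← sub_add_cancel u 1]
    exact norm_add_le_of_le hu.le norm_one.le
  have key : ∀ k : ℕ, ‖u ^ k - 1‖ < 1 := by
    intro k
    induction k with
    | zero => simp
    | succ k ih =>
      have : u ^ (k + 1) - 1 = (u ^ k - 1) * u + (u - 1) := by ring
      rw [this]
      refine norm_add_lt_of_lt ?_ hu
      rw [norm_mul]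
      exact (mul_le_of_le_one_right (norm_nonneg _) hu1).trans_lt ih
  have key2 : ∀ k : ℕ, ‖∑ i ∈ Finset.range k, u ^ i - (k : L)‖ < 1 := by
    intro k
    induction k with
    | zero => simp
    | succ k ih =>
      rw [Finset.sum_range_succ]
      have : ∑ i ∈ Finset.range k, u ^ i + u ^ k - ((k + 1 : ℕ) : L) =
        (∑ i ∈ Finset.range k, u ^ i - k) + (u ^ k - 1) := by push_cast; ring
      rw [this]
      exact norm_add_lt_of_lt ih (key k)
  have h1 : ‖∑ i ∈ Finset.range n, u ^ i‖ = 1 := by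
    rw [← sub_add_cancel (∑ i ∈ Finset.range n, u ^ i) (n : L), add_comm, norm_add_eq_left, hn]
    rw [hn]; exact key2 n
  rw [← geom_sum_mul, norm_mul, h1, one_mul]

lemma eq_one_of_pow_eq_one {u : L} (hu : ‖u - 1‖ < 1) {n : ℕ} (hn : ‖(n : L)‖ = 1)
    (h : u ^ n = 1) : u = 1 := by
  have := norm_pow_sub_one hu hn
  rw [h, sub_self, norm_zero, eq_comm, norm_eq_zero] at this
  exact sub_eq_zero.mp this

end IsUltrametricDist

open IsUltrametricDist

namespace WeierstrassCurve

/-- Weierstrass equations `y² + xy = x³ + a₄x + a₆` whose reduction is the nodal cubic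
`y² + xy = x³`, with `|a₄| ≤ |a₆|`. -/
structure IsNodal {L : Type*} [NormedField L] (W : WeierstrassCurve L) : Prop where
  a₁ : W.a₁ = 1
  a₂ : W.a₂ = 0
  a₃ : W.a₃ = 0
  a₄ : ‖W.a₄‖ ≤ ‖W.a₆‖
  a₆_pos : 0 < ‖W.a₆‖
  a₆_lt : ‖W.a₆‖ < 1

/-- Points `P`, `Q`, `-(P + Q) = (x₃, y₃)` lie on the line `y = λx + ν`. -/
lemma Affine.Point.exists_line {L : Type*} [Field L] [DecidableEq L] {W : WeierstrassCurve L}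
    (h₁ : W.a₁ = 1) (h₂ : W.a₂ = 0) (h₃ : W.a₃ = 0) {x₁ y₁ x₂ y₂ : L}
    (hP : W.toAffine.Nonsingular x₁ y₁) (hQ : W.toAffine.Nonsingular x₂ y₂)
    (h : Affine.Point.some x₁ y₁ hP + .some x₂ y₂ hQ ≠ 0) :
    ∃ l v x₃ y₃ hR, Affine.Point.some x₁ y₁ hP + .some x₂ y₂ hQ = -.some x₃ y₃ hR ∧
      y₁ = l * x₁ + v ∧ y₂ = l * x₂ + v ∧ y₃ = l * x₃ + v ∧ x₁ + x₂ + x₃ = l ^ 2 + l ∧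
      x₁ * x₂ + x₁ * x₃ + x₂ * x₃ = W.a₄ - 2 * l * v - v ∧ x₁ * x₂ * x₃ = v ^ 2 - W.a₆ := by
  have hxy : ¬(x₁ = x₂ ∧ y₁ = W.toAffine.negY x₂ y₂) := fun H ↦
    h (Affine.Point.add_of_Y_eq H.1 H.2)
  have hp := Affine.addPolynomial_slope hP.1 hQ.1 hxy
  refine ⟨W.toAffine.slope x₁ x₂ y₁ y₂, y₁ - W.toAffine.slope x₁ x₂ y₁ y₂ * x₁, _, _,
    Affine.nonsingular_negAdd hP hQ hxy, ?_, by ring, ?_, ?_, ?_⟩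
  · rw [Affine.Point.add_some hxy]; rfl
  · by_cases hx : x₁ = x₂
    · subst hx
      have hy : y₁ ≠ W.toAffine.negY x₁ y₂ := fun h ↦ hxy ⟨rfl, h⟩
      obtain rfl := Affine.Y_eq_of_Y_ne hP.1 hQ.1 rfl hy
      ring
    · rw [Affine.slope_of_X_ne hx]
      have := sub_ne_zero.mpr hx
      field_simp
      ring
  · simp only [Affine.negAddY]; ring
  · generalize W.toAffine.slope x₁ x₂ y₁ y₂ = l at *
    rw [Affine.addPolynomial_eq, neg_inj, Cubic.prod_X_sub_C_eq, Cubic.toPoly_injective,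
      Cubic.mk.injEq] at hp
    obtain ⟨-, e1, e2, e3⟩ := hp
    refine ⟨?_, ?_, ?_⟩
    · linear_combination e1 + l * h₁ - h₂
    · linear_combination -e2 + h₁ * (x₁ * l - y₁) - l * h₃
    · linear_combination e3 - h₃ * (x₁ * l - y₁)

namespace IsNodal

variable {L : Type*} [NormedField L] {W : WeierstrassCurve L} (hW : W.IsNodal)
include hW

lemma equation_iff (x y : L) :
    W.toAffine.Equation x y ↔ y * (x + y) = x ^ 3 + W.a₄ * x + W.a₆ := by
  rw [Affine.equation_iff, hW.a₁, hW.a₂, hW.a₃]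
  ring_nf

lemma norm_a₄_lt : ‖W.a₄‖ < 1 := hW.a₄.trans_lt hW.a₆_lt

variable [IsUltrametricDist L]

/-- On points with good reduction, away from the node. -/
lemma norm_of_one_le {x y : L} (h : W.toAffine.Equation x y) (hx : 1 ≤ ‖x‖) :
    ‖x + y‖ = ‖y‖ ∧ ‖y‖ ^ 2 = ‖x‖ ^ 3 := by
  rw [hW.equation_iff] at h
  have hx0 : 0 < ‖x‖ := one_pos.trans_le hx
  have h3 : ‖x ^ 3 + W.a₄ * x + W.a₆‖ = ‖x‖ ^ 3 := by
    have hx3 : ‖x‖ ≤ ‖x‖ ^ 3 := by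
      nlinarith [mul_le_mul hx hx zero_le_one hx0.le]
    rw [add_assoc, norm_add_eq_left, norm_pow]
    rw [norm_pow]
    refine norm_add_lt_of_lt ?_ ?_
    · rw [norm_mul]
      exact (mul_lt_of_lt_one_left hx0 hW.norm_a₄_lt).trans_le hx3
    · exact hW.a₆_lt.trans_le (hx.trans hx3)
  rw [← h, norm_mul] at h3
  suffices hs : ‖x + y‖ = ‖y‖ by
    refine ⟨hs, ?_⟩
    rw [← h3, hs, sq]
  rcases lt_or_ge ‖x‖ ‖y‖ with hlt | hge
  · rw [add_comm, norm_add_eq_left hlt]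
  -- Here `|x|³ = |y| |x + y| ≤ |x|²` forces `|x| = 1`, and then both factors are units.
  · have hxy : ‖x + y‖ ≤ ‖x‖ := norm_add_le_of_le le_rfl hge
    have hx1 : ‖x‖ = 1 := by
      refine le_antisymm ?_ hx
      have : ‖x‖ ^ 3 ≤ ‖x‖ * ‖x‖ := by
        rw [← h3]
        exact mul_le_mul hge hxy (norm_nonneg _) (norm_nonneg _)
      by_contra hc
      push Not at hc
      nlinarith [mul_pos hx0 hx0]
    rw [hx1] at hge hxy h3
    have := norm_nonneg y
    have := norm_nonneg (x + y)
    have h4 : ‖y‖ = 1 := by nlinarith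
    rw [h4, one_mul] at h3
    rw [h3, h4]
    norm_num

lemma norm_lt_one_of_norm_lt_one {x y : L} (h : W.toAffine.Equation x y) (hx : ‖x‖ < 1) :
    ‖y‖ < 1 := by
  rw [hW.equation_iff] at h
  by_contra! hy
  have h1 : ‖x + y‖ = ‖y‖ := by rw [add_comm, norm_add_eq_left (hx.trans_le hy)]
  have h2 : ‖x ^ 3 + W.a₄ * x + W.a₆‖ < 1 := by
    refine norm_add_lt_of_lt (norm_add_lt_of_lt ?_ ?_) hW.a₆_lt
    · rw [norm_pow]; exact pow_lt_one₀ (norm_nonneg _) hx (by norm_num)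
    · rw [norm_mul]; exact mul_lt_one_of_nonneg_of_lt_one_left (norm_nonneg _) hW.norm_a₄_lt hx.le
  rw [← h, norm_mul, h1] at h2
  nlinarith

section line

variable {x₁ x₂ x₃ y₁ y₂ y₃ l v : L}

/-- A line through the node modulo the maximal ideal cannot meet the curve in two further smooth
points. If `|l| ≤ 1`, then `v` is small and so is `x₁x₂`. If `|l| > 1`, then `|x₁ + x₂| = |l|²`
exceeds `|x₁x₂|`, impossible when both abscissae have norm at least `1`. -/
lemma one_le_norm_third (h₃ : W.toAffine.Equation x₃ y₃)
    (l₃ : y₃ = l * x₃ + v) (e₁ : x₁ + x₂ + x₃ = l ^ 2 + l)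
    (e₂ : x₁ * x₂ + x₁ * x₃ + x₂ * x₃ = W.a₄ - 2 * l * v - v)
    (hx₁ : 1 ≤ ‖x₁‖) (hx₂ : 1 ≤ ‖x₂‖) : 1 ≤ ‖x₃‖ := by
  by_contra! hx₃
  have hy₃ := hW.norm_lt_one_of_norm_lt_one h₃ hx₃
  have hv : v = y₃ - l * x₃ := by linear_combination -l₃
  have hlx : ‖l * x₃‖ ≤ ‖l‖ * ‖x₃‖ := (norm_mul _ _).le
  have two : ‖(2 : L)‖ ≤ 1 := by
    simpa using IsUltrametricDist.norm_natCast_le_one L 2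
  have h12 : x₁ * x₂ = W.a₄ - (2 * l * v + v) - (x₁ + x₂) * x₃ := by linear_combination e₂
  have h12s : x₁ + x₂ = l ^ 2 + (l - x₃) := by linear_combination e₁
  have hp : 1 ≤ ‖x₁‖ * ‖x₂‖ := one_le_mul_of_one_le_of_one_le hx₁ hx₂
  rcases le_or_gt ‖l‖ 1 with hl | hl
  · have hv1 : ‖v‖ < 1 := by
      rw [hv]
      refine norm_sub_lt_of_lt hy₃ (hlx.trans_lt ?_)
      exact mul_lt_one_of_nonneg_of_lt_one_right hl (norm_nonneg _) hx₃
    have hs : ‖x₁ + x₂‖ ≤ 1 := by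
      rw [h12s]
      refine norm_add_le_of_le ?_ (norm_sub_le_of_le hl hx₃.le)
      rw [norm_pow]; exact pow_le_one₀ (norm_nonneg _) hl
    have : ‖x₁ * x₂‖ < 1 := by
      rw [h12]
      refine norm_sub_lt_of_lt (norm_sub_lt_of_lt hW.norm_a₄_lt (norm_add_lt_of_lt ?_ hv1)) ?_
      · rw [norm_mul, norm_mul]
        exact mul_lt_one_of_nonneg_of_lt_one_right (mul_le_one₀ two (norm_nonneg _) hl)
          (norm_nonneg _) hv1
      · rw [norm_mul]
        exact mul_lt_one_of_nonneg_of_lt_one_right hs (norm_nonneg _) hx₃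
    rw [norm_mul] at this
    linarith
  · have hl0 : 0 < ‖l‖ := one_pos.trans hl
    have hll : ‖l‖ < ‖l‖ ^ 2 := by nlinarith
    have hv1 : ‖v‖ < ‖l‖ := by
      rw [hv]
      refine norm_sub_lt_of_lt (hy₃.trans hl) (hlx.trans_lt ?_)
      exact mul_lt_of_lt_one_right hl0 hx₃
    have hs : ‖x₁ + x₂‖ = ‖l‖ ^ 2 := by
      rw [h12s, norm_add_eq_left, norm_pow]
      rw [norm_pow]
      exact norm_sub_lt_of_lt hll ((hx₃.trans hl).trans hll)
    have : ‖x₁ * x₂‖ < ‖l‖ ^ 2 := by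
      rw [h12]
      refine norm_sub_lt_of_lt (norm_sub_lt_of_lt ((hW.norm_a₄_lt.trans hl).trans hll)
        (norm_add_lt_of_lt ?_ (hv1.trans hll))) ?_
      · rw [norm_mul, norm_mul, sq]
        exact mul_lt_mul' (mul_le_of_le_one_left hl0.le two) hv1 (norm_nonneg _) hl0
      · rw [norm_mul, hs]
        exact mul_lt_of_lt_one_right (by positivity) hx₃
    have h5 : ‖x₁ + x₂‖ ≤ ‖x₁‖ * ‖x₂‖ :=
      norm_add_le_of_le (le_mul_of_one_le_right (norm_nonneg _) hx₂)
        (le_mul_of_one_le_left (norm_nonneg _) hx₁)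
    rw [norm_mul] at this
    linarith

/-- The function `y / (x + y)` is multiplicative on three collinear points away from the node,
up to a small error. -/
lemma norm_uniformizer_mul_sub_one (h₁ : W.toAffine.Equation x₁ y₁)
    (l₁ : y₁ = l * x₁ + v) (l₂ : y₂ = l * x₂ + v) (l₃ : y₃ = l * x₃ + v)
    (e₁ : x₁ + x₂ + x₃ = l ^ 2 + l)
    (e₂ : x₁ * x₂ + x₁ * x₃ + x₂ * x₃ = W.a₄ - 2 * l * v - v)
    (e₃ : x₁ * x₂ * x₃ = v ^ 2 - W.a₆)
    (hx₁ : 1 ≤ ‖x₁‖) (hx₂ : 1 ≤ ‖x₂‖) (hx₃ : 1 ≤ ‖x₃‖) :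
    ‖y₁ / (x₁ + y₁) * (y₂ / (x₂ + y₂)) * (y₃ / (x₃ + y₃)) - 1‖ ≤
      ‖W.a₆‖ * ‖y₁ / (x₁ + y₁) - 1‖ := by
  have p12 : 1 ≤ ‖x₁‖ * ‖x₂‖ := one_le_mul_of_one_le_of_one_le hx₁ hx₂
  have p13 : 1 ≤ ‖x₁‖ * ‖x₃‖ := one_le_mul_of_one_le_of_one_le hx₁ hx₃
  have p23 : 1 ≤ ‖x₂‖ * ‖x₃‖ := one_le_mul_of_one_le_of_one_le hx₂ hx₃
  have pr : 1 ≤ ‖x₁‖ * ‖x₂‖ * ‖x₃‖ := one_le_mul_of_one_le_of_one_le p12 hx₃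
  have hpr : ‖x₁ * x₂ * x₃‖ = ‖x₁‖ * ‖x₂‖ * ‖x₃‖ := by rw [norm_mul, norm_mul]
  have hv2 : v ^ 2 = x₁ * x₂ * x₃ + W.a₆ := by linear_combination -e₃
  have hv2n : ‖v‖ ^ 2 = ‖x₁‖ * ‖x₂‖ * ‖x₃‖ := by
    rw [← norm_pow, hv2, norm_add_eq_left, hpr]
    rw [hpr]; exact hW.a₆_lt.trans_le pr
  have hv0 := norm_nonneg v
  have hl0 := norm_nonneg l
  have hv1 : 1 ≤ ‖v‖ := by nlinarith
  have hvpos : 0 < ‖v‖ := by linarith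
  have hlv : ‖l‖ ≤ ‖v‖ := by
    rcases le_or_gt ‖l‖ 1 with hl | hl
    · exact hl.trans hv1
    · have hll : ‖l‖ < ‖l‖ ^ 2 := by nlinarith
      have hs : ‖x₁ + x₂ + x₃‖ = ‖l‖ ^ 2 := by
        rw [e₁, norm_add_eq_left, norm_pow]
        rwa [norm_pow]
      have : ‖x₁ + x₂ + x₃‖ ≤ ‖x₁‖ * ‖x₂‖ * ‖x₃‖ := by
        refine norm_add_le_of_le (norm_add_le_of_le ?_ ?_) ?_
        · rw [mul_assoc]; exact le_mul_of_one_le_right (norm_nonneg _) p23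
        · rw [mul_right_comm]; exact le_mul_of_one_le_left (norm_nonneg _) p13
        · exact le_mul_of_one_le_left (norm_nonneg _) p12
      rw [hs, ← hv2n] at this
      exact (pow_le_pow_iff_left₀ hl0 hv0 two_ne_zero).mp this
  have hl1v : ‖l + 1‖ ≤ ‖v‖ := norm_add_le_of_le hlv (norm_one.trans_le hv1)
  -- Both triple products are values of `λ ↦ v³ + a₄λ²v - a₆λ³`, at `l` for the `yᵢ` and at `l + 1`
  -- for the `xᵢ + yᵢ`. They share the dominant term `v³`.
  have hy : y₁ * y₂ * y₃ = v ^ 3 + (W.a₄ * l ^ 2 * v - W.a₆ * l ^ 3) := by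
    rw [l₁, l₂, l₃]
    linear_combination l ^ 3 * e₃ + l ^ 2 * v * e₂ + l * v ^ 2 * e₁
  have hg : (x₁ + y₁) * (x₂ + y₂) * (x₃ + y₃) =
      v ^ 3 + (W.a₄ * (l + 1) ^ 2 * v - W.a₆ * (l + 1) ^ 3) := by
    rw [l₁, l₂, l₃]
    linear_combination (l + 1) ^ 3 * e₃ + (l + 1) ^ 2 * v * e₂ + (l + 1) * v ^ 2 * e₁
  have hgn : ‖(x₁ + y₁) * (x₂ + y₂) * (x₃ + y₃)‖ = ‖v‖ ^ 3 := by
    have hp3 : 0 < ‖v‖ ^ 3 := by positivity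
    rw [hg, norm_add_eq_left, norm_pow]
    rw [norm_pow]
    refine norm_sub_lt_of_lt ?_ ?_
    · calc ‖W.a₄ * (l + 1) ^ 2 * v‖ = ‖W.a₄‖ * (‖l + 1‖ ^ 2 * ‖v‖) := by
            rw [norm_mul, norm_mul, norm_pow, mul_assoc]
        _ ≤ ‖W.a₄‖ * (‖v‖ ^ 2 * ‖v‖) := by gcongr
        _ = ‖W.a₄‖ * ‖v‖ ^ 3 := by ring
        _ < ‖v‖ ^ 3 := mul_lt_of_lt_one_left hp3 hW.norm_a₄_lt
    · calc ‖W.a₆ * (l + 1) ^ 3‖ = ‖W.a₆‖ * ‖l + 1‖ ^ 3 := by rw [norm_mul, norm_pow]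
        _ ≤ ‖W.a₆‖ * ‖v‖ ^ 3 := by gcongr
        _ < ‖v‖ ^ 3 := mul_lt_of_lt_one_left hp3 hW.a₆_lt
  have hg0 : (x₁ + y₁) * (x₂ + y₂) * (x₃ + y₃) ≠ 0 := by
    rw [← norm_pos_iff, hgn]; positivity
  have hne : x₁ + y₁ ≠ 0 ∧ x₂ + y₂ ≠ 0 ∧ x₃ + y₃ ≠ 0 := by
    simpa [not_or, and_assoc] using hg0
  obtain ⟨g₁, g₂, g₃⟩ := hne
  have diff : y₁ / (x₁ + y₁) * (y₂ / (x₂ + y₂)) * (y₃ / (x₃ + y₃)) - 1 =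
      (W.a₆ * (3 * (l * l) + 3 * l + 1) - W.a₄ * ((2 * l + 1) * v)) /
        ((x₁ + y₁) * (x₂ + y₂) * (x₃ + y₃)) := by
    rw [eq_div_iff hg0]
    have : y₁ / (x₁ + y₁) * (y₂ / (x₂ + y₂)) * (y₃ / (x₃ + y₃)) *
        ((x₁ + y₁) * (x₂ + y₂) * (x₃ + y₃)) = y₁ * y₂ * y₃ := by field_simp
    rw [sub_mul, this, one_mul, hy, hg]
    ring
  have two : ‖(2 : L)‖ ≤ 1 := by
    simpa using IsUltrametricDist.norm_natCast_le_one L 2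
  have three : ‖(3 : L)‖ ≤ 1 := by
    simpa using IsUltrametricDist.norm_natCast_le_one L 3
  have num : ‖W.a₆ * (3 * (l * l) + 3 * l + 1) - W.a₄ * ((2 * l + 1) * v)‖ ≤
      ‖W.a₆‖ * ‖v‖ ^ 2 := by
    have hvv : ‖v‖ ≤ ‖v‖ ^ 2 := by nlinarith
    refine norm_sub_le_of_le ?_ ?_
    · rw [norm_mul]
      refine mul_le_mul_of_nonneg_left (norm_add_le_of_le (norm_add_le_of_le ?_ ?_) ?_)
        (norm_nonneg _)
      · rw [norm_mul, norm_mul, sq]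
        exact (mul_le_of_le_one_left (by positivity) three).trans (by gcongr)
      · rw [norm_mul]
        exact (mul_le_of_le_one_left hl0 three).trans (hlv.trans hvv)
      · rw [norm_one]; exact hv1.trans hvv
    · rw [norm_mul, norm_mul, sq]
      refine mul_le_mul hW.a₄ (mul_le_mul_of_nonneg_right (norm_add_le_of_le ?_ ?_) hv0)
        (by positivity) (norm_nonneg _)
      · rw [norm_mul]
        exact (mul_le_of_le_one_left hl0 two).trans hlv
      · rw [norm_one]; exact hv1
  have hd : y₁ / (x₁ + y₁) - 1 = -x₁ / (x₁ + y₁) := by field_simp; ring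
  obtain ⟨n1, n2⟩ := hW.norm_of_one_le h₁ hx₁
  have hx1v : ‖x₁‖ ≤ ‖v‖ ^ 2 := by
    rw [hv2n, mul_assoc]; exact le_mul_of_one_le_right (norm_nonneg _) p23
  have hx1p : 0 < ‖x₁‖ := by linarith
  have hy1p : 0 < ‖y₁‖ := by rw [← n1]; exact norm_pos_iff.mpr g₁
  -- The error is at most `|a₆| / |v|`, and `|x₁| / |y₁|`, the distance of the coordinate of the
  -- first point from `1`, is at least `1 / |v|`. Keeping this factor makes the estimate effective
  -- in the kernel of reduction.
  have hdn : 1 ≤ ‖v‖ * (‖x₁‖ / ‖y₁‖) := by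
    rw [← mul_div_assoc, one_le_div hy1p]
    refine (pow_le_pow_iff_left₀ hy1p.le (by positivity) two_ne_zero).mp ?_
    rw [n2, mul_pow]
    nlinarith [sq_nonneg ‖x₁‖]
  rw [diff, norm_div, hgn, hd, norm_div, norm_neg, n1, div_le_iff₀ (by positivity)]
  refine num.trans ?_
  have : ‖W.a₆‖ * (‖x₁‖ / ‖y₁‖) * ‖v‖ ^ 3 = ‖W.a₆‖ * ‖v‖ ^ 2 * (‖v‖ * (‖x₁‖ / ‖y₁‖)) := by ring
  rw [this]
  exact le_mul_of_one_le_right (by positivity) hdn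

end line

end IsNodal

end WeierstrassCurve

end

/-! ## Nodal reduction: smooth points -/

noncomputable section

open WeierstrassCurve IsUltrametricDist

namespace WeierstrassCurve

namespace Affine.Point

variable {L : Type*} [NormedField L] {W : WeierstrassCurve L}

/-- The points which do not reduce to the node `(0, 0)`. -/
def IsSmooth : W.toAffine.Point → Prop
  | .zero => True
  | .some x _ _ => 1 ≤ ‖x‖

/-- The coordinate `y / (x + y)`, which on the smooth points of the nodal cubic `y² + xy = x³` is
the isomorphism to the multiplicative group. -/
def unitCoord : W.toAffine.Point → L
  | .zero => 1
  | .some x y _ => y / (x + y)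

lemma isSmooth_zero : IsSmooth (0 : W.toAffine.Point) := trivial

lemma isSmooth_some {x y : L} {h : W.toAffine.Nonsingular x y} :
    IsSmooth (.some x y h) ↔ 1 ≤ ‖x‖ := Iff.rfl

lemma unitCoord_zero : unitCoord (0 : W.toAffine.Point) = 1 := rfl

lemma unitCoord_some {x y : L} (h : W.toAffine.Nonsingular x y) :
    unitCoord (.some x y h) = y / (x + y) := rfl

lemma isSmooth_neg {P : W.toAffine.Point} : IsSmooth (-P) ↔ IsSmooth P := by
  cases P <;> rfl

end Affine.Point

open Affine.Point

namespace IsNodal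

variable {L : Type*} [NormedField L] {W : WeierstrassCurve L} (hW : W.IsNodal)
include hW

lemma neg_some' {x y : L} (h : W.toAffine.Nonsingular x y) :
    ∃ h', -Affine.Point.some x y h = .some x (-(x + y)) h' := by
  have e : W.toAffine.negY x y = -(x + y) := by
    rw [Affine.negY, hW.a₁, hW.a₃]; ring
  refine ⟨e ▸ (Affine.nonsingular_neg x y).mpr h, ?_⟩
  rw [Affine.Point.neg_some]
  simp only [e]

lemma unitCoord_neg (P : W.toAffine.Point) : unitCoord (-P) = (unitCoord P)⁻¹ := by
  rcases P with _ | ⟨x, y, h⟩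
  · exact inv_one.symm
  · obtain ⟨h', e⟩ := hW.neg_some' h
    rw [e, unitCoord_some, unitCoord_some, inv_div, neg_add_rev, add_comm (-y), add_neg_cancel_left,
      ← neg_add_rev, add_comm y, neg_div_neg_eq]

variable [IsUltrametricDist L]

lemma norm_unitCoord {P : W.toAffine.Point} (hP : IsSmooth P) : ‖unitCoord P‖ = 1 := by
  rcases P with _ | ⟨x, y, h⟩
  · exact norm_one
  · obtain ⟨h1, h2⟩ := hW.norm_of_one_le h.1 hP
    have hx : 0 < ‖x‖ := one_pos.trans_le hP
    have hy : ‖y‖ ≠ 0 := by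
      intro h0
      rw [h0] at h2
      have := pow_pos hx 3
      rw [← h2] at this
      norm_num at this
    rw [unitCoord_some, norm_div, h1, div_self hy]

lemma unitCoord_ne_zero {P : W.toAffine.Point} (hP : IsSmooth P) : unitCoord P ≠ 0 := by
  rw [← norm_ne_zero_iff, hW.norm_unitCoord hP]; exact one_ne_zero

lemma eq_zero_of_unitCoord_eq_one {P : W.toAffine.Point} (hP : IsSmooth P)
    (h1 : unitCoord P = 1) : P = 0 := by
  have h0 := hW.unitCoord_ne_zero hP
  rcases P with _ | ⟨x, y, h⟩
  · rfl
  · exfalso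
    rw [unitCoord_some] at h1 h0
    have hxy : x + y ≠ 0 := fun H ↦ h0 (by rw [H, div_zero])
    rw [div_eq_one_iff_eq hxy] at h1
    have hx : x = 0 := by linear_combination -h1
    rw [isSmooth_some, hx, norm_zero] at hP
    linarith

lemma norm_unitCoord_sub_one_le {P : W.toAffine.Point} (hP : IsSmooth P) :
    ‖unitCoord P - 1‖ ≤ 1 :=
  norm_sub_le_of_le (hW.norm_unitCoord hP).le norm_one.le

variable [DecidableEq L]

lemma isSmooth_add {P Q : W.toAffine.Point} (hP : IsSmooth P) (hQ : IsSmooth Q) :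
    IsSmooth (P + Q) := by
  by_cases hP0 : P = 0
  · rwa [hP0, zero_add]
  by_cases hQ0 : Q = 0
  · rwa [hQ0, add_zero]
  by_cases h0 : P + Q = 0
  · rw [h0]; exact isSmooth_zero
  obtain ⟨x₁, y₁, h₁, rfl⟩ := exists_eq_some hP0
  obtain ⟨x₂, y₂, h₂, rfl⟩ := exists_eq_some hQ0
  obtain ⟨l, v, x₃, y₃, h₃, e, l₁, l₂, l₃, e₁, e₂, e₃⟩ := exists_line hW.a₁ hW.a₂ hW.a₃ h₁ h₂ h0
  rw [e, isSmooth_neg]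
  exact hW.one_le_norm_third h₃.1 l₃ e₁ e₂ hP hQ

lemma norm_unitCoord_add {P Q : W.toAffine.Point} (hP : IsSmooth P) (hQ : IsSmooth Q) :
    ‖unitCoord (P + Q) - unitCoord P * unitCoord Q‖ ≤ ‖W.a₆‖ * ‖unitCoord P - 1‖ := by
  by_cases hP0 : P = 0
  · simp [hP0, unitCoord_zero]
  by_cases hQ0 : Q = 0
  · simp only [hQ0, unitCoord_zero, add_zero, mul_one, sub_self, norm_zero]; positivity
  by_cases h0 : P + Q = 0
  · rw [h0, eq_neg_of_add_eq_zero_right h0, hW.unitCoord_neg, mul_inv_cancel₀ (hW.unitCoord_ne_zero hP),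
      unitCoord_zero, sub_self, norm_zero]
    positivity
  have hPQ := hW.isSmooth_add hP hQ
  obtain ⟨x₁, y₁, h₁, rfl⟩ := exists_eq_some hP0
  obtain ⟨x₂, y₂, h₂, rfl⟩ := exists_eq_some hQ0
  obtain ⟨l, v, x₃, y₃, h₃, e, l₁, l₂, l₃, e₁, e₂, e₃⟩ := exists_line hW.a₁ hW.a₂ hW.a₃ h₁ h₂ h0
  rw [e, isSmooth_neg] at hPQ
  have key := hW.norm_uniformizer_mul_sub_one h₁.1 l₁ l₂ l₃ e₁ e₂ e₃ hP hQ hPQ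
  have n3 := hW.norm_unitCoord hPQ
  have u3 := hW.unitCoord_ne_zero hPQ
  rw [e, hW.unitCoord_neg]
  rw [← unitCoord_some h₁, ← unitCoord_some h₂, ← unitCoord_some h₃] at key
  refine le_trans (le_of_eq ?_) key
  generalize unitCoord (Affine.Point.some x₃ y₃ h₃) = u at *
  rw [← norm_neg, neg_sub, ← mul_one ‖_ - u⁻¹‖, ← n3, ← norm_mul, sub_mul, inv_mul_cancel₀ u3]

lemma isSmooth_nsmul {P : W.toAffine.Point} (hP : IsSmooth P) (n : ℕ) : IsSmooth (n • P) := by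
  induction n with
  | zero => rw [zero_nsmul]; exact isSmooth_zero
  | succ n ih => rw [succ_nsmul]; exact hW.isSmooth_add ih hP

lemma norm_unitCoord_nsmul {P : W.toAffine.Point} (hP : IsSmooth P) (n : ℕ) :
    ‖unitCoord (n • P) - unitCoord P ^ n‖ ≤ ‖W.a₆‖ * ‖unitCoord P - 1‖ := by
  induction n with
  | zero => rw [zero_nsmul, unitCoord_zero, pow_zero, sub_self, norm_zero]; positivity
  | succ n ih =>
    rw [succ_nsmul', pow_succ', ← sub_add_sub_cancel _ (unitCoord P * unitCoord (n • P))]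
    refine norm_add_le_of_le (hW.norm_unitCoord_add hP (hW.isSmooth_nsmul hP n)) ?_
    rwa [← mul_sub, norm_mul, hW.norm_unitCoord hP, one_mul]

lemma norm_unitCoord_pow_sub_one {P : W.toAffine.Point} (hP : IsSmooth P) {n : ℕ}
    (h : n • P = 0) : ‖unitCoord P ^ n - 1‖ ≤ ‖W.a₆‖ * ‖unitCoord P - 1‖ := by
  have := hW.norm_unitCoord_nsmul hP n
  rwa [h, unitCoord_zero, norm_sub_rev] at this

/-- The kernel of reduction has no torsion prime to the residue characteristic. -/
lemma eq_zero_of_nsmul_eq_zero {P : W.toAffine.Point} (hP : IsSmooth P) {n : ℕ}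
    (hn : ‖(n : L)‖ = 1) (h : n • P = 0) (h1 : ‖unitCoord P - 1‖ < 1) : P = 0 := by
  refine hW.eq_zero_of_unitCoord_eq_one hP ?_
  have := hW.norm_unitCoord_pow_sub_one hP h
  -- The bound becomes `|u - 1| ≤ |a₆| |u - 1|` with `|a₆| < 1`, which forces `u = 1`.
  rw [norm_pow_sub_one h1 hn] at this
  by_contra hne
  have hpos : 0 < ‖unitCoord P - 1‖ := norm_pos_iff.mpr (sub_ne_zero.mpr hne)
  exact absurd this (not_le.mpr (mul_lt_of_lt_one_left hpos hW.a₆_lt))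

/-- The subgroup of points which do not reduce to the node. -/
def smoothPoints : AddSubgroup W.toAffine.Point where
  carrier := {P : W.toAffine.Point | IsSmooth P}
  zero_mem' := isSmooth_zero (W := W)
  add_mem' {P Q} hP hQ := hW.isSmooth_add (P := P) (Q := Q) hP hQ
  neg_mem' {P} hP := (isSmooth_neg (W := W) (P := P)).mpr hP

lemma mem_smoothPoints {P : W.toAffine.Point} : P ∈ hW.smoothPoints ↔ IsSmooth P := Iff.rfl

end IsNodal

/-! ### Sums of points reducing to the node -/

namespace IsNodal

section

variable {L : Type*} [NormedField L] {W : WeierstrassCurve L} {x₁ y₁ x₂ y₂ x₃ y₃ l v : L}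

/-- The slope with denominator `y₁ + x₂ + y₂`, the difference of `y₁` and the ordinate of `-Q`. It
covers chord and tangent at once. Near the node the quadratic terms are negligible, so `l` and `l +
1` are governed by `-y₁` and `x₂ + y₂`. -/
lemma slope_mul_eq (l₁ : y₁ = l * x₁ + v) (l₂ : y₂ = l * x₂ + v)
    (e₁ : x₁ + x₂ + x₃ = l ^ 2 + l)
    (e₂ : x₁ * x₂ + x₁ * x₃ + x₂ * x₃ = W.a₄ - 2 * l * v - v) :
    l * (y₁ + (x₂ + y₂)) = x₁ ^ 2 + x₁ * x₂ + x₂ ^ 2 + W.a₄ - y₁ ∧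
    (l + 1) * (y₁ + (x₂ + y₂)) = x₁ ^ 2 + x₁ * x₂ + x₂ ^ 2 + W.a₄ + (x₂ + y₂) := by
  subst l₁ l₂
  constructor <;> linear_combination e₂ - (x₁ + x₂) * e₁

/-- Since `x₃ = l(l + 1) - x₁ - x₂`, it suffices that `l` and `l + 1` are integral and one of them
lies in the maximal ideal. -/
lemma norm_third_lt_one [IsUltrametricDist L] {a b D : L} {R : ℝ} (hR : 0 < R) (ha : ‖a‖ ≤ R) (hb : ‖b‖ ≤ R)
    (hD : ‖D‖ = R) (ea : l * D = a) (eb : (l + 1) * D = b) (hab : ‖a‖ < R ∨ ‖b‖ < R)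
    (e₁ : x₁ + x₂ + x₃ = l ^ 2 + l) (hx₁ : ‖x₁‖ < 1) (hx₂ : ‖x₂‖ < 1) : ‖x₃‖ < 1 := by
  have e : x₃ = l * (l + 1) - x₁ - x₂ := by linear_combination e₁
  have na : ‖l‖ * R = ‖a‖ := by rw [← hD, ← norm_mul, ea]
  have nb : ‖l + 1‖ * R = ‖b‖ := by rw [← hD, ← norm_mul, eb]
  have la : ‖l‖ ≤ 1 := by
    refine le_of_mul_le_mul_right ?_ hR; rwa [na, one_mul]
  have lb : ‖l + 1‖ ≤ 1 := by
    refine le_of_mul_le_mul_right ?_ hR; rwa [nb, one_mul]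
  rw [e]
  refine norm_sub_lt_of_lt (norm_sub_lt_of_lt ?_ hx₁) hx₂
  rw [norm_mul]
  rcases hab with h | h
  · have : ‖l‖ < 1 := by
      refine lt_of_mul_lt_mul_right ?_ hR.le; rwa [na, one_mul]
    exact mul_lt_one_of_nonneg_of_lt_one_left (norm_nonneg _) this lb
  · have : ‖l + 1‖ < 1 := by
      refine lt_of_mul_lt_mul_right ?_ hR.le; rwa [nb, one_mul]
    exact mul_lt_one_of_nonneg_of_lt_one_right la (norm_nonneg _) this

end

variable {L : Type*} [NormedField L] {W : WeierstrassCurve L} (hW : W.IsNodal)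
  [IsUltrametricDist L]
include hW

/-- Solve the equation for `a₆`: every other term is at most `r²`, except `a₄x`, which is smaller
than `a₆` itself. -/
lemma norm_a₆_le_sq {x y : L} (h : W.toAffine.Equation x y) (hx : ‖x‖ < 1)
    {r : ℝ} (hxr : ‖x‖ ≤ r) (hyr : ‖y‖ ≤ r) (hr : r < 1) : ‖W.a₆‖ ≤ r ^ 2 := by
  rw [hW.equation_iff] at h
  by_contra! hc
  have hr0 : 0 ≤ r := (norm_nonneg _).trans hxr
  have e : W.a₆ = y * (x + y) - x ^ 3 - W.a₄ * x := by linear_combination -h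
  have : ‖W.a₆‖ < ‖W.a₆‖ := by
    conv_lhs => rw [e]
    refine norm_sub_lt_of_lt (norm_sub_lt_of_lt ?_ ?_) ?_
    · rw [norm_mul]
      refine lt_of_le_of_lt ?_ hc
      rw [sq]
      exact mul_le_mul hyr (norm_add_le_of_le hxr hyr) (norm_nonneg _) hr0
    · rw [norm_pow]
      refine lt_of_le_of_lt ?_ hc
      refine (pow_le_pow_left₀ (norm_nonneg _) hxr 3).trans ?_
      exact pow_le_pow_of_le_one hr0 hr.le (by norm_num)
    · rw [norm_mul]
      exact (mul_le_mul_of_nonneg_right hW.a₄ (norm_nonneg _)).trans_lt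
        (mul_lt_of_lt_one_right hW.a₆_pos hx)
  exact lt_irrefl _ this

/-- At a point reducing to the node, with `|x| ≤ |y|`, the two branches have product `|a₆|`. -/
lemma norm_mul_eq_of_lt {x y : L} (h : W.toAffine.Equation x y) (hx : ‖x‖ < 1)
    (hxy : ‖x‖ ≤ ‖y‖) (h6 : ‖W.a₆‖ < ‖y‖ ^ 2) : ‖x + y‖ < ‖y‖ ∧ ‖x‖ = ‖y‖ := by
  have hy := hW.norm_lt_one_of_norm_lt_one h hx
  rw [hW.equation_iff] at h
  have hy0 : 0 < ‖y‖ := by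
    by_contra! h0
    rw [le_antisymm h0 (norm_nonneg _)] at h6
    have := norm_nonneg W.a₆
    norm_num at h6
    linarith
  have h1 : ‖x + y‖ < ‖y‖ := by
    have : ‖y * (x + y)‖ < ‖y‖ * ‖y‖ := by
      rw [h, ← sq]
      refine norm_add_lt_of_lt (norm_add_lt_of_lt ?_ ?_) h6
      · rw [norm_pow]
        refine (pow_le_pow_left₀ (norm_nonneg _) hxy 3).trans_lt ?_
        exact pow_lt_pow_right_of_lt_one₀ hy0 hy (by norm_num)
      · rw [norm_mul]
        exact (mul_le_of_le_one_right (norm_nonneg _) hx.le).trans_lt (hW.a₄.trans_lt h6)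
    rw [norm_mul] at this
    exact lt_of_mul_lt_mul_left this hy0.le
  refine ⟨h1, ?_⟩
  have : ‖(x + y) - y‖ = ‖y‖ := by
    rw [← norm_neg, neg_sub]
    exact norm_sub_eq_left h1
  rwa [add_sub_cancel_right] at this

variable {r : ℝ} {x₁ y₁ x₂ y₂ x₃ y₃ l v : L}

lemma norm_quadratic_lt (h6 : ‖W.a₆‖ ≤ r ^ 2) (hr0 : 0 ≤ r) (hr : r < 1)
    (hx₁ : ‖x₁‖ ≤ r) (hx₂ : ‖x₂‖ ≤ r) : ‖x₁ ^ 2 + x₁ * x₂ + x₂ ^ 2 + W.a₄‖ < r := by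
  have h6p := hW.a₆_pos
  have hr0' : 0 < r := by
    rcases hr0.eq_or_lt with h | h
    · rw [← h] at h6; norm_num at h6; rw [h6, norm_zero] at h6p; exact absurd h6p (lt_irrefl _)
    · exact h
  have hrr : r * r < r := mul_lt_of_lt_one_left hr0' hr
  have hm : ∀ a b : L, ‖a‖ ≤ r → ‖b‖ ≤ r → ‖a * b‖ < r := fun a b ha hb ↦ by
    rw [norm_mul]
    exact (mul_le_mul ha hb (norm_nonneg _) hr0).trans_lt hrr
  rw [sq, sq]
  refine norm_add_lt_of_lt (norm_add_lt_of_lt (norm_add_lt_of_lt (hm _ _ hx₁ hx₁)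
    (hm _ _ hx₁ hx₂)) (hm _ _ hx₂ hx₂)) ((hW.a₄.trans h6).trans_lt ?_)
  rwa [sq]

variable [DecidableEq L] {h₁ : W.toAffine.Nonsingular x₁ y₁} {h₂ : W.toAffine.Nonsingular x₂ y₂}

/-- Points at the same distance from the node, on different branches, add to a smooth point. -/
lemma isSmooth_add_of_norm_eq (hx₁ : ‖x₁‖ < 1) (h1 : ‖x₁‖ ≤ ‖y₁‖) (h2 : ‖x₂‖ ≤ ‖x₂ + y₂‖)
    (h : ‖y₁‖ = ‖x₂ + y₂‖) :
    IsSmooth (Affine.Point.some x₁ y₁ h₁ + .some x₂ y₂ h₂) := by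
  by_cases h0 : Affine.Point.some x₁ y₁ h₁ + .some x₂ y₂ h₂ = 0
  · rw [h0]; exact isSmooth_zero
  obtain ⟨l, v, x₃, y₃, h₃, e, l₁, l₂, l₃, e₁, e₂, e₃⟩ := exists_line hW.a₁ hW.a₂ hW.a₃ h₁ h₂ h0
  rw [e, isSmooth_neg, isSmooth_some]
  obtain ⟨ea, eb⟩ := slope_mul_eq l₁ l₂ e₁ e₂
  have hy₁ := hW.norm_lt_one_of_norm_lt_one h₁.1 hx₁
  have h6 := hW.norm_a₆_le_sq h₁.1 hx₁ h1 le_rfl hy₁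
  have hN := hW.norm_quadratic_lt h6 (norm_nonneg _) hy₁ h1 (h2.trans h.ge)
  have hD : ‖y₁ + (x₂ + y₂)‖ ≤ ‖y₁‖ := norm_add_le_of_le le_rfl h.ge
  have hpos : 0 < ‖y₁‖ := (norm_nonneg _).trans_lt hN
  have na : ‖l‖ * ‖y₁ + (x₂ + y₂)‖ = ‖y₁‖ := by
    rw [← norm_mul, ea, ← norm_neg, neg_sub]
    exact norm_sub_eq_left hN
  have nb : ‖l + 1‖ * ‖y₁ + (x₂ + y₂)‖ = ‖y₁‖ := by
    rw [← norm_mul, eb, add_comm, norm_add_eq_left, h]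
    rwa [← h]
  have la : 1 ≤ ‖l‖ := by
    by_contra! hc
    have : ‖l‖ * ‖y₁ + (x₂ + y₂)‖ ≤ ‖l‖ * ‖y₁‖ := by gcongr
    nlinarith
  have lb : 1 ≤ ‖l + 1‖ := by
    by_contra! hc
    have : ‖l + 1‖ * ‖y₁ + (x₂ + y₂)‖ ≤ ‖l + 1‖ * ‖y₁‖ := by gcongr
    nlinarith
  have ex : x₃ = l * (l + 1) - (x₁ + x₂) := by linear_combination e₁
  have hll : 1 ≤ ‖l * (l + 1)‖ := by
    rw [norm_mul]; exact one_le_mul_of_one_le_of_one_le la lb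
  rw [ex, norm_sub_eq_left]
  · exact hll
  · exact (norm_add_lt_of_lt hx₁ ((h2.trans h.ge).trans_lt hy₁)).trans_le hll

/-- With unequal distances the denominator of `slope_mul_eq` has the larger norm, while one of the
numerators for `l` and `l + 1` is strictly smaller. -/
lemma not_isSmooth_add_of_norm_ne (hx₁ : ‖x₁‖ < 1) (hx₂ : ‖x₂‖ < 1) (h1 : ‖x₁‖ ≤ ‖y₁‖)
    (h2 : ‖x₂‖ ≤ ‖x₂ + y₂‖) (h : ‖y₁‖ ≠ ‖x₂ + y₂‖) :
    ¬ IsSmooth (Affine.Point.some x₁ y₁ h₁ + .some x₂ y₂ h₂) := by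
  by_cases h0 : Affine.Point.some x₁ y₁ h₁ + .some x₂ y₂ h₂ = 0
  · obtain ⟨h', e⟩ := hW.neg_some' h₂
    rw [add_eq_zero_iff_eq_neg, e, Affine.Point.some.injEq] at h0
    exact absurd (by rw [h0.2, norm_neg]) h
  obtain ⟨l, v, x₃, y₃, h₃, e, l₁, l₂, l₃, e₁, e₂, e₃⟩ := exists_line hW.a₁ hW.a₂ hW.a₃ h₁ h₂ h0
  rw [e, isSmooth_neg, isSmooth_some, not_le]
  obtain ⟨ea, eb⟩ := slope_mul_eq l₁ l₂ e₁ e₂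
  have hy₁ := hW.norm_lt_one_of_norm_lt_one h₁.1 hx₁
  have hy₂ := hW.norm_lt_one_of_norm_lt_one h₂.1 hx₂
  have hg₂ : ‖x₂ + y₂‖ < 1 := norm_add_lt_of_lt hx₂ hy₂
  have h6 := hW.norm_a₆_le_sq h₁.1 hx₁ h1 le_rfl hy₁
  have hR : max ‖y₁‖ ‖x₂ + y₂‖ < 1 := max_lt hy₁ hg₂
  have h6' : ‖W.a₆‖ ≤ (max ‖y₁‖ ‖x₂ + y₂‖) ^ 2 :=
    h6.trans (pow_le_pow_left₀ (norm_nonneg _) (le_max_left _ _) 2)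
  have hN := hW.norm_quadratic_lt h6' (le_max_of_le_left (norm_nonneg _)) hR
    (h1.trans (le_max_left _ _)) (h2.trans (le_max_right _ _))
  have hpos := (norm_nonneg _).trans_lt hN
  refine norm_third_lt_one hpos (norm_sub_le_of_le hN.le (le_max_left _ _))
    (norm_add_le_of_le hN.le (le_max_right _ _)) (norm_add_eq_max_of_norm_ne_norm h) ea eb ?_
    e₁ hx₁ hx₂
  rcases lt_or_gt_of_ne h with hlt | hlt
  · exact .inl (norm_sub_lt_of_lt hN (hlt.trans_le (le_max_right _ _)))
  · exact .inr (norm_add_lt_of_lt hN (hlt.trans_le (le_max_left _ _)))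

lemma not_isSmooth_add_of_lt (hx₁ : ‖x₁‖ < 1) (hx₂ : ‖x₂‖ < 1) (h1 : ‖x₁‖ ≤ ‖y₁‖)
    (h2 : ‖x₂‖ ≤ ‖y₂‖) (h : ‖y₂‖ ≤ ‖y₁‖) (h6 : ‖W.a₆‖ < ‖y₁‖ ^ 2) :
    ¬ IsSmooth (Affine.Point.some x₁ y₁ h₁ + .some x₂ y₂ h₂) := by
  obtain ⟨hg₁, hxy₁⟩ := hW.norm_mul_eq_of_lt h₁.1 hx₁ h1 h6
  by_cases h0 : Affine.Point.some x₁ y₁ h₁ + .some x₂ y₂ h₂ = 0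
  · obtain ⟨h', e⟩ := hW.neg_some' h₂
    rw [add_eq_zero_iff_eq_neg, e, Affine.Point.some.injEq] at h0
    obtain ⟨rfl, rfl⟩ := h0
    rw [neg_add_rev, add_comm (-y₂), add_neg_cancel_left, norm_neg, ← neg_add_rev, norm_neg,
      add_comm] at hg₁
    rw [norm_neg] at hxy₁
    linarith
  obtain ⟨l, v, x₃, y₃, h₃, e, l₁, l₂, l₃, e₁, e₂, e₃⟩ := exists_line hW.a₁ hW.a₂ hW.a₃ h₁ h₂ h0
  rw [e, isSmooth_neg, isSmooth_some, not_le]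
  have hy₁ := hW.norm_lt_one_of_norm_lt_one h₁.1 hx₁
  rcases h.eq_or_lt with heq | hlt
  · have hN := hW.norm_quadratic_lt h6.le (norm_nonneg _) hy₁ (heq ▸ h2) h1
    have hpos := (norm_nonneg _).trans_lt hN
    obtain ⟨ea, eb⟩ := slope_mul_eq (x₃ := x₃) (W := W) l₂ l₁ (by linear_combination e₁)
      (by linear_combination e₂)
    refine norm_third_lt_one hpos (norm_sub_le_of_le hN.le h) (norm_add_le_of_le hN.le hg₁.le)
      ?_ ea eb (.inr (norm_add_lt_of_lt hN hg₁)) e₁ hx₁ hx₂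
    rw [norm_add_eq_left, heq]
    rwa [heq]
  -- When `|y₂| < |y₁|` the ordinary chord slope suffices: the numerator `(x₁ + y₁) - (x₂ + y₂)` of
  -- `l + 1` is smaller than the denominator `x₁ - x₂`.
  · have hD : ‖x₁ - x₂‖ = ‖y₁‖ := by
      rw [norm_sub_eq_left, hxy₁]
      rw [hxy₁]; exact h2.trans_lt hlt
    have hpos : 0 < ‖y₁‖ := (norm_nonneg _).trans_lt hlt
    have hg : ‖x₁ + y₁ - (x₂ + y₂)‖ < ‖y₁‖ :=
      norm_sub_lt_of_lt hg₁ (norm_add_lt_of_lt (h2.trans_lt hlt) hlt)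
    exact norm_third_lt_one hpos (norm_sub_le_of_le le_rfl h) hg.le hD
      (by rw [l₁, l₂]; ring) (by rw [l₁, l₂]; ring) (.inr hg) e₁ hx₁ hx₂

end IsNodal

end WeierstrassCurve

end

/-! ## The component group over `ℚ_ℓ` -/

noncomputable section

open WeierstrassCurve IsUltrametricDist Affine.Point

namespace WeierstrassCurve

/-- An absolute value distinguishing the components of the special fibre of a minimal regular
model, for a curve with nodal reduction. -/
def Affine.Point.componentNorm {L : Type*} [NormedField L] {W : WeierstrassCurve L} :
    W.toAffine.Point → ℝ
  | .zero => 1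
  | .some x y _ => open scoped Classical in
    -- At the node the branches are `y = 0` and `x + y = 0`, with `y (x + y) = x³ + a₄x + a₆`. Only
    -- the larger of `y` and `x + y` has a norm determined by the component, as `x³` may swamp `a₆`
    -- in the smaller; hence `|a₆| / |y|` stands in for `|x + y|` when `|x| ≤ |y|`.
    if 1 ≤ ‖x‖ then 1 else if ‖x‖ ≤ ‖y‖ then ‖W.a₆‖ / ‖y‖ else ‖x + y‖

namespace IsNodal

section

variable {L : Type*} [NormedField L] {W : WeierstrassCurve L} (hW : W.IsNodal)

lemma componentNorm_of_isSmooth {P : W.toAffine.Point} (hP : IsSmooth P) :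
    componentNorm P = 1 := by
  rcases P with _ | ⟨x, y, h⟩
  · rfl
  · exact if_pos hP

lemma componentNorm_of_le {x y : L} {h : W.toAffine.Nonsingular x y} (hx : ‖x‖ < 1)
    (hxy : ‖x‖ ≤ ‖y‖) : componentNorm (.some x y h) = ‖W.a₆‖ / ‖y‖ := by
  rw [componentNorm, if_neg (not_le.mpr hx), if_pos hxy]

lemma componentNorm_of_lt {x y : L} {h : W.toAffine.Nonsingular x y} (hx : ‖x‖ < 1)
    (hxy : ‖y‖ < ‖x‖) : componentNorm (.some x y h) = ‖x + y‖ := by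
  rw [componentNorm, if_neg (not_le.mpr hx), if_neg (not_le.mpr hxy)]

variable [IsUltrametricDist L]
include hW

lemma norm_a₆_lt_sq {x y : L} (h : W.toAffine.Equation x y) (hx : ‖x‖ < 1) (hxy : ‖y‖ < ‖x‖) :
    ‖W.a₆‖ < ‖x + y‖ ^ 2 := by
  have hx0 : 0 < ‖x‖ := (norm_nonneg _).trans_lt hxy
  have h6 := hW.norm_a₆_le_sq h hx le_rfl hxy.le hx
  rw [norm_add_eq_left hxy]
  refine lt_of_le_of_ne h6 fun heq ↦ ?_
  rw [hW.equation_iff] at h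
  have e : W.a₆ = y * (x + y) - x ^ 3 - W.a₄ * x := by linear_combination -h
  have : ‖W.a₆‖ < ‖x‖ ^ 2 := by
    rw [e]
    refine norm_sub_lt_of_lt (norm_sub_lt_of_lt ?_ ?_) ?_
    · rw [norm_mul, norm_add_eq_left hxy, sq]
      exact mul_lt_mul_of_pos_right hxy hx0
    · rw [norm_pow]
      exact pow_lt_pow_right_of_lt_one₀ hx0 hx (by norm_num)
    · rw [norm_mul, ← heq]
      exact (mul_le_mul_of_nonneg_right hW.a₄ (norm_nonneg _)).trans_lt
        (mul_lt_of_lt_one_right hW.a₆_pos hx)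
  exact this.ne heq

lemma norm_pos_of_le {x y : L} (h : W.toAffine.Equation x y) (hx : ‖x‖ < 1) (hxy : ‖x‖ ≤ ‖y‖) :
    0 < ‖y‖ := by
  have := hW.norm_a₆_le_sq h hx hxy le_rfl (hW.norm_lt_one_of_norm_lt_one h hx)
  exact (sq_pos_iff.mp (hW.a₆_pos.trans_le this)).lt_of_le' (norm_nonneg y)

/-- The square of the norm is at most `|a₆|` in the second case and larger in the third, where the
norm stays below `1`. So values from different cases never coincide. -/
lemma componentNorm_trichotomy (P : W.toAffine.Point) :
    (IsSmooth P ∧ componentNorm P = 1) ∨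
    (∃ x y h, P = .some x y h ∧ ‖x‖ < 1 ∧ ‖x‖ ≤ ‖y‖ ∧ 0 < ‖y‖ ∧
      componentNorm P = ‖W.a₆‖ / ‖y‖ ∧ componentNorm P < 1 ∧ componentNorm P ^ 2 ≤ ‖W.a₆‖) ∨
    (∃ x y h, P = .some x y h ∧ ‖x‖ < 1 ∧ ‖x‖ ≤ ‖x + y‖ ∧ ‖W.a₆‖ < ‖x + y‖ ^ 2 ∧
      componentNorm P = ‖x + y‖ ∧ ‖x + y‖ < 1) := by
  by_cases hP : IsSmooth P
  · exact .inl ⟨hP, componentNorm_of_isSmooth hP⟩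
  rcases P with _ | ⟨x, y, h⟩
  · exact absurd trivial hP
  rw [isSmooth_some, not_le] at hP
  have hy1 := hW.norm_lt_one_of_norm_lt_one h.1 hP
  rcases le_or_gt ‖x‖ ‖y‖ with hxy | hxy
  · have hy := hW.norm_pos_of_le h.1 hP hxy
    have h6 := hW.norm_a₆_le_sq h.1 hP hxy le_rfl hy1
    have hc : ‖W.a₆‖ / ‖y‖ ≤ ‖y‖ := by rwa [div_le_iff₀ hy, ← sq]
    refine .inr (.inl ⟨x, y, h, rfl, hP, hxy, hy, componentNorm_of_le hP hxy, ?_, ?_⟩)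
    · rw [componentNorm_of_le hP hxy]
      exact hc.trans_lt hy1
    · rw [componentNorm_of_le hP hxy, sq]
      refine (mul_le_mul_of_nonneg_left hc (by positivity)).trans ?_
      rw [div_mul_cancel₀ _ hy.ne']
  · refine .inr (.inr ⟨x, y, h, rfl, hP, ?_, hW.norm_a₆_lt_sq h.1 hP hxy,
      componentNorm_of_lt hP hxy, norm_add_lt_of_lt hP hy1⟩)
    rw [norm_add_eq_left hxy]

variable [DecidableEq L]

lemma isSmooth_sub_iff_of_le {x₁ y₁ x₂ y₂ : L} (h₁ : W.toAffine.Nonsingular x₁ y₁)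
    (h₂ : W.toAffine.Nonsingular x₂ y₂) (hx₁ : ‖x₁‖ < 1) (hx₂ : ‖x₂‖ < 1) (hy₁ : ‖x₁‖ ≤ ‖y₁‖)
    (hy₂ : ‖x₂‖ ≤ ‖y₂‖) :
    IsSmooth (Affine.Point.some x₁ y₁ h₁ - .some x₂ y₂ h₂) ↔ ‖y₁‖ = ‖y₂‖ := by
  obtain ⟨h', e⟩ := hW.neg_some' h₂
  have e' : ‖x₂ + -(x₂ + y₂)‖ = ‖y₂‖ := by
    rw [neg_add, add_neg_cancel_left, norm_neg]
  rw [sub_eq_add_neg, e, ← e']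
  refine ⟨fun h ↦ ?_, hW.isSmooth_add_of_norm_eq hx₁ hy₁ (by rwa [e'])⟩
  by_contra hne
  exact hW.not_isSmooth_add_of_norm_ne hx₁ hx₂ hy₁ (by rwa [e']) hne h

lemma isSmooth_sub_iff_of_le_add {x₁ y₁ x₂ y₂ : L} (h₁ : W.toAffine.Nonsingular x₁ y₁)
    (h₂ : W.toAffine.Nonsingular x₂ y₂) (hx₁ : ‖x₁‖ < 1) (hx₂ : ‖x₂‖ < 1)
    (hy₁ : ‖x₁‖ ≤ ‖x₁ + y₁‖) (hy₂ : ‖x₂‖ ≤ ‖x₂ + y₂‖) :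
    IsSmooth (Affine.Point.some x₁ y₁ h₁ - .some x₂ y₂ h₂) ↔ ‖x₁ + y₁‖ = ‖x₂ + y₂‖ := by
  obtain ⟨h₁', e₁⟩ := hW.neg_some' h₁
  obtain ⟨h₂', e₂⟩ := hW.neg_some' h₂
  rw [← isSmooth_neg, neg_sub', e₁, e₂, hW.isSmooth_sub_iff_of_le _ _ hx₁ hx₂ (by rwa [norm_neg])
    (by rwa [norm_neg]), norm_neg, norm_neg]

lemma not_isSmooth_sub_of_lt {x₁ y₁ x₂ y₂ : L} (h₁ : W.toAffine.Nonsingular x₁ y₁)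
    (h₂ : W.toAffine.Nonsingular x₂ y₂) (hx₁ : ‖x₁‖ < 1) (hx₂ : ‖x₂‖ < 1) (hy₁ : ‖x₁‖ ≤ ‖y₁‖)
    (hy₂ : ‖x₂‖ ≤ ‖x₂ + y₂‖) (h6 : ‖W.a₆‖ < ‖x₂ + y₂‖ ^ 2) :
    ¬ IsSmooth (Affine.Point.some x₁ y₁ h₁ - .some x₂ y₂ h₂) := by
  obtain ⟨h', e⟩ := hW.neg_some' h₂
  rw [sub_eq_add_neg, e]
  rcases le_total ‖y₁‖ ‖x₂ + y₂‖ with h | h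
  · rw [add_comm (Affine.Point.some x₁ y₁ h₁)]
    exact hW.not_isSmooth_add_of_lt hx₂ hx₁ (by rwa [norm_neg]) hy₁ (by rwa [norm_neg])
      (by rwa [norm_neg])
  · exact hW.not_isSmooth_add_of_lt hx₁ hx₂ hy₁ (by rwa [norm_neg]) (by rwa [norm_neg])
      (h6.trans_le (pow_le_pow_left₀ (norm_nonneg _) h 2))

/-- Negation exchanges the branches, so a difference of points on one branch is a sum across
branches, smooth exactly at equal distances; across branches it becomes a sum on one branch,
excluded by `not_isSmooth_add_of_lt`. This identifies components both for counting them and for the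
Galois action. -/
lemma isSmooth_sub_iff {P Q : W.toAffine.Point} :
    IsSmooth (P - Q) ↔ componentNorm P = componentNorm Q := by
  have hs : ∀ {P Q : W.toAffine.Point}, IsSmooth P → (IsSmooth (P - Q) ↔ IsSmooth Q) :=
    fun {P Q} hP ↦ ⟨fun h ↦ by
      have := hW.isSmooth_add (isSmooth_neg.mpr h) hP
      rwa [neg_sub, sub_add_cancel] at this, fun h ↦ by
      rw [sub_eq_add_neg]; exact hW.isSmooth_add hP (isSmooth_neg.mpr h)⟩
  have hns : ∀ {P : W.toAffine.Point}, componentNorm P < 1 → ¬ IsSmooth P :=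
    fun h h' ↦ h.ne (componentNorm_of_isSmooth h')
  rcases hW.componentNorm_trichotomy P with ⟨hP, tP⟩ | ⟨x₁, y₁, h₁, rfl, hx₁, hy₁, p₁, t₁, u₁, s₁⟩ |
    ⟨x₁, y₁, h₁, rfl, hx₁, hy₁, s₁, t₁, u₁⟩ <;>
  rcases hW.componentNorm_trichotomy Q with ⟨hQ, tQ⟩ | ⟨x₂, y₂, h₂, rfl, hx₂, hy₂, p₂, t₂, u₂, s₂⟩ |
    ⟨x₂, y₂, h₂, rfl, hx₂, hy₂, s₂, t₂, u₂⟩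
  · exact iff_of_true ((hs hP).mpr hQ) (tP.trans tQ.symm)
  · exact iff_of_false (mt (hs hP).mp (hns u₂)) (tP ▸ u₂.ne')
  · exact iff_of_false (mt (hs hP).mp (hns (t₂ ▸ u₂))) (by rw [tP, t₂]; exact u₂.ne')
  · rw [← isSmooth_neg, neg_sub]
    exact iff_of_false (mt (hs hQ).mp (hns u₁)) (tQ ▸ u₁.ne)
  · rw [hW.isSmooth_sub_iff_of_le _ _ hx₁ hx₂ hy₁ hy₂, t₁, t₂, div_eq_div_iff p₁.ne' p₂.ne',
      mul_right_inj' hW.a₆_pos.ne', eq_comm]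
  · refine iff_of_false (hW.not_isSmooth_sub_of_lt _ _ hx₁ hx₂ hy₁ hy₂ s₂) fun h ↦ ?_
    rw [h, t₂] at s₁
    exact absurd s₁ (not_le.mpr s₂)
  · rw [← isSmooth_neg, neg_sub]
    exact iff_of_false (mt (hs hQ).mp (hns (t₁ ▸ u₁))) (by rw [tQ, t₁]; exact u₁.ne)
  · rw [← isSmooth_neg, neg_sub]
    refine iff_of_false (hW.not_isSmooth_sub_of_lt _ _ hx₂ hx₁ hy₂ hy₁ s₁) fun h ↦ ?_
    rw [← h, t₁] at s₂
    exact absurd s₂ (not_le.mpr s₁)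
  · rw [hW.isSmooth_sub_iff_of_le_add _ _ hx₁ hx₂ hy₁ hy₂, t₁, t₂]

end

section Padic

variable {ℓ : ℕ} [Fact ℓ.Prime] {W : WeierstrassCurve ℚ_[ℓ]} (hW : W.IsNodal)
include hW

/-- Put `y = ℓ^s`, `x = ℓ^s X` and divide by `ℓ^(2s)`. Modulo `ℓ` the equation in `X` is linear with
root `B - 1`, where `a₆ = ℓ^(2s) B`, and Hensel's lemma lifts it. -/
lemma exists_equation_of_norm_le {s : ℕ} (hs : 0 < s) (h6 : ‖W.a₆‖ ≤ ‖(ℓ : ℚ_[ℓ]) ^ s‖ ^ 2) :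
    ∃ x : ℚ_[ℓ], W.toAffine.Equation x (ℓ ^ s) ∧ ‖x‖ ≤ ‖(ℓ : ℚ_[ℓ]) ^ s‖ := by
  have hℓ : (ℓ : ℚ_[ℓ]) ≠ 0 := Nat.cast_ne_zero.mpr (Fact.out (p := ℓ.Prime)).ne_zero
  have hc : (ℓ : ℚ_[ℓ]) ^ s ≠ 0 := pow_ne_zero _ hℓ
  have hdiv : ∀ a : ℚ_[ℓ], ‖a‖ ≤ ‖(ℓ : ℚ_[ℓ]) ^ s‖ ^ 2 →
      ∃ b : ℤ_[ℓ], a = ((ℓ : ℚ_[ℓ]) ^ s) ^ 2 * b := fun a ha ↦ by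
    refine ⟨⟨a / ((ℓ : ℚ_[ℓ]) ^ s) ^ 2, ?_⟩, ?_⟩
    · rw [norm_div, norm_pow ((ℓ : ℚ_[ℓ]) ^ s)]
      exact div_le_one_of_le₀ ha (by positivity)
    · simp only
      field_simp
  obtain ⟨B, hB⟩ := hdiv _ h6
  obtain ⟨A, hA⟩ := hdiv _ (hW.a₄.trans h6)
  obtain ⟨c, hce⟩ : ∃ c : ℤ_[ℓ], c = (ℓ : ℤ_[ℓ]) ^ s := ⟨_, rfl⟩
  have hcn : ‖c‖ < 1 := by
    rw [hce, norm_pow]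
    exact pow_lt_one₀ (norm_nonneg _) (PadicInt.norm_lt_one_iff_dvd _ |>.mpr dvd_rfl) hs.ne'
  have hs1 : ∀ z : ℤ_[ℓ], ‖c * z‖ < 1 := fun z ↦ by
    rw [norm_mul]
    exact mul_lt_one_of_nonneg_of_lt_one_left (norm_nonneg _) hcn (PadicInt.norm_le_one z)
  let F : Polynomial ℤ_[ℓ] := .C (c) * .X ^ 3 +
    .C (c * A - 1) * .X + .C (B - 1)
  have hd : ‖F.derivative.eval (B - 1)‖ = 1 := by
    have : F.derivative.eval (B - 1) =
        -1 + c * (3 * (B - 1) ^ 2 + A) := by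
      simp [F]; ring
    rw [this, PadicInt.norm_add_eq_max_of_ne] <;> rw [norm_neg, norm_one]
    · exact max_eq_left (hs1 _).le
    · exact (hs1 _).ne'
  obtain ⟨X, hX, -⟩ := hensels_lemma (F := F) (a := B - 1) (by
    simp only [Polynomial.coe_aeval_eq_eval]
    rw [hd]
    have : F.eval (B - 1) = c * ((B - 1) ^ 3 + A * (B - 1)) := by
      simp [F]; ring
    rw [this]
    simpa using hs1 _)
  simp only [Polynomial.coe_aeval_eq_eval] at hX
  have hX' : c * X ^ 3 + (c * A - 1) * X + (B - 1) = 0 := by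
    simpa [F] using hX
  have hX'' : (ℓ : ℚ_[ℓ]) ^ s * X ^ 3 + ((ℓ : ℚ_[ℓ]) ^ s * A - 1) * X + (B - 1) = 0 := by
    have := congrArg (fun z : ℤ_[ℓ] ↦ (z : ℚ_[ℓ])) hX'
    simpa [hce] using this
  refine ⟨ℓ ^ s * X, ?_, ?_⟩
  · rw [hW.equation_iff, hA, hB]
    linear_combination -((ℓ : ℚ_[ℓ]) ^ s) ^ 2 * hX''
  · rw [norm_mul]
    exact mul_le_of_le_one_right (norm_nonneg _) X.2

variable {e : ℕ} (he : ‖W.a₆‖ = (ℓ : ℝ) ^ (-(e : ℤ)))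
include he

lemma exists_componentNorm (P : W.toAffine.Point) :
    ∃ s < e, componentNorm P = (ℓ : ℝ) ^ (-(s : ℤ)) := by
  have hℓ1 : (1 : ℝ) < ℓ := by exact_mod_cast (Fact.out (p := ℓ.Prime)).one_lt
  have hℓ0 : (0 : ℝ) < ℓ := one_pos.trans hℓ1
  have key : ∀ z : ℤ, componentNorm P = (ℓ : ℝ) ^ (-z) → componentNorm P ≤ 1 →
      ‖W.a₆‖ < componentNorm P → ∃ s < e, componentNorm P = (ℓ : ℝ) ^ (-(s : ℤ)) := by
    intro z hz h1 h6
    have hz0 : 0 ≤ z := by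
      by_contra! hc
      exact absurd h1 (not_le.mpr (by rw [hz]; exact one_lt_zpow₀ hℓ1 (by omega)))
    lift z to ℕ using hz0
    refine ⟨z, ?_, hz⟩
    rw [hz, he, zpow_lt_zpow_iff_right₀ hℓ1] at h6
    omega
  rcases hW.componentNorm_trichotomy P with ⟨hP, tP⟩ | ⟨x, y, h, rfl, hx, hy, p, t, u, s⟩ |
    ⟨x, y, h, rfl, hx, hy, s, t, u⟩
  · exact key 0 (by simpa using tP) tP.le (by rw [tP]; exact hW.a₆_lt)
  · refine key (e - y.valuation) ?_ u.le ?_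
    · rw [t, he, Padic.norm_eq_zpow_neg_valuation (norm_pos_iff.mp p), ← zpow_sub₀ hℓ0.ne']
      congr 1
      ring
    · rw [t, lt_div_iff₀ p]
      exact mul_lt_of_lt_one_right hW.a₆_pos (hW.norm_lt_one_of_norm_lt_one h.1 hx)
  · have hne : x + y ≠ 0 := by
      intro h0
      rw [h0, norm_zero] at s
      have := hW.a₆_pos
      norm_num at s
      linarith
    refine key (x + y).valuation ?_ (t.trans_lt u).le ?_
    · rw [t, Padic.norm_eq_zpow_neg_valuation hne]
    · rw [t]
      refine s.trans ?_
      rw [sq]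
      exact mul_lt_of_lt_one_right (norm_pos_iff.mpr hne) u

variable [W.IsElliptic]

lemma exists_componentNorm_eq {s : ℕ} (hs : s < e) :
    ∃ P : W.toAffine.Point, componentNorm P = (ℓ : ℝ) ^ (-(s : ℤ)) := by
  have hℓ1 : (1 : ℝ) < ℓ := by exact_mod_cast (Fact.out (p := ℓ.Prime)).one_lt
  have hℓ0 : (0 : ℝ) < ℓ := one_pos.trans hℓ1
  have hn : ∀ k : ℕ, ‖(ℓ : ℚ_[ℓ]) ^ k‖ = (ℓ : ℝ) ^ (-(k : ℤ)) := fun k ↦ by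
    rw [norm_pow, Padic.norm_p, zpow_neg, zpow_natCast, inv_pow]
  have hn2 : ∀ k : ℕ, ‖(ℓ : ℚ_[ℓ]) ^ k‖ ^ 2 = (ℓ : ℝ) ^ (-(2 * k : ℤ)) := fun k ↦ by
    rw [hn, ← zpow_natCast, ← zpow_mul]; congr 1; push_cast; ring
  have hlt : ∀ k : ℕ, 0 < k → ‖(ℓ : ℚ_[ℓ]) ^ k‖ < 1 := fun k hk ↦ by
    rw [hn]; exact zpow_lt_one_of_neg₀ hℓ1 (by omega)
  rcases s.eq_zero_or_pos with rfl | hs0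
  · exact ⟨0, by simpa using componentNorm_of_isSmooth isSmooth_zero⟩
  rcases lt_or_ge (2 * s) e with h2 | h2
  · have h6 : ‖W.a₆‖ < ‖(ℓ : ℚ_[ℓ]) ^ s‖ ^ 2 := by
      rw [he, hn2]; exact zpow_lt_zpow_right₀ hℓ1 (by omega)
    obtain ⟨x, hx, hxs⟩ := hW.exists_equation_of_norm_le hs0 h6.le
    have hx1 := hxs.trans_lt (hlt s hs0)
    obtain ⟨h1, h2⟩ := hW.norm_mul_eq_of_lt hx hx1 hxs h6
    -- Negation moves the point to the other branch, where `x + y` becomes `-ℓ^s`.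
    obtain ⟨h', e'⟩ := hW.neg_some' ((Affine.equation_iff_nonsingular).mp hx)
    refine ⟨.some x (-(x + ℓ ^ s)) h', ?_⟩
    rw [componentNorm_of_lt hx1 (by rwa [norm_neg, h2]), neg_add, add_neg_cancel_left, norm_neg, hn]
  · have h6 : ‖W.a₆‖ ≤ ‖(ℓ : ℚ_[ℓ]) ^ (e - s)‖ ^ 2 := by
      rw [he, hn2]; exact zpow_le_zpow_right₀ hℓ1.le (by omega)
    obtain ⟨x, hx, hxs⟩ := hW.exists_equation_of_norm_le (by omega) h6
    refine ⟨.some x _ ((Affine.equation_iff_nonsingular).mp hx), ?_⟩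
    rw [componentNorm_of_le (hxs.trans_lt (hlt _ (by omega))) hxs, he, hn, ← zpow_sub₀ hℓ0.ne']
    congr 1
    omega

variable [DecidableEq ℚ_[ℓ]]

lemma card_quotient_smoothPoints : Nat.card (W.toAffine.Point ⧸ hW.smoothPoints) = e := by
  have hℓ1 : (1 : ℝ) < ℓ := by exact_mod_cast (Fact.out (p := ℓ.Prime)).one_lt
  choose f hf using fun s : Fin e ↦ hW.exists_componentNorm_eq he s.2
  have hmk : ∀ P Q : W.toAffine.Point, (P : W.toAffine.Point ⧸ hW.smoothPoints) = Q ↔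
      componentNorm P = componentNorm Q := fun P Q ↦ by
    rw [← hW.isSmooth_sub_iff, eq_comm, QuotientAddGroup.eq, mem_smoothPoints,
      neg_add_eq_sub]
  have hb : Function.Bijective (fun s : Fin e ↦ (f s : W.toAffine.Point ⧸ hW.smoothPoints)) := by
    constructor
    · intro s t hst
      rw [hmk, hf, hf] at hst
      have := zpow_right_injective₀ (one_pos.trans hℓ1) hℓ1.ne' hst
      ext
      omega
    · intro q
      obtain ⟨P, rfl⟩ := QuotientAddGroup.mk_surjective q
      obtain ⟨s, hs, h⟩ := hW.exists_componentNorm he P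
      exact ⟨⟨s, hs⟩, (hmk _ _).mpr ((hf _).trans h.symm)⟩
  rw [← Nat.card_eq_of_bijective _ hb, Nat.card_fin]

/-- Rational torsion of order prime to the order of the component group reduces to a smooth
point. -/
lemma isSmooth_of_nsmul_eq_zero {n : ℕ} (hn : n.Coprime e) {P : W.toAffine.Point}
    (hP : n • P = 0) : IsSmooth P := by
  rw [← hW.mem_smoothPoints, ← QuotientAddGroup.eq_zero_iff]
  have h1 : e • (P : W.toAffine.Point ⧸ hW.smoothPoints) = 0 := by
    have := card_nsmul_eq_zero' (x := (P : W.toAffine.Point ⧸ hW.smoothPoints))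
    rwa [hW.card_quotient_smoothPoints he] at this
  have h2 : n • (P : W.toAffine.Point ⧸ hW.smoothPoints) = 0 := by
    rw [← QuotientAddGroup.mk_nsmul, hP, QuotientAddGroup.mk_zero]
  rw [← AddMonoid.addOrderOf_eq_one_iff, ← Nat.dvd_one, ← hn]
  exact Nat.dvd_gcd (addOrderOf_dvd_of_nsmul_eq_zero h2) (addOrderOf_dvd_of_nsmul_eq_zero h1)

end Padic

end IsNodal

end WeierstrassCurve

end

/-! ## Torsion points reducing to the node -/

noncomputable section

open WeierstrassCurve IsUltrametricDist Affine.Point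

namespace Polynomial

/-- A polynomial whose constant coefficient is smaller than its leading coefficient has a root in
the open unit disc. -/
lemma exists_isRoot_norm_lt_one {L : Type*} [NormedField L] [IsAlgClosed L] {f : L[X]}
    (h : ‖f.coeff 0‖ < ‖f.leadingCoeff‖) : ∃ x, f.IsRoot x ∧ ‖x‖ < 1 := by
  have hf : f ≠ 0 := by
    rintro rfl
    simp at h
  by_contra! H
  have hc := (IsAlgClosed.splits f).coeff_zero_eq_leadingCoeff_mul_prod_roots
  rw [hc, norm_mul, norm_mul, norm_pow, norm_neg, norm_one, one_pow, one_mul] at h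
  have hp : ∀ s : Multiset L, (∀ x ∈ s, 1 ≤ ‖x‖) → 1 ≤ ‖s.prod‖ := fun s ↦ by
    induction s using Multiset.induction_on with
    | empty => simp
    | cons a s ih =>
      intro hs
      rw [Multiset.prod_cons, norm_mul]
      exact one_le_mul_of_one_le_of_one_le (hs a (Multiset.mem_cons_self a s))
        (ih fun x hx ↦ hs x (Multiset.mem_cons_of_mem hx))
  refine absurd h (not_lt.mpr (le_mul_of_one_le_right (norm_nonneg _) (hp _ fun x hx ↦ ?_)))
  exact H x ((mem_roots hf).mp hx)

end Polynomial

namespace WeierstrassCurve.IsNodal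

variable {L : Type*} [NormedField L] [IsUltrametricDist L] {W : WeierstrassCurve L}
  (hW : W.IsNodal)
include hW

/-- The division polynomials vanish at the node modulo the maximal ideal. -/
lemma norm_eval_preΨ'_zero (n : ℕ) :
    ‖(W.preΨ' n).eval 0‖ ≤ 1 ∧ (3 ≤ n → ‖(W.preΨ' n).eval 0‖ < 1) := by
  have hm : ∀ {a b : L}, ‖a‖ ≤ 1 → ‖b‖ ≤ 1 → ‖a * b‖ ≤ 1 := fun ha hb ↦ by
    rw [norm_mul]; exact mul_le_one₀ ha (norm_nonneg _) hb
  have hlt : ∀ {a b : L}, ‖a‖ < 1 → ‖b‖ ≤ 1 → ‖a * b‖ < 1 := fun ha hb ↦ by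
    rw [norm_mul]; exact mul_lt_one_of_nonneg_of_lt_one_left (norm_nonneg _) ha hb
  have hpow : ∀ {a : L} (k : ℕ), ‖a‖ ≤ 1 → ‖a ^ k‖ ≤ 1 := fun k ha ↦ by
    rw [norm_pow]; exact pow_le_one₀ (norm_nonneg _) ha
  have hnat : ∀ k : ℕ, ‖(k : L)‖ ≤ 1 := norm_natCast_le_one L
  have h4 := hW.norm_a₄_lt
  have h6 := hW.a₆_lt
  have b4 : W.b₄ = W.a₄ * (2 : ℕ) := by rw [b₄, hW.a₃]; push_cast; ring
  have b6 : W.b₆ = W.a₆ * (4 : ℕ) := by rw [b₆, hW.a₃]; push_cast; ring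
  have b8 : W.b₈ = W.a₆ - W.a₄ * W.a₄ := by rw [b₈, hW.a₁, hW.a₂, hW.a₃]; ring
  have n4 : ‖W.b₄‖ < 1 := b4 ▸ hlt h4 (hnat _)
  have n6 : ‖W.b₆‖ < 1 := b6 ▸ hlt h6 (hnat _)
  have n8 : ‖W.b₈‖ < 1 := b8 ▸ norm_sub_lt_of_lt h6 (hlt h4 h4.le)
  have hS : ‖(W.Ψ₂Sq ^ 2).eval 0‖ ≤ 1 := by
    rw [Polynomial.eval_pow]
    refine hpow 2 ?_
    simpa [Ψ₂Sq] using n6.le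
  have hif : ∀ (q : Prop) [Decidable q], ‖(if q then W.Ψ₂Sq ^ 2 else 1).eval 0‖ ≤ 1 ∧
      ‖(if q then 1 else W.Ψ₂Sq ^ 2).eval 0‖ ≤ 1 := fun q _ ↦ by
    split_ifs <;> simpa using hS
  induction n using normEDSRec with
  | zero => simp
  | one => simp
  | two => simp
  | three =>
    have : ‖(W.preΨ' 3).eval 0‖ < 1 := by simpa [Ψ₃] using n8
    exact ⟨this.le, fun _ ↦ this⟩
  | four =>
    have : ‖(W.preΨ' 4).eval 0‖ < 1 := by
      have e : (W.preΨ' 4).eval 0 = W.b₄ * W.b₈ - W.b₆ * W.b₆ := by simp [preΨ₄]; ring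
      rw [e]
      exact norm_sub_lt_of_lt (hlt n4 n8.le) (hlt n6 n6.le)
    exact ⟨this.le, fun _ ↦ this⟩
  | even m h1 h2 h3 h4 h5 =>
    have : ‖(W.preΨ' (2 * (m + 3))).eval 0‖ < 1 := by
      have h3' := h3.2 (by omega)
      rw [preΨ'_even]
      simp only [Polynomial.eval_sub, Polynomial.eval_mul, Polynomial.eval_pow]
      generalize (W.preΨ' (m + 3)).eval 0 = x at *
      rw [mul_comm _ x, mul_comm _ x, mul_assoc, mul_assoc]
      -- Both terms of the even recursion contain the polynomial of index `m + 3 ≥ 3`, small by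
      -- induction. In the odd recursion the indices `m + 4` and `m + 3` play this role.
      exact norm_sub_lt_of_lt (hlt h3' (hm (hpow 2 h2.1) h5.1)) (hlt h3' (hm h1.1 (hpow 2 h4.1)))
    exact ⟨this.le, fun _ ↦ this⟩
  | odd m h1 h2 h3 h4 =>
    have : ‖(W.preΨ' (2 * (m + 2) + 1)).eval 0‖ < 1 := by
      have h3' := h3.2 (by omega)
      have h4' := h4.2 (by omega)
      rw [preΨ'_odd, Polynomial.eval_sub]
      refine norm_sub_lt_of_lt ?_ ?_
      · rw [mul_assoc, Polynomial.eval_mul, Polynomial.eval_mul, Polynomial.eval_pow]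
        exact hlt h4' (hm (hpow 3 h2.1) (hif _).1)
      · rw [mul_comm (W.preΨ' (m + 1)), pow_succ', mul_assoc, mul_assoc,
          Polynomial.eval_mul, Polynomial.eval_mul, Polynomial.eval_mul, Polynomial.eval_pow]
        exact hlt h3' (hm (hpow 2 h3.1) (hm h1.1 (hif _).2))
    exact ⟨this.le, fun _ ↦ this⟩

/-- There are torsion points reducing to the node. -/
lemma exists_nsmul_eq_zero_not_isSmooth [IsAlgClosed L] [CharZero L] [DecidableEq L]
    [W.IsElliptic] {n : ℕ} (hn : Odd n) (h3 : 3 ≤ n) (hn1 : ‖(n : L)‖ = 1) :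
    ∃ P : W.toAffine.Point, n • P = 0 ∧ ¬ IsSmooth P := by
  have hn0 : (n : L) ≠ 0 := by rw [← norm_pos_iff, hn1]; exact one_pos
  obtain ⟨x, hx, hx1⟩ := Polynomial.exists_isRoot_norm_lt_one (f := W.preΨ' n) (by
    rw [leadingCoeff_preΨ' _ hn0, if_neg (Nat.not_even_iff_odd.mpr hn), hn1,
      Polynomial.coeff_zero_eq_eval_zero]
    exact (hW.norm_eval_preΨ'_zero n).2 h3)
  obtain ⟨y, hy⟩ := IsAlgClosed.exists_root
    (.X ^ 2 + .C x * .X - .C (x ^ 3 + W.a₄ * x + W.a₆) : Polynomial L) (by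
      have : (.X ^ 2 + .C x * .X - .C (x ^ 3 + W.a₄ * x + W.a₆) : Polynomial L).degree = 2 := by
        compute_degree!
      rw [this]; norm_num)
  have hxy : W.toAffine.Equation x y := by
    rw [hW.equation_iff]
    simp only [Polynomial.IsRoot, Polynomial.eval_sub, Polynomial.eval_add, Polynomial.eval_mul,
      Polynomial.eval_pow, Polynomial.eval_X, Polynomial.eval_C] at hy
    linear_combination hy
  refine ⟨.some x y (Affine.equation_iff_nonsingular.mp hxy),
    nsmul_eq_zero_of_eval_preΨ' (Affine.Point.some_ne_zero _) hn hx, not_le.mpr hx1⟩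

end WeierstrassCurve.IsNodal

end

/-! ## The `q`-expansions of the coefficients of the Tate curve -/

noncomputable section

open WeierstrassCurve IsUltrametricDist Affine.Point

namespace TateCurve

variable {ℓ : ℕ} [Fact ℓ.Prime] {q : ℚ_[ℓ]}

lemma twelve_dvd (m : ℕ) : 12 ∣ 5 * m ^ 3 + 7 * m ^ 5 := by
  have h : ∀ a : ZMod 12, 5 * a ^ 3 + 7 * a ^ 5 = 0 := by decide
  have := h m
  rw [← ZMod.natCast_eq_zero_iff]
  push_cast
  exact this

lemma norm_lambert_term (hq : ‖q‖ < 1) (n : ℕ) :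
    ‖q ^ (n + 1) / (1 - q ^ (n + 1))‖ = ‖q‖ ^ (n + 1) := by
  have h : ‖q ^ (n + 1)‖ < ‖(1 : ℚ_[ℓ])‖ := by
    rw [norm_pow, norm_one]
    exact pow_lt_one₀ (norm_nonneg _) hq n.succ_ne_zero
  rw [norm_div, norm_sub_eq_left h, norm_one, div_one, norm_pow]

lemma norm_lambert_sum (hq : ‖q‖ < 1) (c : ℕ → ℕ) :
    Summable (fun n ↦ (c n : ℚ_[ℓ]) * (q ^ (n + 1) / (1 - q ^ (n + 1)))) ∧
    ∀ k, ‖∑' n, (c (n + k) : ℚ_[ℓ]) * (q ^ (n + k + 1) / (1 - q ^ (n + k + 1)))‖ ≤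
      ‖q‖ ^ (k + 1) := by
  have hb : ∀ n, ‖(c n : ℚ_[ℓ]) * (q ^ (n + 1) / (1 - q ^ (n + 1)))‖ ≤ ‖q‖ ^ (n + 1) := fun n ↦ by
    rw [norm_mul, norm_lambert_term hq]
    exact mul_le_of_le_one_left (by positivity) (norm_natCast_le_one _ _)
  refine ⟨Summable.of_norm_bounded
    ((summable_nat_add_iff 1).mpr (summable_geometric_of_lt_one (norm_nonneg _) hq)) hb,
    fun k ↦ norm_tsum_le_of_forall_le_of_nonneg (by positivity) fun n ↦ (hb _).trans ?_⟩
  exact pow_le_pow_of_le_one (norm_nonneg _) hq.le (by omega)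

lemma lambert_eq (k : ℕ) : lambert k q =
    ∑' n : ℕ, (((n + 1) ^ k : ℕ) : ℚ_[ℓ]) * (q ^ (n + 1) / (1 - q ^ (n + 1))) := by
  refine tsum_congr fun n ↦ ?_
  push_cast
  rw [mul_div_assoc]

lemma norm_equation_a₄_le (hq : ‖q‖ < 1) : ‖(equation q).a₄‖ ≤ ‖q‖ := by
  have h := (norm_lambert_sum hq fun n ↦ (n + 1) ^ 3).2 0
  have h5 : ‖(5 : ℚ_[ℓ])‖ ≤ 1 := by
    simpa using norm_natCast_le_one ℚ_[ℓ] 5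
  simp only [equation, lambert_eq, norm_mul, norm_neg]
  exact (mul_le_of_le_one_left (norm_nonneg _) h5).trans (by simpa using h)

lemma norm_equation_a₆ (hq : ‖q‖ < 1) (h0 : q ≠ 0) : ‖(equation q).a₆‖ = ‖q‖ := by
  -- The coefficients `(5m³ + 7m⁵)/12` are integers, so the division by `12` is harmless even for `ℓ
  -- = 2, 3`. As `c 1 = 1`, the term in `q / (1 - q)` dominates.
  choose c hc using twelve_dvd
  obtain ⟨s3, -⟩ := norm_lambert_sum hq fun n ↦ (n + 1) ^ 3
  obtain ⟨s5, -⟩ := norm_lambert_sum hq fun n ↦ (n + 1) ^ 5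
  obtain ⟨s, hs⟩ := norm_lambert_sum hq fun n ↦ c (n + 1)
  have e : (equation q).a₆ =
      -∑' n : ℕ, (c (n + 1) : ℚ_[ℓ]) * (q ^ (n + 1) / (1 - q ^ (n + 1))) := by
    have : 5 * lambert 3 q + 7 * lambert 5 q =
        12 * ∑' n : ℕ, (c (n + 1) : ℚ_[ℓ]) * (q ^ (n + 1) / (1 - q ^ (n + 1))) := by
      rw [lambert_eq, lambert_eq, ← tsum_mul_left, ← tsum_mul_left, ← tsum_mul_left,
        ← (s3.mul_left 5).tsum_add (s5.mul_left 7)]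
      refine tsum_congr fun n ↦ ?_
      have := congrArg (Nat.cast (R := ℚ_[ℓ])) (hc (n + 1))
      push_cast at this ⊢
      linear_combination (q ^ (n + 1) / (1 - q ^ (n + 1))) * this
    rw [equation, this]
    field_simp
  have c1 : c (0 + 1) = 1 := by
    have := hc 1
    rw [zero_add]; omega
  have n0 := norm_lambert_term hq 0
  have n1 := hs 1
  rw [e, norm_neg, s.tsum_eq_zero_add, c1, Nat.cast_one, one_mul, norm_add_eq_left]
  · simpa using n0
  · rw [n0]
    refine n1.trans_lt ?_
    exact pow_lt_pow_right_of_lt_one₀ (norm_pos_iff.mpr h0) hq (by norm_num)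

lemma isNodal_equation (hq : ‖q‖ < 1) (h0 : q ≠ 0) : (equation q).IsNodal where
  a₁ := rfl
  a₂ := rfl
  a₃ := rfl
  a₄ := (norm_equation_a₄_le hq).trans_eq (norm_equation_a₆ hq h0).symm
  a₆_pos := by rw [norm_equation_a₆ hq h0]; exact norm_pos_iff.mpr h0
  a₆_lt := by rwa [norm_equation_a₆ hq h0]

end TateCurve

end

/-! ## Extensions of `ℤ/p` and Kummer theory -/

noncomputable section

section Extension

variable {Γ V M : Type*} [Group Γ] [AddCommGroup V] [DistribMulAction Γ V] [AddCommGroup M]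
  [DistribMulAction Γ M] {p : ℕ} [Fact p.Prime]

/-- An extension of `ℤ/p` by a `Γ`-module `M` of order `p`, without invariants, whose class lies in
the span of the class of a cocycle `κ`, is the extension defined by `κ`. -/
theorem exists_addEquiv_prod_of_cocycle (hV : ∀ v : V, p • v = 0) (hM : Nat.card M = p)
    {V₀ : AddSubgroup V} (hV₀ : V₀ ≠ ⊤) (ι : V₀ →+ M) (hι : Function.Injective ι)
    (hsub : ∀ (σ : Γ) (v : V), σ • v - v ∈ V₀)
    (hsmul : ∀ (σ : Γ) (v : V₀) (h : σ • (v : V) ∈ V₀), ι ⟨σ • (v : V), h⟩ = σ • ι v)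
    (κ : Γ → M) (hκ : ∀ v : V, ∃ (a : ℤ) (m : M), ∀ σ : Γ,
      ι ⟨σ • v - v, hsub σ v⟩ = a • κ σ + (σ • m - m))
    (hfix : ∀ v : V, (∀ σ : Γ, σ • v = v) → v = 0) :
    ∃ Φ : V ≃+ M × ZMod p, ∀ (σ : Γ) (v : V),
      Φ (σ • v) = (σ • (Φ v).1 + (Φ v).2.val • κ σ, (Φ v).2) := by
  have hp : p.Prime := Fact.out
  have hMp : ∀ m : M, (p : ℤ) • m = 0 := fun m ↦ by
    rw [natCast_zsmul, ← hM, card_nsmul_eq_zero']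
  let D : Γ → V →+ M := fun σ ↦ ι.comp
    ((DistribSMul.toAddMonoidHom V σ - AddMonoidHom.id V).codRestrict V₀ (hsub σ))
  have hD : ∀ σ v, D σ v = ι ⟨σ • v - v, hsub σ v⟩ := fun _ _ ↦ rfl
  have hV₀σ : ∀ (σ : Γ) (v : V₀), σ • (v : V) ∈ V₀ := fun σ v ↦ by
    have := V₀.add_mem (hsub σ v) v.2
    rwa [sub_add_cancel] at this
  have hD₀ : ∀ σ (v : V₀), D σ v = σ • ι v - ι v := fun σ v ↦ by
    rw [hD, ← hsmul σ v (hV₀σ σ v), ← map_sub]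
    rfl
  have hDfix : ∀ v, (∀ σ, D σ v = 0) → v = 0 := fun v h ↦ hfix v fun σ ↦ by
    have := (injective_iff_map_eq_zero ι).mp hι _ (h σ)
    exact sub_eq_zero.mp (congrArg Subtype.val this)
  obtain ⟨Q, hQ⟩ : ∃ Q, Q ∉ V₀ := by
    by_contra! h
    exact hV₀ (eq_top_iff.mpr fun v _ ↦ h v)
  have hsurj : Function.Surjective ι := by
    rw [← AddMonoidHom.range_eq_top]
    have : Fact (Nat.card M).Prime := ⟨hM ▸ hp⟩
    -- If `ι` had trivial image, `Q` would be invariant, hence zero and in `V₀`.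
    refine (AddSubgroup.eq_bot_or_eq_top_of_prime_card ι.range).resolve_left fun h ↦ hQ ?_
    rw [hDfix Q fun σ ↦ ?_]
    · exact V₀.zero_mem
    · have : D σ Q ∈ ι.range := ⟨_, rfl⟩
      rwa [h, AddSubgroup.mem_bot] at this
  have key : ∀ v, ∃ (a : ℤ) (w : V₀), ∀ σ, D σ (v - w) = a • κ σ := fun v ↦ by
    obtain ⟨a, m, h⟩ := hκ v
    obtain ⟨w, rfl⟩ := hsurj m
    refine ⟨a, w, fun σ ↦ ?_⟩
    rw [map_sub, hD, h, hD₀, add_sub_cancel_right]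
  obtain ⟨P, hP, hPκ⟩ : ∃ P, P ∉ V₀ ∧ ∀ σ, D σ P = κ σ := by
    obtain ⟨a, w, h⟩ := key Q
    -- Otherwise `Q - w` would be invariant, hence zero. So `a` is invertible modulo `p`, and a
    -- multiple of `Q - w` has cocycle exactly `κ`.
    have ha : ¬ (p : ℤ) ∣ a := by
      rintro ⟨c, rfl⟩
      have := hDfix (Q - w) fun σ ↦ by rw [h, mul_comm, mul_zsmul, hMp, zsmul_zero]
      exact hQ (sub_eq_zero.mp this ▸ w.2)
    have hco : IsCoprime (p : ℤ) a :=
      (Nat.prime_iff_prime_int.mp hp).irreducible.coprime_iff_not_dvd.mpr ha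
    obtain ⟨c, b, hcb⟩ := hco
    refine ⟨b • (Q - w), fun hmem ↦ hQ ?_, fun σ ↦ ?_⟩
    · have h1 : a • b • (Q - w) = Q - w := by
        rw [← mul_zsmul, show a * b = 1 - c * p by linear_combination hcb, sub_zsmul, one_zsmul,
          mul_zsmul, natCast_zsmul, hV, zsmul_zero, neg_zero, add_zero]
      have h2 := V₀.add_mem (V₀.zsmul_mem hmem a) w.2
      rwa [h1, sub_add_cancel] at h2
    · rw [map_zsmul, h, ← mul_zsmul, show b * a = 1 - c * p by linear_combination hcb, sub_zsmul,
        one_zsmul, mul_zsmul, hMp, zsmul_zero, neg_zero, add_zero]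
  let e : V₀ ≃+ M := AddEquiv.ofBijective ι ⟨hι, hsurj⟩
  have heι : ∀ m, ι (e.symm m) = m := e.apply_symm_apply
  let f : ZMod p →+ V := ZMod.lift p ⟨zmultiplesHom V P, by
    rw [zmultiplesHom_apply, natCast_zsmul, hV]⟩
  have hf : ∀ a : ℤ, f a = a • P := fun a ↦ ZMod.lift_coe p _ a
  have hfv : ∀ n : ZMod p, f n = n.val • P := fun n ↦ by
    rw [← natCast_zsmul, ← hf, Int.cast_natCast, ZMod.natCast_zmod_val]
  let Ψ : M × ZMod p →+ V := (V₀.subtype.comp e.symm.toAddMonoidHom).coprod f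
  have hΨ : ∀ m n, Ψ (m, n) = e.symm m + f n := fun _ _ ↦ rfl
  have hbij : Function.Bijective Ψ := by
    constructor
    · rw [injective_iff_map_eq_zero]
      rintro ⟨m, n⟩ h
      rw [hΨ] at h
      have hn : n = 0 := by
        by_contra hn
        have hmem : n.val • P ∈ V₀ := by
          rw [← hfv, eq_neg_of_add_eq_zero_right h]
          exact V₀.neg_mem (e.symm m).2
        refine hP ?_
        have h1 : n⁻¹.val • n.val • P = P := by
          rw [← mul_nsmul', ← natCast_zsmul, ← hf]
          push_cast
          rw [ZMod.natCast_zmod_val, ZMod.natCast_zmod_val, inv_mul_cancel₀ hn]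
          simpa using hf 1
        rw [← h1]
        exact V₀.nsmul_mem hmem _
      subst hn
      rw [map_zero, add_zero] at h
      have : e.symm m = 0 := Subtype.ext h
      rw [EmbeddingLike.map_eq_zero_iff] at this
      rw [this]
      rfl
    · intro v
      obtain ⟨a, w, h⟩ := key v
      refine ⟨(e w, a), ?_⟩
      -- Surjectivity needs no count of `V`: what remains of `v` is invariant, hence zero.
      have h0 := hDfix (v - w - a • P) fun σ ↦ by
        rw [map_sub, h, map_zsmul, hPκ, sub_self]
      rw [hΨ, e.symm_apply_apply, hf]
      rw [sub_sub] at h0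
      exact (sub_eq_zero.mp h0).symm
  let Ψe := AddEquiv.ofBijective Ψ hbij
  refine ⟨Ψe.symm, fun σ v ↦ ?_⟩
  obtain ⟨⟨m, n⟩, rfl⟩ := Ψe.surjective v
  rw [AddEquiv.symm_apply_eq, Ψe.symm_apply_apply]
  change σ • Ψ (m, n) = Ψ (σ • m + n.val • κ σ, n)
  have h1 : σ • ((e.symm m : V₀) : V) = e.symm (σ • m) := by
    have := hsmul σ (e.symm m) (hV₀σ σ _)
    rw [heι] at this
    rw [← this]
    exact congrArg Subtype.val (e.symm_apply_apply ⟨σ • _, hV₀σ σ _⟩).symm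
  have h2 : σ • P = P + e.symm (κ σ) := by
    have := hPκ σ
    rw [hD, ← heι (κ σ)] at this
    rw [← congrArg Subtype.val (hι this)]
    exact (add_sub_cancel _ _).symm
  have h3 : σ • n.val • P = n.val • σ • P := map_nsmul (DistribSMul.toAddMonoidHom V σ) _ _
  rw [hΨ, hΨ, smul_add, h1, hfv, h3, h2, map_add, map_nsmul, nsmul_add]
  push_cast
  abel

end Extension

section Kummer

variable {K L : Type*} [Field K] [Field L] [Algebra K L] [IsGalois K L]

/-- Hilbert's Theorem 90 for a cocycle of an infinite Galois extension which factors through a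
finite quotient. -/
theorem exists_smul_eq_of_isMulCocycle₁ (c : (L ≃ₐ[K] L) → Lˣ)
    (hc : groupCohomology.IsMulCocycle₁ c) (S : Set L) (hS : S.Finite)
    (hcS : ∀ σ τ : L ≃ₐ[K] L, (∀ s ∈ S, σ s = τ s) → c σ = c τ) (hmem : ∀ σ, (c σ : L) ∈ S) :
    ∃ α : L, α ≠ 0 ∧ ∀ σ : L ≃ₐ[K] L, σ α = c σ * α := by
  have : FiniteDimensional K (IntermediateField.adjoin K S) :=
    have := hS.to_subtype
    IntermediateField.finiteDimensional_adjoin fun x _ ↦ Algebra.IsIntegral.isIntegral x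
  -- The cocycle and its values live on this finite Galois extension, where the finite form of
  -- Theorem 90 applies.
  let F := IntermediateField.normalClosure K (IntermediateField.adjoin K S) L
  have hSF : ∀ s ∈ S, s ∈ F := fun s hs ↦
    (IntermediateField.le_normalClosure _) (IntermediateField.subset_adjoin K S hs)
  have hsurj := AlgEquiv.restrictNormalHom_surjective (F := K) (K₁ := F) L
  choose r hr using hsurj
  have hres : ∀ (σ : L ≃ₐ[K] L) (x : F), ((AlgEquiv.restrictNormalHom F σ x : F) : L) = σ x :=
    fun σ x ↦ AlgEquiv.restrictNormal_commutes σ F x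
  have hcr : ∀ σ, c (r (AlgEquiv.restrictNormalHom F σ)) = c σ := fun σ ↦ hcS _ _ fun s hs ↦ by
    rw [← hres _ ⟨s, hSF s hs⟩, ← hres _ ⟨s, hSF s hs⟩, hr]
  let f : (F ≃ₐ[K] F) → Fˣ := fun τ ↦ Units.mk0 ⟨c (r τ), hSF _ (hmem _)⟩ fun h ↦
    (c (r τ)).ne_zero (congrArg Subtype.val h)
  have hf : ∀ σ, ((f (AlgEquiv.restrictNormalHom F σ) : F) : L) = c σ := fun σ ↦ by
    rw [← hcr σ]; rfl
  have hfc : groupCohomology.IsMulCocycle₁ f := by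
    intro g h
    obtain ⟨σ, rfl⟩ := AlgEquiv.restrictNormalHom_surjective (F := K) (K₁ := F) L g
    obtain ⟨τ, rfl⟩ := AlgEquiv.restrictNormalHom_surjective (F := K) (K₁ := F) L h
    ext
    rw [← map_mul, hf, hc σ τ]
    change σ (c τ) * c σ = ((AlgEquiv.restrictNormalHom F σ (f _) : F) : L) * (f _ : F)
    rw [hres, hf, hf]
  obtain ⟨x, hx⟩ := groupCohomology.isMulCoboundary₁_of_isMulCocycle₁_of_aut_to_units f hfc
  refine ⟨(x : F), fun h ↦ x.ne_zero (Subtype.ext h), fun σ ↦ ?_⟩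
  have := congrArg (fun z : Fˣ ↦ ((z : F) : L))
    (div_eq_iff_eq_mul.mp (hx (AlgEquiv.restrictNormalHom F σ)))
  change ((AlgEquiv.restrictNormalHom F σ (x : F) : F) : L) = (f _ : F) * (x : F) at this
  rwa [hres, hf] at this

end Kummer

end

/-! ## Torsion with smooth reduction and roots of unity -/

noncomputable section

open WeierstrassCurve IsUltrametricDist Affine.Point

namespace IsUltrametricDist

variable {L : Type*} [NormedField L] {n : ℕ} [NeZero n]

lemma norm_rootsOfUnity (ζ : rootsOfUnity n L) : ‖((ζ : Lˣ) : L)‖ = 1 :=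
  (pow_eq_one_iff_of_nonneg (norm_nonneg _) (NeZero.ne n)).mp (by
    rw [← norm_pow, ← Units.val_pow_eq_pow_val, (mem_rootsOfUnity n _).mp ζ.2, Units.val_one,
      norm_one])

lemma exists_rootsOfUnity_norm_sub_lt_one [IsAlgClosed L] {u : L} (hu : ‖u ^ n - 1‖ < 1) :
    ∃ ζ : rootsOfUnity n L, ‖u - ((ζ : Lˣ) : L)‖ < 1 := by
  have hm : ((.X + .C u) ^ n : Polynomial L).Monic := (Polynomial.monic_X_add_C u).pow n
  have hd : (1 : Polynomial L).degree < ((.X + .C u) ^ n : Polynomial L).degree := by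
    rw [Polynomial.degree_one, Polynomial.degree_pow, Polynomial.degree_X_add_C, nsmul_one]
    exact_mod_cast NeZero.pos n
  obtain ⟨x, hx, hx1⟩ := Polynomial.exists_isRoot_norm_lt_one
    (f := ((.X + .C u) ^ n - 1 : Polynomial L)) (by
      rw [hm.sub_of_left hd, norm_one, Polynomial.coeff_zero_eq_eval_zero]
      simpa using hu)
  have h1 : (x + u) ^ n = 1 := by
    rw [← sub_eq_zero]
    simpa using hx
  refine ⟨rootsOfUnity.mkOfPowEq _ h1, ?_⟩
  rw [rootsOfUnity.coe_mkOfPowEq, ← norm_neg]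
  simpa using hx1

/-- Roots of unity of order prime to the residue characteristic are distinct modulo the maximal
ideal, by `eq_one_of_pow_eq_one`. -/
lemma rootsOfUnity_eq_of_norm_sub_lt_one [IsUltrametricDist L] (hn : ‖(n : L)‖ = 1) {ζ ξ : rootsOfUnity n L} {u : L}
    (hζ : ‖u - ((ζ : Lˣ) : L)‖ < 1) (hξ : ‖u - ((ξ : Lˣ) : L)‖ < 1) : ζ = ξ := by
  have h : ‖((ζ : Lˣ) : L) - ((ξ : Lˣ) : L)‖ < 1 := by
    have := norm_sub_lt_of_lt hξ hζ
    rwa [sub_sub_sub_cancel_left] at this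
  have h1 : ‖(((ζ / ξ : rootsOfUnity n L) : Lˣ) : L) - 1‖ < 1 := by
    refine lt_of_eq_of_lt ?_ h
    rw [← mul_one ‖(((ζ / ξ : rootsOfUnity n L) : Lˣ) : L) - 1‖]
    rw [← norm_rootsOfUnity ξ, ← norm_mul, sub_mul, one_mul, ← Units.val_mul, ← Subgroup.coe_mul, div_mul_cancel]
  have h2 := eq_one_of_pow_eq_one h1 hn (by
    rw [← Units.val_pow_eq_pow_val, (mem_rootsOfUnity n _).mp (ζ / ξ).2, Units.val_one])
  rw [← div_eq_one]
  exact Subtype.ext (Units.ext h2)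

end IsUltrametricDist

namespace WeierstrassCurve.IsNodal

variable {L : Type*} [NormedField L] [IsUltrametricDist L] [IsAlgClosed L] [DecidableEq L]
  {W : WeierstrassCurve L} (hW : W.IsNodal) {n : ℕ} [NeZero n]

/-- Torsion points with smooth reduction are identified with roots of unity. -/
theorem exists_hom_rootsOfUnity (hn : ‖(n : L)‖ = 1) :
    ∃ ι : hW.smoothPoints.addSubgroupOf (AddSubgroup.torsionBy W.toAffine.Point (n : ℤ)) →+
      Additive (rootsOfUnity n L), Function.Injective ι ∧
      ∀ P : hW.smoothPoints.addSubgroupOf (AddSubgroup.torsionBy W.toAffine.Point (n : ℤ)),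
        ‖unitCoord (P : W.toAffine.Point) - (((ι P).toMul : Lˣ) : L)‖ < 1 := by
  have hn0 : ∀ P : hW.smoothPoints.addSubgroupOf (AddSubgroup.torsionBy W.toAffine.Point (n : ℤ)),
      n • (P : W.toAffine.Point) = 0 := fun P ↦ by
    rw [← natCast_zsmul]; exact P.1.2
  have hs : ∀ P : hW.smoothPoints.addSubgroupOf (AddSubgroup.torsionBy W.toAffine.Point (n : ℤ)),
      IsSmooth (P : W.toAffine.Point) := fun P ↦ P.2
  -- `unitCoord P ^ n` is congruent to `1`, so `unitCoord P` is congruent to an `n`-th root of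
  -- unity, which is unique.
  choose f hf using fun P : hW.smoothPoints.addSubgroupOf
      (AddSubgroup.torsionBy W.toAffine.Point (n : ℤ)) ↦
    exists_rootsOfUnity_norm_sub_lt_one (n := n)
      ((hW.norm_unitCoord_pow_sub_one (hs P) (hn0 P)).trans_lt
        ((mul_le_of_le_one_right (norm_nonneg _) (hW.norm_unitCoord_sub_one_le (hs P))).trans_lt
          hW.a₆_lt))
  have hadd : ∀ P Q, f (P + Q) = f P * f Q := fun P Q ↦ by
    refine rootsOfUnity_eq_of_norm_sub_lt_one hn (hf (P + Q)) ?_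
    have h1 := (hW.norm_unitCoord_add (hs P) (hs Q)).trans_lt
      ((mul_le_of_le_one_right (norm_nonneg _) (hW.norm_unitCoord_sub_one_le (hs P))).trans_lt
        hW.a₆_lt)
    have e : unitCoord ((P + Q : _) : W.toAffine.Point) - (((f P * f Q : rootsOfUnity n L) : Lˣ) : L)
        = (unitCoord ((P : W.toAffine.Point) + (Q : W.toAffine.Point)) -
            unitCoord (P : W.toAffine.Point) * unitCoord (Q : W.toAffine.Point)) +
          ((unitCoord (P : W.toAffine.Point) - ((f P : Lˣ) : L)) * unitCoord (Q : W.toAffine.Point) +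
            ((f P : Lˣ) : L) * (unitCoord (Q : W.toAffine.Point) - ((f Q : Lˣ) : L))) := by
      push_cast
      ring
    rw [e]
    refine norm_add_lt_of_lt h1 (norm_add_lt_of_lt ?_ ?_)
    · rw [norm_mul, hW.norm_unitCoord (hs Q), mul_one]; exact hf P
    · rw [norm_mul, norm_rootsOfUnity, one_mul]; exact hf Q
  refine ⟨AddMonoidHom.mk' (fun P ↦ Additive.ofMul (f P)) hadd, ?_, hf⟩
  rw [injective_iff_map_eq_zero]
  intro P hP
  have hP1 : f P = 1 := hP
  have := hf P
  rw [hP1] at this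
  exact Subtype.ext (Subtype.ext (hW.eq_zero_of_nsmul_eq_zero (hs P) hn (hn0 P) this))

end WeierstrassCurve.IsNodal

section Padic

variable {ℓ p : ℕ} [Fact ℓ.Prime]

lemma coprime_card_units_zmod (hp : p.Prime) (h : ¬ ℓ ≡ 1 [MOD p]) :
    (Nat.card (ZMod ℓ)ˣ).Coprime p := by
  rw [Nat.card_eq_fintype_card, ZMod.card_units, Nat.coprime_comm, hp.coprime_iff_not_dvd]
  exact fun hd ↦ h ((Nat.modEq_iff_dvd' (Fact.out (p := ℓ.Prime)).one_le).mpr hd).symm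

lemma PadicInt.norm_lt_one_iff_toZMod {x : ℤ_[ℓ]} : ‖x‖ < 1 ↔ PadicInt.toZMod x = 0 := by
  rw [← RingHom.mem_ker, PadicInt.ker_toZMod, IsLocalRing.mem_maximalIdeal, PadicInt.mem_nonunits]

/-- Raising to the power `p` is injective on `𝔽_ℓˣ`. -/
lemma Padic.norm_sub_one_lt_one_of_pow (hp : p ≠ 0) (hc : (Nat.card (ZMod ℓ)ˣ).Coprime p)
    {u : ℚ_[ℓ]} (h : ‖u ^ p - 1‖ < 1) : ‖u - 1‖ < 1 := by
  have hu : ‖u‖ = 1 := by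
    have h1 : ‖1 + (u ^ p - 1)‖ = 1 := by
      rw [norm_add_eq_left, norm_one]
      rwa [norm_one]
    rw [add_sub_cancel, norm_pow] at h1
    exact (pow_eq_one_iff_of_nonneg (norm_nonneg _) hp).mp h1
  obtain ⟨u, rfl⟩ : ∃ z : ℤ_[ℓ], (z : ℚ_[ℓ]) = u := ⟨⟨u, hu.le⟩, rfl⟩
  have h' : ‖u ^ p - 1‖ < 1 := by
    rw [← PadicInt.padic_norm_e_of_padicInt]; push_cast; exact h
  suffices hs : ‖u - 1‖ < 1 by
    rw [← PadicInt.padic_norm_e_of_padicInt] at hs; push_cast at hs; exact hs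
  rw [PadicInt.norm_lt_one_iff_toZMod] at h' ⊢
  rw [map_sub, map_one, sub_eq_zero] at h' ⊢
  rw [map_pow] at h'
  have hv := (powCoprime hc).injective (a₁ := Units.ofPowEqOne _ p h' hp) (a₂ := 1) (by
    ext
    simp [powCoprime_apply])
  simpa using congrArg Units.val hv

/-- Raising to the power `p` is surjective on `𝔽_ℓˣ`, and `X^p - u` has unit derivative at a unit,
so Hensel's lemma applies. -/
lemma PadicInt.exists_pow_eq (hc : (Nat.card (ZMod ℓ)ˣ).Coprime p) (hp : ‖(p : ℤ_[ℓ])‖ = 1)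
    {u : ℤ_[ℓ]} (hu : ‖u‖ = 1) : ∃ w, w ^ p = u := by
  have hu0 : PadicInt.toZMod u ≠ 0 := by
    rw [Ne, ← PadicInt.norm_lt_one_iff_toZMod, hu]; exact lt_irrefl 1
  obtain ⟨v, hv⟩ := (powCoprime hc).surjective (Units.mk0 _ hu0)
  have hv' : (v : ZMod ℓ) ^ p = PadicInt.toZMod u := by
    simpa [powCoprime_apply] using congrArg Units.val hv
  obtain ⟨a, ha⟩ : ∃ a : ℤ_[ℓ], PadicInt.toZMod a = v :=
    ⟨((v : ZMod ℓ).val : ℤ_[ℓ]), by rw [map_natCast, ZMod.natCast_zmod_val]⟩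
  have ha1 : ‖a‖ = 1 := by
    refine le_antisymm (PadicInt.norm_le_one a) (not_lt.mp fun h ↦ v.ne_zero ?_)
    rw [← ha]
    exact PadicInt.norm_lt_one_iff_toZMod.mp h
  have hd : ‖Polynomial.aeval a (.X ^ p - .C u : Polynomial ℤ_[ℓ]).derivative‖ = 1 := by
    simp [Polynomial.derivative_X_pow, hp, ha1]
  obtain ⟨w, hw, -⟩ := hensels_lemma (F := (.X ^ p - .C u : Polynomial ℤ_[ℓ])) (a := a) (by
    rw [hd, one_pow, PadicInt.norm_lt_one_iff_toZMod]
    simp [ha, hv'])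
  exact ⟨w, by simpa [sub_eq_zero] using hw⟩

lemma Padic.exists_eq_zpow_mul_pow (hc : (Nat.card (ZMod ℓ)ˣ).Coprime p)
    (hp : ‖(p : ℤ_[ℓ])‖ = 1) {k : ℚ_[ℓ]} (hk : k ≠ 0) :
    ∃ (a : ℤ) (w : ℚ_[ℓ]), k = (ℓ : ℚ_[ℓ]) ^ a * w ^ p := by
  have hℓ : (ℓ : ℚ_[ℓ]) ≠ 0 := Nat.cast_ne_zero.mpr (Fact.out (p := ℓ.Prime)).ne_zero
  have hℓ' : (ℓ : ℝ) ≠ 0 := Nat.cast_ne_zero.mpr (Fact.out (p := ℓ.Prime)).ne_zero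
  have hu : ‖k / (ℓ : ℚ_[ℓ]) ^ k.valuation‖ = 1 := by
    rw [norm_div, Padic.norm_p_zpow, ← Padic.norm_eq_zpow_neg_valuation hk,
      div_self (norm_ne_zero_iff.mpr hk)]
  obtain ⟨w, hw⟩ := PadicInt.exists_pow_eq hc hp (u := ⟨_, hu.le⟩) hu
  refine ⟨k.valuation, w, ?_⟩
  have := congrArg (fun z : ℤ_[ℓ] ↦ (z : ℚ_[ℓ])) hw
  simp only [PadicInt.coe_pow] at this
  rw [this, mul_div_cancel₀ _ (zpow_ne_zero _ hℓ)]

end Padic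

end

/-! ## The Galois action -/

noncomputable section

open WeierstrassCurve IsUltrametricDist Affine.Point

namespace TateCurve

section RootsOfUnity

variable {K L : Type*} [Field K] [Field L] [Algebra K L] (n : ℕ)

instance instGaloisActionRootsOfUnity :
    DistribMulAction (L ≃ₐ[K] L) (Additive (rootsOfUnity n L)) where
  smul σ z := Additive.ofMul (restrictRootsOfUnity σ n z.toMul)
  one_smul _ := rfl
  mul_smul _ _ _ := rfl
  smul_zero σ := congrArg Additive.ofMul (map_one (restrictRootsOfUnity σ n))
  smul_add σ a b := congrArg Additive.ofMul (map_mul (restrictRootsOfUnity σ n) a.toMul b.toMul)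

variable {n}

lemma coe_toMul_smul (σ : L ≃ₐ[K] L) (z : Additive (rootsOfUnity n L)) :
    (((σ • z).toMul : Lˣ) : L) = σ ((z.toMul : Lˣ) : L) := rfl

end RootsOfUnity

variable {ℓ : ℕ} [Fact ℓ.Prime]

lemma norm_algEquiv (σ : PadicAlgCl ℓ ≃ₐ[ℚ_[ℓ]] PadicAlgCl ℓ) (x : PadicAlgCl ℓ) :
    ‖σ x‖ = ‖x‖ :=
  (spectralNorm_eq_of_equiv σ x).symm

variable {W : WeierstrassCurve ℚ_[ℓ]}

lemma isNodal_baseChange (hW : W.IsNodal) {F : Type*} [NormedField F] [NormedAlgebra ℚ_[ℓ] F] :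
    (W.baseChange F).IsNodal where
  a₁ := by simp [hW.a₁]
  a₂ := by simp [hW.a₂]
  a₃ := by simp [hW.a₃]
  a₄ := by simpa using hW.a₄
  a₆_pos := by simpa using hW.a₆_pos
  a₆_lt := by simpa using hW.a₆_lt

lemma unitCoord_smul (σ : PadicAlgCl ℓ ≃ₐ[ℚ_[ℓ]] PadicAlgCl ℓ) (P : GeomPoints W) :
    unitCoord (σ • P) = σ (unitCoord P) := by
  rcases P with _ | ⟨x, y, h⟩
  · exact (map_one σ).symm
  · change σ y / (σ x + σ y) = σ (y / (x + y))
    rw [map_div₀, map_add]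

lemma isSmooth_smul {σ : PadicAlgCl ℓ ≃ₐ[ℚ_[ℓ]] PadicAlgCl ℓ} {P : GeomPoints W} :
    IsSmooth (σ • P) ↔ IsSmooth P := by
  rcases P with _ | ⟨x, y, h⟩
  · exact Iff.rfl
  · change 1 ≤ ‖σ x‖ ↔ 1 ≤ ‖x‖
    rw [norm_algEquiv]

lemma componentNorm_smul (σ : PadicAlgCl ℓ ≃ₐ[ℚ_[ℓ]] PadicAlgCl ℓ) (P : GeomPoints W) :
    componentNorm (σ • P) = componentNorm P := by
  classical
  rcases P with _ | ⟨x, y, h⟩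
  · rfl
  · change (if 1 ≤ ‖σ x‖ then (1 : ℝ) else if ‖σ x‖ ≤ ‖σ y‖ then
      ‖(W.baseChange (PadicAlgCl ℓ)).a₆‖ / ‖σ y‖ else ‖σ x + σ y‖) = if 1 ≤ ‖x‖ then (1 : ℝ) else
      if ‖x‖ ≤ ‖y‖ then ‖(W.baseChange (PadicAlgCl ℓ)).a₆‖ / ‖y‖ else ‖x + y‖
    rw [← map_add, norm_algEquiv, norm_algEquiv, norm_algEquiv]

lemma isSmooth_smul_sub (hW : W.IsNodal) (σ : PadicAlgCl ℓ ≃ₐ[ℚ_[ℓ]] PadicAlgCl ℓ)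
    (P : GeomPoints W) : IsSmooth (σ • P - P) := by
  classical
  exact (isNodal_baseChange hW).isSmooth_sub_iff.mpr (componentNorm_smul σ P)

open scoped Classical in
lemma exists_map_eq_of_fixed {P : GeomPoints W}
    (hP : ∀ σ : PadicAlgCl ℓ ≃ₐ[ℚ_[ℓ]] PadicAlgCl ℓ, σ • P = P) :
    ∃ Q : (W.baseChange ℚ_[ℓ]).toAffine.Point,
      Affine.Point.map (W' := W.toAffine) (Algebra.ofId ℚ_[ℓ] (PadicAlgCl ℓ)) Q = P := by
  rcases P with _ | ⟨x, y, h⟩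
  · exact ⟨0, rfl⟩
  · have hxy : ∀ σ : PadicAlgCl ℓ ≃ₐ[ℚ_[ℓ]] PadicAlgCl ℓ, σ x = x ∧ σ y = y := fun σ ↦ by
      have := hP σ
      change Affine.Point.some (σ x) (σ y) _ = _ at this
      exact (Affine.Point.some.injEq ..).mp this
    obtain ⟨x, rfl⟩ := (InfiniteGalois.mem_range_algebraMap_iff_fixed x).mpr fun σ ↦ (hxy σ).1
    obtain ⟨y, rfl⟩ := (InfiniteGalois.mem_range_algebraMap_iff_fixed y).mpr fun σ ↦ (hxy σ).2
    exact ⟨.some x y ((W.toAffine.baseChange_nonsingular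
      (Algebra.ofId ℚ_[ℓ] (PadicAlgCl ℓ)).injective x y).mp h), rfl⟩

variable {p : ℕ}

/-- There are no rational `p`-torsion points. -/
lemma eq_zero_of_fixed (hW : W.IsNodal) [W.IsElliptic] {e : ℕ}
    (he : ‖W.a₆‖ = (ℓ : ℝ) ^ (-(e : ℤ))) (hpe : p.Coprime e) (hp0 : p ≠ 0)
    (hp : ‖(p : ℚ_[ℓ])‖ = 1) (hc : (Nat.card (ZMod ℓ)ˣ).Coprime p) {P : GeomPoints W}
    (hP : p • P = 0) (hfix : ∀ σ : PadicAlgCl ℓ ≃ₐ[ℚ_[ℓ]] PadicAlgCl ℓ, σ • P = P) : P = 0 := by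
  classical
  obtain ⟨Q, rfl⟩ := exists_map_eq_of_fixed hfix
  have hN : (W.baseChange ℚ_[ℓ]).IsNodal := isNodal_baseChange hW
  have : (W.baseChange ℚ_[ℓ]).IsElliptic :=
    inferInstanceAs (W.map (algebraMap ℚ_[ℓ] ℚ_[ℓ])).IsElliptic
  have hQ : p • Q = 0 := by
    apply Affine.Point.map_injective (W' := W.toAffine) (Algebra.ofId ℚ_[ℓ] (PadicAlgCl ℓ))
    rw [map_nsmul, _root_.map_zero]
    exact hP
  -- The component group has order prime to `p`, so `Q` is smooth. Its coordinate then satisfies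
  -- `u^p ≡ 1`, hence `u ≡ 1`, and the kernel of reduction has no `p`-torsion.
  have hs : IsSmooth Q := hN.isSmooth_of_nsmul_eq_zero (by simpa using he) hpe hQ
  have h1 := (hN.norm_unitCoord_pow_sub_one hs hQ).trans_lt
    ((mul_le_of_le_one_right (norm_nonneg _) (hN.norm_unitCoord_sub_one_le hs)).trans_lt hN.a₆_lt)
  rw [hN.eq_zero_of_nsmul_eq_zero hs hp hQ (Padic.norm_sub_one_lt_one_of_pow hp0 hc h1)]
  rfl

/-- A cocycle of `μ_p` over `ℚ_ℓ` is a power of the Kummer cocycle of `ℓ`, up to a coboundary. -/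
lemma exists_zsmul_kummer [NeZero p] (hp : ‖(p : ℤ_[ℓ])‖ = 1)
    (hc : (Nat.card (ZMod ℓ)ˣ).Coprime p) {β : PadicAlgCl ℓ} (hβ : β ^ p = ℓ)
    {κ c : (PadicAlgCl ℓ ≃ₐ[ℚ_[ℓ]] PadicAlgCl ℓ) → Additive (rootsOfUnity p (PadicAlgCl ℓ))}
    (hκ : ∀ σ, σ β = (((κ σ).toMul : (PadicAlgCl ℓ)ˣ) : PadicAlgCl ℓ) * β)
    (hcc : ∀ σ τ, c (σ * τ) = σ • c τ + c σ) {S : Set (PadicAlgCl ℓ)} (hS : S.Finite)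
    (hcS : ∀ σ τ : PadicAlgCl ℓ ≃ₐ[ℚ_[ℓ]] PadicAlgCl ℓ, (∀ s ∈ S, σ s = τ s) → c σ = c τ) :
    ∃ (a : ℤ) (m : Additive (rootsOfUnity p (PadicAlgCl ℓ))), ∀ σ,
      c σ = a • κ σ + (σ • m - m) := by
  have hp0 : p ≠ 0 := NeZero.ne p
  have hℓ : (ℓ : PadicAlgCl ℓ) ≠ 0 := Nat.cast_ne_zero.mpr (Fact.out (p := ℓ.Prime)).ne_zero
  have hβ0 : β ≠ 0 := fun h ↦ hℓ (by rw [← hβ, h, zero_pow hp0])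
  obtain ⟨α, hα0, hα⟩ := exists_smul_eq_of_isMulCocycle₁
    (fun σ ↦ ((c σ).toMul : (PadicAlgCl ℓ)ˣ)) (fun σ τ ↦ by
      ext
      have := congrArg (fun z : Additive (rootsOfUnity p (PadicAlgCl ℓ)) ↦
        ((z.toMul : (PadicAlgCl ℓ)ˣ) : PadicAlgCl ℓ)) (hcc σ τ)
      simpa [coe_toMul_smul] using this)
    (S ∪ Set.range fun ζ : rootsOfUnity p (PadicAlgCl ℓ) ↦ ((ζ : (PadicAlgCl ℓ)ˣ) : PadicAlgCl ℓ))
    (hS.union (Set.finite_range _))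
    (fun σ τ h ↦ by rw [hcS σ τ fun s hs ↦ h s (.inl hs)]) (fun σ ↦ .inr ⟨_, rfl⟩)
  have hpow : ∀ ζ : rootsOfUnity p (PadicAlgCl ℓ),
      ((ζ : (PadicAlgCl ℓ)ˣ) : PadicAlgCl ℓ) ^ p = 1 := fun ζ ↦ by
    rw [← Units.val_pow_eq_pow_val, (mem_rootsOfUnity p _).mp ζ.2, Units.val_one]
  -- `α^p` is rational, equal to some `ℓ^a w^p`. So `α` differs from `β^a w` by a root of unity,
  -- whose coboundary is the correction term.
  obtain ⟨k, hk⟩ := (InfiniteGalois.mem_range_algebraMap_iff_fixed (k := ℚ_[ℓ]) (α ^ p)).mpr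
    fun σ ↦ by rw [map_pow, hα, mul_pow, hpow, one_mul]
  have hk0 : k ≠ 0 := by
    rintro rfl
    rw [_root_.map_zero] at hk
    exact pow_ne_zero p hα0 hk.symm
  obtain ⟨a, w, rfl⟩ := Padic.exists_eq_zpow_mul_pow hc hp hk0
  have hw0 : algebraMap ℚ_[ℓ] (PadicAlgCl ℓ) w ≠ 0 := by
    rw [map_ne_zero]
    rintro rfl
    exact hk0 (by rw [zero_pow hp0, mul_zero])
  have hξ : (α / (β ^ a * algebraMap ℚ_[ℓ] (PadicAlgCl ℓ) w)) ^ p = 1 := by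
    rw [div_pow, ← hk, mul_pow, ← zpow_natCast (β ^ a), ← zpow_mul, mul_comm a, zpow_mul, zpow_natCast, hβ,
      map_mul, map_zpow₀, map_natCast, map_pow, div_self]
    exact mul_ne_zero (zpow_ne_zero _ hℓ) (pow_ne_zero _ hw0)
  refine ⟨a, Additive.ofMul (rootsOfUnity.mkOfPowEq _ hξ), fun σ ↦ ?_⟩
  refine Additive.toMul.injective (Subtype.ext (Units.ext ?_))
  have hκ0 := ((κ σ).toMul : (PadicAlgCl ℓ)ˣ).ne_zero
  have hσ := hα σ
  simp only [toMul_add, toMul_sub, toMul_zsmul, Subgroup.coe_mul, Subgroup.coe_div,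
    Subgroup.coe_zpow, Units.val_mul, Units.val_div_eq_div_val, Units.val_zpow_eq_zpow_val,
    coe_toMul_smul, toMul_ofMul, rootsOfUnity.coe_mkOfPowEq, map_div₀, map_mul, map_zpow₀, hκ, hσ,
    AlgEquiv.commutes]
  rw [mul_zpow]
  field_simp

end TateCurve

end

/-! ## The structure of the `p`-torsion -/

noncomputable section

open WeierstrassCurve IsUltrametricDist Affine.Point

namespace TateCurve

variable {ℓ p : ℕ} [Fact ℓ.Prime]

/-- Continuity of `σ ↦ σP`, in the finite form that `exists_zsmul_kummer` asks for. -/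
lemma exists_finset_coord (W : WeierstrassCurve ℚ_[ℓ]) (P : GeomPoints W) :
    ∃ S : Set (PadicAlgCl ℓ), S.Finite ∧ ∀ σ τ : PadicAlgCl ℓ ≃ₐ[ℚ_[ℓ]] PadicAlgCl ℓ,
      (∀ s ∈ S, σ s = τ s) → σ • P = τ • P := by
  rcases P with _ | ⟨x, y, h⟩
  · exact ⟨∅, Set.finite_empty, fun _ _ _ ↦ rfl⟩
  · refine ⟨{x, y}, Set.toFinite _, fun σ τ hs ↦ ?_⟩
    exact (Affine.Point.some.injEq ..).mpr ⟨hs x (by simp), hs y (by simp)⟩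

/-- The Galois module `E[p]` of a curve over `ℚ_ℓ` with nodal reduction as an extension of `ℤ/p` by
`μ_p`. -/
theorem exists_torsion_addEquiv (hp : p.Prime) (hℓp : ℓ ≠ p) (hp3 : 3 ≤ p) (hℓ : ¬ ℓ ≡ 1 [MOD p])
    {W : WeierstrassCurve ℚ_[ℓ]} (hW : W.IsNodal) [W.IsElliptic] {e : ℕ}
    (he : ‖W.a₆‖ = (ℓ : ℝ) ^ (-(e : ℤ))) (hpe : p.Coprime e) {β : PadicAlgCl ℓ} (hβ : β ^ p = ℓ)
    {κ : (PadicAlgCl ℓ ≃ₐ[ℚ_[ℓ]] PadicAlgCl ℓ) → Additive (rootsOfUnity p (PadicAlgCl ℓ))}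
    (hκ : ∀ σ, σ β = (((κ σ).toMul : (PadicAlgCl ℓ)ˣ) : PadicAlgCl ℓ) * β) :
    ∃ Φ : Torsion W p ≃+ Additive (rootsOfUnity p (PadicAlgCl ℓ)) × ZMod p,
      ∀ (σ : PadicAlgCl ℓ ≃ₐ[ℚ_[ℓ]] PadicAlgCl ℓ) (P : Torsion W p),
        Φ (σ • P) = (σ • (Φ P).1 + (Φ P).2.val • κ σ, (Φ P).2) := by
  classical
  have : Fact p.Prime := ⟨hp⟩
  have : NeZero p := ⟨hp.ne_zero⟩
  have hc := coprime_card_units_zmod hp hℓ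
  have hcop : ℓ.Coprime p := (Nat.coprime_primes Fact.out hp).mpr hℓp
  have hpK : ‖(p : ℚ_[ℓ])‖ = 1 := Padic.norm_natCast_eq_one_iff.mpr hcop
  have hpZ : ‖(p : ℤ_[ℓ])‖ = 1 := PadicInt.norm_natCast_eq_one_iff.mpr hcop
  have hpL : ‖(p : PadicAlgCl ℓ)‖ = 1 := by
    rw [← map_natCast (algebraMap ℚ_[ℓ] (PadicAlgCl ℓ)), PadicAlgCl.norm_extends, hpK]
  have hL : (W.baseChange (PadicAlgCl ℓ)).IsNodal := isNodal_baseChange hW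
  have hEL : (W.baseChange (PadicAlgCl ℓ)).IsElliptic :=
    inferInstanceAs (W.map (algebraMap ℚ_[ℓ] (PadicAlgCl ℓ))).IsElliptic
  obtain ⟨ι, hι, hU⟩ := hL.exists_hom_rootsOfUnity hpL
  have htors : ∀ P : Torsion W p, p • (P : GeomPoints W) = 0 := fun P ↦ by
    rw [← natCast_zsmul]; exact P.2
  have hsub : ∀ (σ : PadicAlgCl ℓ ≃ₐ[ℚ_[ℓ]] PadicAlgCl ℓ) (P : Torsion W p),
      σ • P - P ∈ hL.smoothPoints.addSubgroupOf (Torsion W p) :=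
    fun σ P ↦ isSmooth_smul_sub hW σ P
  have hsmul : ∀ (σ : PadicAlgCl ℓ ≃ₐ[ℚ_[ℓ]] PadicAlgCl ℓ)
      (P : hL.smoothPoints.addSubgroupOf (Torsion W p))
      (h : σ • (P : Torsion W p) ∈ hL.smoothPoints.addSubgroupOf (Torsion W p)),
      ι ⟨σ • (P : Torsion W p), h⟩ = σ • ι P := fun σ P h ↦ by
    -- Equivariance follows from uniqueness of the root of unity near `unitCoord`, because `σ` is an
    -- isometry.
    refine Additive.toMul.injective (rootsOfUnity_eq_of_norm_sub_lt_one hpL (hU _) ?_)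
    have e : unitCoord ((σ • (P : Torsion W p) : Torsion W p) : GeomPoints W) =
        σ (unitCoord ((P : Torsion W p) : GeomPoints W)) := unitCoord_smul σ _
    rw [coe_toMul_smul]
    change ‖unitCoord ((σ • (P : Torsion W p) : Torsion W p) : GeomPoints W) - _‖ < 1
    rw [e, ← map_sub, norm_algEquiv]
    exact hU P
  refine exists_addEquiv_prod_of_cocycle (fun P ↦ Subtype.ext ?_) ?_ ?_ ι hι hsub hsmul κ ?_ ?_
  · exact htors P
  · exact HasEnoughRootsOfUnity.natCard_rootsOfUnity (PadicAlgCl ℓ) p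
  · obtain ⟨P, hP, hns⟩ := hL.exists_nsmul_eq_zero_not_isSmooth
      (hp.odd_of_ne_two (by omega)) hp3 hpL
    intro htop
    have hmem : (p : ℤ) • P = 0 := by rw [natCast_zsmul, hP]
    have : (⟨P, hmem⟩ : Torsion W p) ∈ hL.smoothPoints.addSubgroupOf (Torsion W p) :=
      htop ▸ AddSubgroup.mem_top _
    exact hns this
  · intro P
    obtain ⟨S, hS, hSP⟩ := exists_finset_coord W P
    refine exists_zsmul_kummer hpZ hc hβ hκ (c := fun σ ↦ ι ⟨σ • P - P, hsub σ P⟩) (fun σ τ ↦ ?_)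
      hS fun σ τ h ↦ ?_
    · have hmem : σ • (τ • P - P) ∈ hL.smoothPoints.addSubgroupOf (Torsion W p) := by
        have : IsSmooth (σ • ((τ • P - P : Torsion W p) : GeomPoints W)) :=
          isSmooth_smul.mpr (hsub τ P)
        exact this
      rw [← hsmul σ ⟨τ • P - P, hsub τ P⟩ hmem, ← map_add]
      refine congrArg ι (Subtype.ext ?_)
      change (σ * τ) • P - P = σ • (τ • P - P) + (σ • P - P)
      rw [smul_sub, mul_smul, sub_add_sub_cancel]
    · have : σ • P = τ • P := Subtype.ext (hSP σ τ h)
      simp only [this]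
  · intro P hP
    exact Subtype.ext (eq_zero_of_fixed hW he hpe hp.ne_zero hpK hc (htors P)
      fun σ ↦ congrArg Subtype.val (hP σ))

/-- An isomorphism of curves over `K` induces an isomorphism of Galois modules of torsion points. -/
theorem exists_torsion_addEquiv_of_smul_eq {K : Type*} [Field K] {E W : WeierstrassCurve K}
    {C : VariableChange K} (h : C • E = W) (n : ℕ) :
    ∃ φ : Torsion W n ≃+ Torsion E n,
      ∀ (σ : AlgebraicClosure K ≃ₐ[K] AlgebraicClosure K) (P : Torsion W n),
        φ (σ • P) = σ • φ P := by
  classical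
  have h' : C.map (algebraMap K (AlgebraicClosure K)) • E.baseChange (AlgebraicClosure K) =
      W.baseChange (AlgebraicClosure K) := by
    rw [← h]
    exact (E.map_variableChange C (algebraMap K (AlgebraicClosure K)))
  let ψ : GeomPoints W ≃+ GeomPoints E := VariableChange.pointEquiv h'
  have hψ : ∀ (σ : AlgebraicClosure K ≃ₐ[K] AlgebraicClosure K) (P : GeomPoints W),
      ψ (σ • P) = σ • ψ P := fun σ P ↦ by
    rcases P with _ | ⟨x, y, hxy⟩
    · change ψ (σ • 0) = σ • ψ 0
      rw [smul_zero, _root_.map_zero, smul_zero]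
    · refine (Affine.Point.some.injEq ..).mpr ⟨?_, ?_⟩ <;>
      simp [VariableChange.map]
  have hmem : ∀ P : GeomPoints W, P ∈ Torsion W n ↔ ψ P ∈ Torsion E n := fun P ↦ by
    change (n : ℤ) • P = 0 ↔ (n : ℤ) • ψ P = 0
    rw [← map_zsmul, EmbeddingLike.map_eq_zero_iff]
  refine ⟨{ toFun := fun P ↦ ⟨ψ P, (hmem P).mp P.2⟩
            invFun := fun P ↦ ⟨ψ.symm P, (hmem _).mpr (by rw [ψ.apply_symm_apply]; exact P.2)⟩
            left_inv := fun P ↦ Subtype.ext (ψ.symm_apply_apply _)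
            right_inv := fun P ↦ Subtype.ext (ψ.apply_symm_apply _)
            map_add' := fun P Q ↦ Subtype.ext (map_add ψ _ _) },
    fun σ P ↦ Subtype.ext (hψ σ P)⟩

end TateCurve

end

/-! ### Comparison of two Tate curves -/

theorem proposition5p4 {ℓ p : ℕ} [Fact ℓ.Prime] (hp : p.Prime) (hℓp : ℓ ≠ p) (hp3 : 3 ≤ p)
    (hℓ : ¬ ℓ ≡ 1 [MOD p])
    (E₁ E₂ : WeierstrassCurve ℚ_[ℓ]) [E₁.IsElliptic] [E₂.IsElliptic] (q₁ q₂ : ℚ_[ℓ])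
    (h₁ : TateCurve.IsTateCurve E₁ q₁) (h₂ : TateCurve.IsTateCurve E₂ q₂)
    (he : ¬ (p : ℤ) ∣ q₁.valuation * q₂.valuation) :
    ∃ φ : TateCurve.Torsion E₁ p ≃+ TateCurve.Torsion E₂ p,
      ∀ (σ : AlgebraicClosure ℚ_[ℓ] ≃ₐ[ℚ_[ℓ]] AlgebraicClosure ℚ_[ℓ])
        (P : TateCurve.Torsion E₁ p), φ (σ • P) = σ • φ P := by
  have : NeZero p := ⟨hp.ne_zero⟩
  have hℓ0 : (ℓ : PadicAlgCl ℓ) ≠ 0 := Nat.cast_ne_zero.mpr (Fact.out (p := ℓ.Prime)).ne_zero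
  obtain ⟨β, hβ⟩ := IsAlgClosed.exists_pow_nat_eq (ℓ : PadicAlgCl ℓ) hp.pos
  have hβ0 : β ≠ 0 := fun h ↦ hℓ0 (by rw [← hβ, h, zero_pow hp.ne_zero])
  have hκ1 : ∀ σ : PadicAlgCl ℓ ≃ₐ[ℚ_[ℓ]] PadicAlgCl ℓ, (σ β / β) ^ p = 1 := fun σ ↦ by
    rw [div_pow, ← map_pow, hβ, map_natCast, div_self hℓ0]
  -- The model depends only on `ℓ`, `p` and the chosen root `β`, not on `E` or `q`. Composing one
  -- identification with the inverse of the other gives the isomorphism.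
  have key : ∀ (E : WeierstrassCurve ℚ_[ℓ]) [E.IsElliptic] (q : ℚ_[ℓ]),
      TateCurve.IsTateCurve E q → ¬ (p : ℤ) ∣ q.valuation →
      ∃ Φ : TateCurve.Torsion E p ≃+ Additive (rootsOfUnity p (PadicAlgCl ℓ)) × ZMod p,
        ∀ (σ : PadicAlgCl ℓ ≃ₐ[ℚ_[ℓ]] PadicAlgCl ℓ) (P : TateCurve.Torsion E p),
          Φ (σ • P) = (σ • (Φ P).1 + (Φ P).2.val •
            Additive.ofMul (rootsOfUnity.mkOfPowEq _ (hκ1 σ)), (Φ P).2) := by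
    intro E _ q h hq
    obtain ⟨C, hC⟩ := h.isom
    have : (TateCurve.equation q).IsElliptic := hC ▸ inferInstance
    have hq0 : 0 ≤ q.valuation := by
      rw [← Padic.norm_le_one_iff_val_nonneg]
      exact h.norm_lt_one.le
    obtain ⟨e, hqe⟩ := Int.eq_ofNat_of_zero_le hq0
    obtain ⟨φ, hφ⟩ := TateCurve.exists_torsion_addEquiv_of_smul_eq hC p
    obtain ⟨Φ, hΦ⟩ := TateCurve.exists_torsion_addEquiv hp hℓp hp3 hℓ
      (TateCurve.isNodal_equation h.norm_lt_one h.ne_zero) (e := e)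
      (by rw [TateCurve.norm_equation_a₆ h.norm_lt_one h.ne_zero,
        Padic.norm_eq_zpow_neg_valuation h.ne_zero, hqe])
      ((hp.coprime_iff_not_dvd).mpr fun hd ↦ hq (by rw [hqe]; exact_mod_cast hd)) hβ
      (κ := fun σ ↦ Additive.ofMul (rootsOfUnity.mkOfPowEq _ (hκ1 σ)))
      (fun σ ↦ (div_mul_cancel₀ _ hβ0).symm)
    refine ⟨φ.symm.trans Φ, fun σ P ↦ ?_⟩
    have : φ.symm (σ • P) = σ • φ.symm P := by
      rw [AddEquiv.symm_apply_eq, hφ, φ.apply_symm_apply]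
    rw [AddEquiv.trans_apply, AddEquiv.trans_apply, this, hΦ]
  obtain ⟨Φ₁, hΦ₁⟩ := key E₁ q₁ h₁ fun h ↦ he (h.mul_right _)
  obtain ⟨Φ₂, hΦ₂⟩ := key E₂ q₂ h₂ fun h ↦ he (h.mul_left _)
  refine ⟨Φ₁.trans Φ₂.symm, fun σ P ↦ ?_⟩
  rw [AddEquiv.trans_apply, AddEquiv.trans_apply, AddEquiv.symm_apply_eq, hΦ₂,
    Φ₂.apply_symm_apply, hΦ₁]
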